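/- Setting. Let $\Theta\subset\mathbb R^d$ be compact with $\theta_0$ in its interior, and let $X_t=\sigma_t(\theta_0)\epsilon_t$, $t\in\mathbb Z$, be strictly stationary and ergodic, where $(\epsilon_t)$ is i.i.d. with density $f$, mean $0$ and variance $1$, $\epsilon_t$ is independent of the past $(X_s)_{s<t}$, and $\sigma_t(\theta)=s(\theta;X_{t-1},X_{t-2},\dots)>0$ for a function $s$, measurable in the past, that does not depend on $t$. Let $\mathcal F_t=\sigma(X_s:s\le t)$. The parameter is identifiable: if $\theta\in\Theta$ and $\sigma_t(\theta)=\sigma_t(\theta_0)$ for all $t$ almost surely, then $\theta=\theta_0$. Let $\tilde\sigma_t(\theta)>0$ ($t\ge1$) be random functions on $\Theta$, jointly measurable (the proxies of $\sigma_t(\theta)$). Fix $\gamma\ge0$ with $\int f^{1+\gamma}<\infty$, put $f_\theta(x\mid\mathcal F_{t-1})=\sigma_t(\theta)^{-1}f(x/\sigma_t(\theta))$, $$q_t(\theta)=\tfrac1\gamma f_\theta^\gamma(X_t\mid\mathcal F_{t-1})-\tfrac1{1+\gamma}\int f_\theta^{1+\gamma}(x\mid\mathcal F_{t-1})\,dx\quad(\gamma>0),\qquad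 q_t(\theta)=\log f_\theta(X_t\mid\mathcal F_{t-1})\quad(\gamma=0),$$ let $\tilde q_t(\theta)$ be the same with $\tilde\sigma_t(\theta)$ in place of $\sigma_t(\theta)$, and put $\tilde Q_n=\sum_{t=1}^n\tilde q_t$. (If $\gamma=0$, the logarithms are assumed finite for all $t$ and all $\theta\in\Theta$, almost surely.) Let $\hat\theta_{\gamma,n}$ be a random vector in $\Theta$ that maximizes $\tilde Q_n$ over $\Theta$. Let $\pi$ be a probability density on $\Theta$ that is positive and continuous at $\theta_0$, with $\int_\Theta\|\theta\|\pi(\theta)\,d\theta<\infty$, and let $$\hat\theta^{EDPE}_{\gamma,n}=\int_\Theta\theta\,e^{\tilde Q_n(\theta)}\pi(\theta)\,d\theta\Big/\int_\Theta e^{\tilde Q_n(\theta)}\pi(\theta)\,d\theta$$ be the posterior mean. Suppose that almost surely all $q_t$ and $\tilde q_t$ are twice continuously differentiable in a common neighbourhood of $\theta_0$. Let $\|\cdot\|$ denote the $l_1$ norm, $\partial$ the gradient and $\partial^2$ the Hessian in $\theta$, and consider the conditions - A1: almost surely all $q_t$ are continuous on $\Theta$, and for each $\theta\in\Theta$ the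 process $(q_t(\theta))_{t\in\mathbb Z}$ is strictly stationary and ergodic; - A2: $E\sup_{\theta\in\Theta}|q_t(\theta)|<\infty$, and $\frac1n\sum_{t=1}^n\sup_{\theta\in\Theta}|q_t(\theta)-\tilde q_t(\theta)|\to0$ a.s.; - A3: $(\partial q_t(\theta_0),\mathcal F_t)_{t\in\mathbb Z}$ is a martingale difference sequence; - A4: $\frac1{\sqrt n}\sum_{t=1}^n\|\partial q_t(\theta_0)-\partial\tilde q_t(\theta_0)\|\to0$ a.s.; - A5: $\frac1n\sum_{t=1}^n\sup_{\theta\in N_1}\|\partial^2q_t(\theta)-\partial^2\tilde q_t(\theta)\|\to0$ a.s. for some neighbourhood $N_1$ of $\theta_0$; - A6: $E\sup_{\theta\in N_2}\|\partial^2q_t(\theta)\|<\infty$ for some neighbourhood $N_2$ of $\theta_0$; - A7: $J_\gamma=-E[\partial^2q_t(\theta_0)]$ and $I_\gamma=E[\partial q_t(\theta_0)\,\partial q_t(\theta_0)^{\mathsf T}]$ exist, and $J_\gamma$ is positive definite. Theorem. Under A1, A2, A5, A6 and A7, $$\sqrt n\,\big(\hat\theta^{EDPE}_{\gamma,n}-\hat\theta_{\gamma,n}\big)\to0\quad\text{almost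 surely.}$$ If A3 and A4 hold as well, then $$\sqrt n\,\big(\hat\theta^{EDPE}_{\gamma,n}-\theta_0\big)\to N\big(0,\;J_\gamma^{-1}I_\gamma J_\gamma^{-1}\big)\quad\text{in distribution.}$$ -/

import Mathlib

open MeasureTheory ProbabilityTheory Filter Topology
open scoped ENNReal

noncomputable section

namespace DPD

/-! ### Derivatives and norms in coordinates -/

/-- The gradient: the vector of first partial derivatives. -/
def grad {d : ℕ} (g : EuclideanSpace ℝ (Fin d) → ℝ) (θ : EuclideanSpace ℝ (Fin d)) :
    EuclideanSpace ℝ (Fin d) :=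
  WithLp.toLp 2 fun i => fderiv ℝ g θ (EuclideanSpace.single i 1)

/-- The matrix of second partial derivatives. -/
def hess {d : ℕ} (g : EuclideanSpace ℝ (Fin d) → ℝ) (θ : EuclideanSpace ℝ (Fin d)) :
    Matrix (Fin d) (Fin d) ℝ :=
  Matrix.of fun i j =>
    fderiv ℝ (fun x => fderiv ℝ g x (EuclideanSpace.single j 1)) θ (EuclideanSpace.single i 1)

/-- The `l₁` norm of a vector. -/
def vecL1 {d : ℕ} (v : EuclideanSpace ℝ (Fin d)) : ℝ := ∑ i, |v i|

/-- The (entrywise) `l₁` norm of a matrix. -/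
def matL1 {d : ℕ} (A : Matrix (Fin d) (Fin d) ℝ) : ℝ := ∑ i, ∑ j, |A i j|

/-! ### Processes indexed by the integers -/

section TimeIndexed

variable {Ω : Type*} [MeasurableSpace Ω]

/-- The real process `Y` is strictly stationary and ergodic: the time shift preserves the law of
the process on the space of two-sided sequences (this is part of `Ergodic`) and is ergodic for
it. -/
def StationaryErgodic (Y : ℤ → Ω → ℝ) (μ : Measure Ω) : Prop :=
  (∀ t, AEMeasurable (Y t) μ) ∧
    Ergodic (fun (y : ℤ → ℝ) (t : ℤ) => y (t + 1)) (μ.map fun ω t => Y t ω)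

/-- The past of `X` strictly before time `t`: the sequence `(X_{t-1}, X_{t-2}, …)`. -/
def past {Ω : Type*} (X : ℤ → Ω → ℝ) (t : ℤ) (ω : Ω) : ℕ → ℝ := fun k => X (t - 1 - k) ω

/-- The σ-algebra `ℱ_t` generated by the `X_s` with `s ≤ t`. -/
@[reducible]
def history {Ω : Type*} (X : ℤ → Ω → ℝ) (t : ℤ) : MeasurableSpace Ω :=
  ⨆ s : Set.Iic t, MeasurableSpace.comap (X s) inferInstance

/-- `{Z_t, ℱ_t}` is a martingale difference sequence: adapted, integrable, and with zero
conditional mean given the preceding σ-algebra. -/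
def MartingaleDifference {E : Type*} [NormedAddCommGroup E] [NormedSpace ℝ E] [CompleteSpace E]
    (Z : ℤ → Ω → E) (ℱ : ℤ → MeasurableSpace Ω) (μ : Measure Ω) : Prop :=
  ∀ t, AEStronglyMeasurable[ℱ t] (Z t) μ ∧ Integrable (Z t) μ ∧ μ[Z t | ℱ (t - 1)] =ᵐ[μ] 0

end TimeIndexed

/-! ### The conditionally heteroscedastic model -/

/-- The conditional standard deviation `σ_t(θ)` given the infinite past of `X`; the model is given
by the function `s`, with `σ_t(θ) = s θ (X_{t-1}, X_{t-2}, …)`. -/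
def sigma {d : ℕ} {Ω : Type*} (s : EuclideanSpace ℝ (Fin d) → (ℕ → ℝ) → ℝ) (X : ℤ → Ω → ℝ)
    (t : ℤ) (θ : EuclideanSpace ℝ (Fin d)) (ω : Ω) : ℝ :=
  s θ (past X t ω)

/-- `X_t = σ_t(θ₀) ε_t` with true parameter `θ₀`: the innovations `ε_t` are i.i.d. with density
`f`, mean zero and unit variance, `ε_t` is independent of the past of `X`, the process `X` is
strictly stationary and ergodic, and different parameters of `Θ` give different conditional
variances from those at `θ₀`. -/
structure HeteroscedasticModel {d : ℕ} {Ω : Type*} [MeasurableSpace Ω] (μ : Measure Ω)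
    (f : ℝ → ℝ) (Θ : Set (EuclideanSpace ℝ (Fin d))) (θ₀ : EuclideanSpace ℝ (Fin d))
    (s : EuclideanSpace ℝ (Fin d) → (ℕ → ℝ) → ℝ) (ε X : ℤ → Ω → ℝ) : Prop where
  density_measurable : Measurable f
  density_nonneg : ∀ x, 0 ≤ f x
  innovation_measurable : ∀ t, Measurable (ε t)
  innovation_indep : iIndepFun ε μ
  innovation_law : ∀ t, μ.map (ε t) = volume.withDensity fun x => ENNReal.ofReal (f x)
  innovation_memLp : ∀ t, MemLp (ε t) 2 μ
  innovation_mean : ∀ t, ∫ ω, ε t ω ∂μ = 0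
  innovation_variance : ∀ t, variance (ε t) μ = 1
  observation_measurable : ∀ t, Measurable (X t)
  scale_measurable : ∀ θ ∈ Θ, Measurable (s θ)
  scale_pos : ∀ᵐ ω ∂μ, ∀ t, ∀ θ ∈ Θ, 0 < sigma s X t θ ω
  innovation_indep_past : ∀ t, IndepFun (ε t) (past X t) μ
  equation : ∀ t, ∀ᵐ ω ∂μ, X t ω = sigma s X t θ₀ ω * ε t ω
  stationary_ergodic : StationaryErgodic X μ
  identifiable : ∀ θ ∈ Θ, (∀ᵐ ω ∂μ, ∀ t, sigma s X t θ ω = sigma s X t θ₀ ω) → θ = θ₀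

/-! ### The density power divergence objective, the posterior and its mean -/

/-- The density `x ↦ v⁻¹ f(x / v)` of `v ε` when `ε` has density `f`; at `v = σ_t(θ)` this is the
conditional density `f_θ(x | ℱ_{t-1})`. -/
def scaleDensity (f : ℝ → ℝ) (v x : ℝ) : ℝ := v⁻¹ * f (x / v)

/-- One summand of the objective function with tuning parameter `γ`, at scale `v` and observation
`x`. -/
def dpdTerm (f : ℝ → ℝ) (γ v x : ℝ) : ℝ :=
  if γ = 0 then Real.log (scaleDensity f v x)
  else 1 / γ * scaleDensity f v x ^ γ - 1 / (1 + γ) * ∫ y, scaleDensity f v y ^ (1 + γ)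

section Objective

variable {d : ℕ} {Ω : Type*}

/-- The summand `q_t(θ)` built from the true conditional standard deviation. -/
def q (f : ℝ → ℝ) (γ : ℝ) (s : EuclideanSpace ℝ (Fin d) → (ℕ → ℝ) → ℝ) (X : ℤ → Ω → ℝ)
    (t : ℤ) (θ : EuclideanSpace ℝ (Fin d)) (ω : Ω) : ℝ :=
  dpdTerm f γ (sigma s X t θ ω) (X t ω)

/-- The feasible summand `q̃_t(θ)`, built from the proxy `σ' t θ` of `σ_t(θ)`. -/
def qProxy (f : ℝ → ℝ) (γ : ℝ) (σ' : ℕ → EuclideanSpace ℝ (Fin d) → Ω → ℝ) (X : ℤ → Ω → ℝ)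
    (t : ℕ) (θ : EuclideanSpace ℝ (Fin d)) (ω : Ω) : ℝ :=
  dpdTerm f γ (σ' t θ ω) (X t ω)

/-- The feasible objective function `Q̃_n(θ) = ∑_{t=1}^n q̃_t(θ)`. -/
def QProxy (f : ℝ → ℝ) (γ : ℝ) (σ' : ℕ → EuclideanSpace ℝ (Fin d) → Ω → ℝ) (X : ℤ → Ω → ℝ)
    (n : ℕ) (θ : EuclideanSpace ℝ (Fin d)) (ω : Ω) : ℝ :=
  ∑ t ∈ Finset.Icc 1 n, qProxy f γ σ' X t θ ω

/-- The posterior density on `Θ`, proportional to `exp (Q̃_n(θ)) π(θ)`. -/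
def posterior (f : ℝ → ℝ) (γ : ℝ) (σ' : ℕ → EuclideanSpace ℝ (Fin d) → Ω → ℝ) (X : ℤ → Ω → ℝ)
    (Θ : Set (EuclideanSpace ℝ (Fin d))) (prior : EuclideanSpace ℝ (Fin d) → ℝ)
    (n : ℕ) (ω : Ω) (θ : EuclideanSpace ℝ (Fin d)) : ℝ :=
  Real.exp (QProxy f γ σ' X n θ ω) * prior θ /
    ∫ θ' in Θ, Real.exp (QProxy f γ σ' X n θ' ω) * prior θ'

/-- The expected posterior estimator: the mean of the posterior density. -/
def EDPE (f : ℝ → ℝ) (γ : ℝ) (σ' : ℕ → EuclideanSpace ℝ (Fin d) → Ω → ℝ) (X : ℤ → Ω → ℝ)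
    (Θ : Set (EuclideanSpace ℝ (Fin d))) (prior : EuclideanSpace ℝ (Fin d) → ℝ)
    (n : ℕ) (ω : Ω) : EuclideanSpace ℝ (Fin d) :=
  ∫ θ in Θ, posterior f γ σ' X Θ prior n ω θ • θ

end Objective

/-- A minimum density power divergence estimator: random vectors `est n` with values in `Θ` that
maximize the feasible objective function over `Θ`. -/
def IsMDPDE {d : ℕ} {Ω : Type*} [MeasurableSpace Ω] (μ : Measure Ω) (f : ℝ → ℝ) (γ : ℝ)
    (σ' : ℕ → EuclideanSpace ℝ (Fin d) → Ω → ℝ) (X : ℤ → Ω → ℝ)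
    (Θ : Set (EuclideanSpace ℝ (Fin d))) (est : ℕ → Ω → EuclideanSpace ℝ (Fin d)) : Prop :=
  ∀ n, AEMeasurable (est n) μ ∧
    ∀ᵐ ω ∂μ, est n ω ∈ Θ ∧ IsMaxOn (fun θ => QProxy f γ σ' X n θ ω) Θ (est n ω)

/-- A prior density on `Θ`. -/
structure IsPriorDensity {d : ℕ} (Θ : Set (EuclideanSpace ℝ (Fin d)))
    (prior : EuclideanSpace ℝ (Fin d) → ℝ) : Prop where
  measurable : Measurable prior
  nonneg : ∀ θ, 0 ≤ prior θ
  integrable : IntegrableOn prior Θ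
  integral_eq_one : ∫ θ in Θ, prior θ = 1

/-! ### The regularity conditions

They are stated for a family `q t θ` (with `t` an integer) and a family `q' t θ` (with `t ≥ 1`).
Suprema are taken in `[0, ∞]`. Expectations that do not depend on the time by stationarity are
taken at time `0`. -/

section Conditions

variable {d : ℕ} {Ω : Type*} [MeasurableSpace Ω]

/-- Near `θ₀` both families are twice continuously differentiable in the parameter, so that the
derivatives in the conditions below exist. -/
def Smooth (μ : Measure Ω) (θ₀ : EuclideanSpace ℝ (Fin d))
    (q : ℤ → EuclideanSpace ℝ (Fin d) → Ω → ℝ) (q' : ℕ → EuclideanSpace ℝ (Fin d) → Ω → ℝ) :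
    Prop :=
  ∃ U : Set (EuclideanSpace ℝ (Fin d)), IsOpen U ∧ θ₀ ∈ U ∧
    ∀ᵐ ω ∂μ, (∀ t, ContDiffOn ℝ 2 (fun θ => q t θ ω) U) ∧
      ∀ t, 1 ≤ t → ContDiffOn ℝ 2 (fun θ => q' t θ ω) U

def A1 (μ : Measure Ω) (Θ : Set (EuclideanSpace ℝ (Fin d)))
    (q : ℤ → EuclideanSpace ℝ (Fin d) → Ω → ℝ) : Prop :=
  (∀ᵐ ω ∂μ, ∀ t, ContinuousOn (fun θ => q t θ ω) Θ) ∧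
    ∀ θ ∈ Θ, StationaryErgodic (fun t => q t θ) μ

def A2 (μ : Measure Ω) (Θ : Set (EuclideanSpace ℝ (Fin d)))
    (q : ℤ → EuclideanSpace ℝ (Fin d) → Ω → ℝ) (q' : ℕ → EuclideanSpace ℝ (Fin d) → Ω → ℝ) :
    Prop :=
  ∫⁻ ω, ⨆ θ ∈ Θ, ENNReal.ofReal |q 0 θ ω| ∂μ < ∞ ∧
    ∀ᵐ ω ∂μ, Tendsto (fun n : ℕ => (n : ℝ≥0∞)⁻¹ *
      ∑ t ∈ Finset.Icc 1 n, ⨆ θ ∈ Θ, ENNReal.ofReal |q t θ ω - q' t θ ω|) atTop (𝓝 0)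

def A3 (μ : Measure Ω) (X : ℤ → Ω → ℝ) (θ₀ : EuclideanSpace ℝ (Fin d))
    (q : ℤ → EuclideanSpace ℝ (Fin d) → Ω → ℝ) : Prop :=
  MartingaleDifference (fun t ω => grad (fun θ => q t θ ω) θ₀) (history X) μ

def A4 (μ : Measure Ω) (θ₀ : EuclideanSpace ℝ (Fin d))
    (q : ℤ → EuclideanSpace ℝ (Fin d) → Ω → ℝ) (q' : ℕ → EuclideanSpace ℝ (Fin d) → Ω → ℝ) :
    Prop :=
  ∀ᵐ ω ∂μ, Tendsto (fun n : ℕ => (√(n : ℝ))⁻¹ *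
    ∑ t ∈ Finset.Icc 1 n, vecL1 (grad (fun θ => q t θ ω) θ₀ - grad (fun θ => q' t θ ω) θ₀))
      atTop (𝓝 0)

def A5 (μ : Measure Ω) (θ₀ : EuclideanSpace ℝ (Fin d))
    (q : ℤ → EuclideanSpace ℝ (Fin d) → Ω → ℝ) (q' : ℕ → EuclideanSpace ℝ (Fin d) → Ω → ℝ) :
    Prop :=
  ∃ N ∈ 𝓝 θ₀, ∀ᵐ ω ∂μ, Tendsto (fun n : ℕ => (n : ℝ≥0∞)⁻¹ *
    ∑ t ∈ Finset.Icc 1 n, ⨆ θ ∈ N, ENNReal.ofReal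
      (matL1 (hess (fun θ => q t θ ω) θ - hess (fun θ => q' t θ ω) θ))) atTop (𝓝 0)

def A6 (μ : Measure Ω) (θ₀ : EuclideanSpace ℝ (Fin d))
    (q : ℤ → EuclideanSpace ℝ (Fin d) → Ω → ℝ) : Prop :=
  ∃ N ∈ 𝓝 θ₀, ∫⁻ ω, ⨆ θ ∈ N, ENNReal.ofReal (matL1 (hess (fun θ => q 0 θ ω) θ)) ∂μ < ∞

/-- The matrix `𝒥 = -E[∂²q_t(θ₀)]`. -/
def matJ (μ : Measure Ω) (θ₀ : EuclideanSpace ℝ (Fin d))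
    (q : ℤ → EuclideanSpace ℝ (Fin d) → Ω → ℝ) : Matrix (Fin d) (Fin d) ℝ :=
  Matrix.of fun i j => -∫ ω, hess (fun θ => q 0 θ ω) θ₀ i j ∂μ

/-- The matrix `ℐ = E[∂q_t(θ₀) ∂q_t(θ₀)ᵀ]`. -/
def matI (μ : Measure Ω) (θ₀ : EuclideanSpace ℝ (Fin d))
    (q : ℤ → EuclideanSpace ℝ (Fin d) → Ω → ℝ) : Matrix (Fin d) (Fin d) ℝ :=
  Matrix.of fun i j =>
    ∫ ω, grad (fun θ => q 0 θ ω) θ₀ i * grad (fun θ => q 0 θ ω) θ₀ j ∂μ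

def A7 (μ : Measure Ω) (θ₀ : EuclideanSpace ℝ (Fin d))
    (q : ℤ → EuclideanSpace ℝ (Fin d) → Ω → ℝ) : Prop :=
  (∀ i j, Integrable (fun ω => hess (fun θ => q 0 θ ω) θ₀ i j) μ) ∧
    (∀ i j, Integrable
      (fun ω => grad (fun θ => q 0 θ ω) θ₀ i * grad (fun θ => q 0 θ ω) θ₀ j) μ) ∧
    (matJ μ θ₀ q).PosDef

end Conditions

end DPD

end

open DPD

/-! Along almost every path the argument is deterministic, and probability only supplies the
hypotheses of that deterministic part, which are collected in `QuadraticPeak`.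

*Consistency.* Each `q_t(θ)`, each of its parameter derivatives, and each countable supremum of such
quantities is a fixed measurable functional of the shifted path of `X`, so that Birkhoff's theorem
applies (`IsStationaryFunctional.ae_tendsto_average`). Dominated convergence on small balls turns
this into a local uniform law of large numbers (`exists_ball_ae_eventually_sum_abs_sub_le`). Given
the past, the innovation has density `f`, and the power divergence between `f` and a rescaled copy
of it is nonnegative, and zero only for equal scales; identifiability then makes `θ₀` the unique
maximizer of `E q_0` (`integral_q_lt`). By compactness the objective function is, away from `θ₀`,
smaller than at `θ₀` by an amount of order `n`, and by the law of large numbers for the Hessians its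
gradient near `θ₀` is that of a quadratic function with Hessian `-n J` (`ae_quadraticPeak`).

*Laplace's method.* Centre at the maximizer and rescale by `√n`. The posterior weights converge to
the Gaussian weight `exp (-⟪u, J u⟫ / 2)`, with a Gaussian bound near `θ₀` and an exponentially small
remainder elsewhere. Since the Gaussian weight is centred, the posterior mean differs from the
maximizer by `o(1 / √n)` (`QuadraticPeak.tendsto_sqrt_smul_posteriorMean_sub`).

*Asymptotic normality.* The gradient vanishes at the maximizer, which makes the maximizer, up to
smaller terms, `J⁻¹` applied to the normalized score
(`QuadraticPeak.eventually_norm_sqrt_smul_sub_le`). The score is a sum of stationary ergodic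
martingale differences. Its normalized sums have Gaussian limits by McLeish's argument: the products
`∏ (1 + i Y_k / √n)`, stopped when the quadratic variation becomes large, have mean one and are
uniformly integrable, and they differ from `exp (i ∑ Y_k / √n)` by a factor that tends to
`exp (v / 2)` (`tendsto_integral_exp_sum_martingaleDifference`). Slutsky's theorem concludes. -/

/-! ### Birkhoff's pointwise ergodic theorem -/

section Birkhoff

variable {α : Type*}

/-- The running maximum `max_{1 ≤ k ≤ n + 1} ∑_{j < k} φ (T^j x)` of the Birkhoff sums, through
the recursion it satisfies. -/
def maxBirkhoffSum (T : α → α) (φ : α → ℝ) : ℕ → α → ℝ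
  | 0, x => φ x
  | n + 1, x => φ x + max 0 (maxBirkhoffSum T φ n (T x))

theorem maxBirkhoffSum_le_succ (T : α → α) (φ : α → ℝ) (n : ℕ) (x : α) :
    maxBirkhoffSum T φ n x ≤ maxBirkhoffSum T φ (n + 1) x := by
  induction n generalizing x with
  | zero => simp [maxBirkhoffSum]
  | succ n ih =>
    rw [maxBirkhoffSum, maxBirkhoffSum]
    have := ih (T x)
    gcongr

theorem maxBirkhoffSum_monotone (T : α → α) (φ : α → ℝ) (x : α) :
    Monotone fun n => maxBirkhoffSum T φ n x :=
  monotone_nat_of_le_succ fun n => maxBirkhoffSum_le_succ T φ n x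

theorem birkhoffSum_le_maxBirkhoffSum (T : α → α) (φ : α → ℝ) (n : ℕ) (x : α) :
    birkhoffSum T φ (n + 1) x ≤ maxBirkhoffSum T φ n x := by
  induction n generalizing x with
  | zero => simp [maxBirkhoffSum]
  | succ n ih =>
    rw [birkhoffSum_succ', maxBirkhoffSum]
    gcongr
    exact (ih (T x)).trans (le_max_right _ _)

variable [MeasurableSpace α] {P : Measure α} {T : α → α} {φ : α → ℝ}

theorem measurable_maxBirkhoffSum (hT : Measurable T) (hφ : Measurable φ) (n : ℕ) :
    Measurable (maxBirkhoffSum T φ n) := by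
  induction n with
  | zero => exact hφ
  | succ n ih => exact hφ.add (measurable_const.max (ih.comp hT))

theorem integrable_maxBirkhoffSum (hT : MeasurePreserving T P P) (hφ : Integrable φ P) (n : ℕ) :
    Integrable (maxBirkhoffSum T φ n) P := by
  induction n with
  | zero => exact hφ
  | succ n ih =>
    exact hφ.add (((integrable_zero _ _ _).sup (hT.integrable_comp_of_integrable ih)))

/-- If `φ` has negative mean, its Birkhoff sums along an ergodic map are almost surely bounded
above. The set where they are not is invariant, and there the increments
`M (n + 1) x - M n (T x)` of the running maxima, whose integrals are nonnegative, tend to `φ`. -/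
theorem Ergodic.ae_bddAbove_birkhoffSum (hT : Ergodic T P)
    (hφm : Measurable φ) (hφ : Integrable φ P) (hneg : ∫ x, φ x ∂P < 0) :
    ∀ᵐ x ∂P, ∃ C, ∀ n, birkhoffSum T φ n x ≤ C := by
  set M := maxBirkhoffSum T φ with hM
  set A : Set α := {x | BddAbove (Set.range fun n => M n x)} with hA
  have hAm : MeasurableSet A :=
    measurableSet_bddAbove_range fun n => measurable_maxBirkhoffSum hT.measurable hφm n
  have hinv : T ⁻¹' A = A := by
    ext x
    simp only [hA, Set.mem_preimage, Set.mem_ofPred_eq]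
    constructor
    · rintro ⟨C, hC⟩
      refine ⟨φ x + max 0 C, ?_⟩
      rintro _ ⟨n, rfl⟩
      refine (maxBirkhoffSum_le_succ T φ n x).trans ?_
      rw [maxBirkhoffSum]
      gcongr
      exact hC ⟨n, rfl⟩
    · rintro ⟨C, hC⟩
      refine ⟨C - φ x, ?_⟩
      rintro _ ⟨n, rfl⟩
      have h1 : M (n + 1) x ≤ C := hC ⟨n + 1, rfl⟩
      have h2 : M (n + 1) x = φ x + max 0 (M n (T x)) := rfl
      have := le_max_right 0 (M n (T x))
      simp only
      linarith
  rcases hT.ae_mem_or_ae_notMem hAm hinv with h | h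
  · filter_upwards [h] with x ⟨C, hC⟩
    refine ⟨max 0 C, fun n => ?_⟩
    cases n with
    | zero => simp
    | succ n =>
      exact (birkhoffSum_le_maxBirkhoffSum T φ n x).trans ((hC ⟨n, rfl⟩).trans (le_max_right _ _))
  · exfalso
    have hint := integrable_maxBirkhoffSum hT.toMeasurePreserving hφ
    have hintT : ∀ n, Integrable (fun x => M n (T x)) P := fun n =>
      hT.toMeasurePreserving.integrable_comp_of_integrable (hint n)
    have hnonneg : ∀ n, 0 ≤ ∫ x, (M (n + 1) x - M n (T x)) ∂P := by
      intro n
      rw [integral_sub (hint _) (hintT n)]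
      have : ∫ x, M n (T x) ∂P = ∫ x, M n x ∂P := by
        have h := integral_map (μ := P) hT.measurable.aemeasurable (f := M n)
          (by rw [hT.map_eq]; exact (hint n).aestronglyMeasurable)
        rw [hT.map_eq] at h
        exact h.symm
      rw [this, sub_nonneg]
      exact integral_mono (hint n) (hint _) fun x => maxBirkhoffSum_le_succ T φ n x
    have hlim : Tendsto (fun n => ∫ x, (M (n + 1) x - M n (T x)) ∂P) atTop
        (𝓝 (∫ x, φ x ∂P)) := by
      have hφT : Integrable (fun x => φ (T x)) P :=
        hT.toMeasurePreserving.integrable_comp_of_integrable hφ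
      refine tendsto_integral_of_dominated_convergence (fun x => |φ x| + |φ (T x)|)
        (fun n => ((hint _).sub (hintT n)).aestronglyMeasurable)
        (hφ.abs.add hφT.abs) (fun n => ae_of_all _ fun x => ?_) ?_
      · have h1 : M (n + 1) x = φ x + max 0 (M n (T x)) := rfl
        have h2 : φ (T x) ≤ M n (T x) := maxBirkhoffSum_monotone T φ (T x) (Nat.zero_le n)
        rw [h1, Real.norm_eq_abs]
        have h3 : |max 0 (M n (T x)) - M n (T x)| ≤ |φ (T x)| := by
          rcases le_total 0 (M n (T x)) with h | h
          · simp [max_eq_right h]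
          · rw [max_eq_left h, abs_of_nonneg (by linarith)]
            have := neg_abs_le (φ (T x))
            linarith
        calc _ = |φ x + (max 0 (M n (T x)) - M n (T x))| := by ring_nf
          _ ≤ _ := (abs_add_le _ _).trans (by gcongr)
      · filter_upwards [h] with x hx
        have hx' : T x ∉ A := by
          change x ∉ T ⁻¹' A
          rwa [hinv]
        have htop : Tendsto (fun n => M n (T x)) atTop atTop :=
          tendsto_atTop_atTop_of_monotone (maxBirkhoffSum_monotone T φ (T x)) fun b => by
            by_contra! hb
            exact hx' ⟨b, by rintro _ ⟨n, rfl⟩; exact (hb n).le⟩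
        refine tendsto_const_nhds.congr' ?_
        filter_upwards [htop.eventually_ge_atTop 0] with n hn
        have h1 : M (n + 1) x = φ x + max 0 (M n (T x)) := rfl
        rw [h1, max_eq_right hn]
        ring
    exact absurd (ge_of_tendsto' hlim hnonneg) (not_le.2 hneg)

theorem Ergodic.ae_eventually_birkhoffSum_le [IsProbabilityMeasure P] (hT : Ergodic T P)
    (hφm : Measurable φ) (hφ : Integrable φ P) {ε : ℝ} (hε : 0 < ε) :
    ∀ᵐ x ∂P, ∀ᶠ n : ℕ in atTop, (n : ℝ)⁻¹ * birkhoffSum T φ n x ≤ ∫ x, φ x ∂P + ε := by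
  set c := ∫ x, φ x ∂P + ε / 2 with hc
  have hint : Integrable (fun x => φ x - c) P := hφ.sub (integrable_const _)
  have := hT.ae_bddAbove_birkhoffSum (hφm.sub_const c) hint
    (by rw [integral_sub hφ (integrable_const _)]; simp [hc, hε])
  filter_upwards [this] with x ⟨C, hC⟩
  have hlim : Tendsto (fun n : ℕ => (n : ℝ)⁻¹ * C) atTop (𝓝 0) := by
    simpa using (tendsto_inv_atTop_zero.comp tendsto_natCast_atTop_atTop).mul_const C
  filter_upwards [hlim.eventually_le_const (half_pos hε), eventually_gt_atTop 0] with n hn hn0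
  have hn0' : (0 : ℝ) < n := by exact_mod_cast hn0
  have h1 : birkhoffSum T (fun x => φ x - c) n x = birkhoffSum T φ n x - n * c := by
    simp [birkhoffSum]
  have h2 := hC n
  rw [h1] at h2
  have h3 : (n : ℝ)⁻¹ * (birkhoffSum T φ n x - n * c) ≤ (n : ℝ)⁻¹ * C := by gcongr
  have h4 : (n : ℝ)⁻¹ * (birkhoffSum T φ n x - n * c) = (n : ℝ)⁻¹ * birkhoffSum T φ n x - c := by
    field_simp
  linarith

/-- **Birkhoff's ergodic theorem** for an ergodic map. -/
theorem Ergodic.ae_tendsto_birkhoffSum [IsProbabilityMeasure P] (hT : Ergodic T P)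
    (hφm : Measurable φ) (hφ : Integrable φ P) :
    ∀ᵐ x ∂P, Tendsto (fun n : ℕ => (n : ℝ)⁻¹ * birkhoffSum T φ n x) atTop
      (𝓝 (∫ x, φ x ∂P)) := by
  have h1 : ∀ᵐ x ∂P, ∀ k : ℕ, ∀ᶠ n : ℕ in atTop,
      (n : ℝ)⁻¹ * birkhoffSum T φ n x ≤ ∫ x, φ x ∂P + 1 / ((k : ℝ) + 1) :=
    ae_all_iff.2 fun k => hT.ae_eventually_birkhoffSum_le hφm hφ (by positivity)
  have h2 : ∀ᵐ x ∂P, ∀ k : ℕ, ∀ᶠ n : ℕ in atTop,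
      (n : ℝ)⁻¹ * birkhoffSum T (-φ) n x ≤ ∫ x, (-φ) x ∂P + 1 / ((k : ℝ) + 1) :=
    ae_all_iff.2 fun k => hT.ae_eventually_birkhoffSum_le hφm.neg hφ.neg (by positivity)
  filter_upwards [h1, h2] with x hx1 hx2
  refine Metric.tendsto_nhds.2 fun ε hε => ?_
  obtain ⟨k, hk⟩ := exists_nat_one_div_lt hε
  filter_upwards [hx1 k, hx2 k] with n hn1 hn2
  simp only [birkhoffSum_neg, Pi.neg_apply, integral_neg, mul_neg] at hn2
  rw [Real.dist_eq, abs_lt]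
  constructor <;> linarith

end Birkhoff

/-! ### Functionals of a stationary ergodic process -/

section StationaryFunctional

variable {Ω : Type*}

/-- The trajectory of `X` with the time origin moved to `t`. -/
def shiftPath (X : ℤ → Ω → ℝ) (t : ℤ) (ω : Ω) : ℤ → ℝ := fun u => X (u + t) ω

/-- The time shift on trajectories. -/
def timeShift (y : ℤ → ℝ) : ℤ → ℝ := fun u => y (u + 1)

theorem measurable_timeShift : Measurable timeShift :=
  measurable_pi_lambda _ fun u => measurable_pi_apply (u + 1)

theorem timeShift_shiftPath (X : ℤ → Ω → ℝ) (t : ℤ) (ω : Ω) :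
    timeShift (shiftPath X t ω) = shiftPath X (t + 1) ω := by
  funext u
  simp only [timeShift, shiftPath]
  congr 1
  ring

theorem timeShift_iterate_shiftPath (X : ℤ → Ω → ℝ) (t : ℤ) (n : ℕ) (ω : Ω) :
    timeShift^[n] (shiftPath X t ω) = shiftPath X (t + n) ω := by
  induction n with
  | zero => simp
  | succ n ih =>
    rw [Function.iterate_succ_apply', ih, timeShift_shiftPath]
    push_cast
    ring_nf

theorem shiftPath_zero_eq (X : ℤ → Ω → ℝ) : shiftPath X 0 = fun ω t => X t ω := by
  funext ω u
  simp [shiftPath]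

variable [MeasurableSpace Ω] {μ : Measure Ω} {X : ℤ → Ω → ℝ}

theorem aemeasurable_shiftPath (hX : StationaryErgodic X μ) (t : ℤ) :
    AEMeasurable (shiftPath X t) μ :=
  aemeasurable_pi_lambda _ fun u => hX.1 (u + t)

theorem ergodic_timeShift (hX : StationaryErgodic X μ) :
    Ergodic timeShift (μ.map (shiftPath X 0)) := by
  rw [shiftPath_zero_eq]
  exact hX.2

theorem map_shiftPath (hX : StationaryErgodic X μ) (t : ℤ) :
    μ.map (shiftPath X t) = μ.map (shiftPath X 0) := by
  have hstep : ∀ t, μ.map (shiftPath X (t + 1)) = (μ.map (shiftPath X t)).map timeShift := by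
    intro t
    rw [AEMeasurable.map_map_of_aemeasurable measurable_timeShift.aemeasurable
      (aemeasurable_shiftPath hX t)]
    congr 1
    funext ω
    exact (timeShift_shiftPath X t ω).symm
  have hinj : ∀ t, μ.map (shiftPath X (t + 1)) = μ.map (shiftPath X 0) →
      μ.map (shiftPath X t) = μ.map (shiftPath X 0) := by
    intro t ht
    -- the shift is invertible, so its action on measures is injective
    have hm : Measurable fun (y : ℤ → ℝ) (u : ℤ) => y (u - 1) :=
      measurable_pi_lambda _ fun u => measurable_pi_apply (u - 1)
    have hback : ∀ ν : Measure (ℤ → ℝ), (ν.map timeShift).map (fun y u => y (u - 1)) = ν := by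
      intro ν
      rw [Measure.map_map hm measurable_timeShift]
      convert Measure.map_id using 2
      funext y u
      simp [timeShift]
    rw [← hback (μ.map (shiftPath X t)), ← hstep, ht]
    conv_rhs => rw [← hback (μ.map (shiftPath X 0))]
    rw [(ergodic_timeShift hX).map_eq]
  induction t using Int.induction_on with
  | zero => rfl
  | succ n ih => rw [hstep, ih, (ergodic_timeShift hX).map_eq]
  | pred n ih => exact hinj _ (by simpa using ih)

/-- `Y` is, up to null sets, a fixed measurable functional of the trajectory of `X` seen from the
current time. For stationary ergodic `X`, such a `Y` is itself stationary and ergodic. -/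
def IsStationaryFunctional {E : Type*} [MeasurableSpace E] (X : ℤ → Ω → ℝ) (μ : Measure Ω)
    (Y : ℤ → Ω → E) : Prop :=
  ∃ g : (ℤ → ℝ) → E, Measurable g ∧ ∀ t, ∀ᵐ ω ∂μ, Y t ω = g (shiftPath X t ω)

namespace IsStationaryFunctional

variable {E F : Type*} [MeasurableSpace E] [MeasurableSpace F]

theorem comp {Y : ℤ → Ω → E} (hY : IsStationaryFunctional X μ Y) {h : E → F}
    (hh : Measurable h) : IsStationaryFunctional X μ fun t ω => h (Y t ω) := by
  obtain ⟨g, hg, hgY⟩ := hY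
  exact ⟨fun y => h (g y), hh.comp hg, fun t => (hgY t).mono fun ω hω => congrArg h hω⟩

theorem prodMk {Y : ℤ → Ω → E} {Z : ℤ → Ω → F} (hY : IsStationaryFunctional X μ Y)
    (hZ : IsStationaryFunctional X μ Z) :
    IsStationaryFunctional X μ fun t ω => (Y t ω, Z t ω) := by
  obtain ⟨g, hg, hgY⟩ := hY
  obtain ⟨k, hk, hkZ⟩ := hZ
  exact ⟨fun y => (g y, k y), hg.prodMk hk, fun t => by
    filter_upwards [hgY t, hkZ t] with ω h1 h2
    rw [h1, h2]⟩

theorem comp₂ {G : Type*} [MeasurableSpace G] {Y : ℤ → Ω → E} {Z : ℤ → Ω → F}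
    (hY : IsStationaryFunctional X μ Y) (hZ : IsStationaryFunctional X μ Z) {h : E → F → G}
    (hh : Measurable (Function.uncurry h)) :
    IsStationaryFunctional X μ fun t ω => h (Y t ω) (Z t ω) :=
  (hY.prodMk hZ).comp hh

theorem pi {ι : Type*} [Countable ι] {Y : ι → ℤ → Ω → E}
    (hY : ∀ i, IsStationaryFunctional X μ (Y i)) :
    IsStationaryFunctional X μ fun t ω i => Y i t ω := by
  choose g hg hgY using hY
  refine ⟨fun y i => g i y, measurable_pi_lambda _ hg, fun t => ?_⟩
  filter_upwards [ae_all_iff.2 fun i => hgY i t] with ω hω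
  funext i
  exact hω i

theorem congr {Y Z : ℤ → Ω → E} (hY : IsStationaryFunctional X μ Y)
    (h : ∀ t, ∀ᵐ ω ∂μ, Y t ω = Z t ω) : IsStationaryFunctional X μ Z := by
  obtain ⟨g, hg, hgY⟩ := hY
  exact ⟨g, hg, fun t => by
    filter_upwards [hgY t, h t] with ω h1 h2
    rw [← h2, h1]⟩

theorem of_tendsto {Y : ℕ → ℤ → Ω → ℝ} {Z : ℤ → Ω → ℝ}
    (hY : ∀ n, IsStationaryFunctional X μ (Y n))
    (h : ∀ t, ∀ᵐ ω ∂μ, Tendsto (fun n => Y n t ω) atTop (𝓝 (Z t ω))) :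
    IsStationaryFunctional X μ Z := by
  have := (pi hY).comp (h := fun u : ℕ → ℝ => limsup u atTop)
    (Measurable.limsup fun n => measurable_pi_apply n)
  exact this.congr fun t => (h t).mono fun ω hω => hω.limsup_eq

theorem biSup {ι : Type*} {D : Set ι} (hD : D.Countable) {Y : ι → ℤ → Ω → ℝ≥0∞}
    (hY : ∀ i ∈ D, IsStationaryFunctional X μ (Y i)) :
    IsStationaryFunctional X μ fun t ω => ⨆ i ∈ D, Y i t ω := by
  have : Countable D := hD.to_subtype
  have := (pi fun i : D => hY i i.2).comp (h := fun u : D → ℝ≥0∞ => ⨆ i, u i)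
    (Measurable.iSup fun n => measurable_pi_apply n)
  exact this.congr fun t => ae_of_all _ fun ω => iSup_subtype' (f := fun i _ => Y i t ω) |>.symm

theorem aemeasurable {Y : ℤ → Ω → E} (hX : StationaryErgodic X μ)
    (hY : IsStationaryFunctional X μ Y) (t : ℤ) : AEMeasurable (Y t) μ := by
  obtain ⟨g, hg, hgY⟩ := hY
  exact (hg.comp_aemeasurable (aemeasurable_shiftPath hX t)).congr
    ((hgY t).mono fun ω h => h.symm)

theorem map_eq {Y : ℤ → Ω → E} (hX : StationaryErgodic X μ)
    (hY : IsStationaryFunctional X μ Y) (t : ℤ) : μ.map (Y t) = μ.map (Y 0) := by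
  obtain ⟨g, hg, hgY⟩ := hY
  have : ∀ t, μ.map (Y t) = (μ.map (shiftPath X t)).map g := fun t => by
    rw [AEMeasurable.map_map_of_aemeasurable hg.aemeasurable (aemeasurable_shiftPath hX t)]
    exact Measure.map_congr (hgY t)
  rw [this, this 0, map_shiftPath hX]

theorem identDistrib {Y : ℤ → Ω → E} (hX : StationaryErgodic X μ)
    (hY : IsStationaryFunctional X μ Y) (t : ℤ) : IdentDistrib (Y t) (Y 0) μ μ :=
  ⟨hY.aemeasurable hX t, hY.aemeasurable hX 0, hY.map_eq hX t⟩

/-- The strong law of large numbers for functionals of a stationary ergodic process. -/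
theorem ae_tendsto_average [IsProbabilityMeasure μ] {Y : ℤ → Ω → ℝ}
    (hX : StationaryErgodic X μ) (hY : IsStationaryFunctional X μ Y)
    (hint : Integrable (Y 0) μ) :
    ∀ᵐ ω ∂μ, Tendsto (fun n : ℕ => (n : ℝ)⁻¹ * ∑ t ∈ Finset.Icc 1 n, Y t ω) atTop
      (𝓝 (∫ ω, Y 0 ω ∂μ)) := by
  have hY1 := (hY.identDistrib hX 1)
  obtain ⟨g, hg, hgY⟩ := hY
  have hm := aemeasurable_shiftPath hX 1
  have hT : Ergodic timeShift (μ.map (shiftPath X 1)) := by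
    rw [map_shiftPath hX]
    exact ergodic_timeShift hX
  have : IsProbabilityMeasure (μ.map (shiftPath X 1)) := Measure.isProbabilityMeasure_map hm
  have hgi : Integrable g (μ.map (shiftPath X 1)) := by
    rw [integrable_map_measure hg.aestronglyMeasurable hm]
    exact (hY1.integrable_iff.2 hint).congr (hgY 1)
  have hmean : ∫ y, g y ∂(μ.map (shiftPath X 1)) = ∫ ω, Y 0 ω ∂μ := by
    rw [integral_map hm hg.aestronglyMeasurable, ← hY1.integral_eq]
    exact integral_congr_ae ((hgY 1).mono fun ω h => h.symm)
  have hlim := ae_of_ae_map hm (hT.ae_tendsto_birkhoffSum hg hgi)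
  rw [hmean] at hlim
  filter_upwards [hlim, ae_all_iff.2 hgY] with ω hω hgω
  refine hω.congr fun n => ?_
  rw [birkhoffSum, Finset.range_eq_Ico, Finset.sum_Ico_eq_sum_range, Nat.sub_zero,
    ← Finset.Ico_add_one_right_eq_Icc, Finset.sum_Ico_eq_sum_range, Nat.add_sub_cancel]
  congr 1
  refine Finset.sum_congr rfl fun k _ => ?_
  rw [timeShift_iterate_shiftPath, hgω]
  push_cast
  ring_nf

end IsStationaryFunctional

end StationaryFunctional

/-! ### A local uniform law of large numbers -/

section LocalUniform

variable {Ω : Type*} [MeasurableSpace Ω] {μ : Measure Ω} {X : ℤ → Ω → ℝ}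
variable {E : Type*} [PseudoMetricSpace E]

/-- A bound on a countable dense subset of `S ∩ ball a r` extends to all of `S ∩ ball a r`, by
continuity. -/
theorem ofReal_abs_sub_le_biSup {S D : Set E} (hDS : D ⊆ S) (hSD : S ⊆ closure D) {g : E → ℝ}
    (hg : ContinuousOn g S) (a : E) (r : ℝ) {θ : E} (hθ : θ ∈ S ∩ Metric.ball a r) :
    ENNReal.ofReal |g θ - g a| ≤ ⨆ θ' ∈ D ∩ Metric.ball a r, ENNReal.ofReal |g θ' - g a| := by
  have hcl : θ ∈ closure (D ∩ Metric.ball a r) := by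
    rw [Set.inter_comm]
    exact Metric.isOpen_ball.inter_closure ⟨hθ.2, hSD hθ.1⟩
  have hne : (𝓝[D ∩ Metric.ball a r] θ).NeBot := mem_closure_iff_nhdsWithin_neBot.1 hcl
  have hcont : Tendsto (fun θ' => ENNReal.ofReal |g θ' - g a|) (𝓝[D ∩ Metric.ball a r] θ)
      (𝓝 (ENNReal.ofReal |g θ - g a|)) := by
    have h := (hg θ hθ.1).mono_left
      (nhdsWithin_mono θ (Set.inter_subset_left.trans hDS : D ∩ Metric.ball a r ⊆ S))
    exact (ENNReal.continuous_ofReal.tendsto _).comp (h.sub_const (g a)).abs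
  refine le_of_tendsto hcont ?_
  filter_upwards [self_mem_nhdsWithin] with θ' hθ'
  exact le_biSup (fun θ' => ENNReal.ofReal |g θ' - g a|) hθ'

/-- If `Φ t θ` is a functional of a stationary ergodic process, continuous in `θ ∈ S` and with an
integrable envelope, then near any `a ∈ S` the averages of `|Φ t θ - Φ t a|` are uniformly small:
by dominated convergence, the modulus of continuity at `a` has small mean. -/
theorem exists_ball_ae_eventually_sum_abs_sub_le [SecondCountableTopology E] [IsProbabilityMeasure μ]
    (hX : StationaryErgodic X μ) {S : Set E} {Φ : ℤ → E → Ω → ℝ}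
    (hΦ : ∀ θ ∈ S, IsStationaryFunctional X μ fun t => Φ t θ)
    (hcont : ∀ᵐ ω ∂μ, ∀ t, ContinuousOn (fun θ => Φ t θ ω) S)
    (hbound : ∫⁻ ω, ⨆ θ ∈ S, ENNReal.ofReal |Φ 0 θ ω| ∂μ < ∞) {a : E} (ha : a ∈ S)
    {η : ℝ} (hη : 0 < η) :
    ∃ r > 0, ∀ᵐ ω ∂μ, ∀ᶠ n : ℕ in atTop, ∀ θ ∈ S ∩ Metric.ball a r,
      ∑ t ∈ Finset.Icc 1 n, |Φ t θ ω - Φ t a ω| ≤ η * n := by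
  obtain ⟨D, hDS, hDc, hSD⟩ :=
    (TopologicalSpace.IsSeparable.of_separableSpace S).exists_countable_dense_subset
  set w : ℝ → ℤ → Ω → ℝ≥0∞ := fun r t ω =>
    ⨆ θ ∈ D ∩ Metric.ball a r, ENNReal.ofReal |Φ t θ ω - Φ t a ω| with hw
  have hwstat : ∀ r, IsStationaryFunctional X μ (w r) := fun r =>
    .biSup (hDc.mono Set.inter_subset_left) fun θ hθ =>
      (hΦ θ (hDS hθ.1)).comp₂ (hΦ a ha) (h := fun x y => ENNReal.ofReal |x - y|) (by fun_prop)
  have hle : ∀ r ω, w r 0 ω ≤ 2 * ⨆ θ ∈ S, ENNReal.ofReal |Φ 0 θ ω| := by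
    refine fun r ω => iSup₂_le fun θ hθ => ?_
    have h := fun θ hθ => le_biSup (fun θ => ENNReal.ofReal |Φ 0 θ ω|) (i := θ) (s := S) hθ
    calc ENNReal.ofReal |Φ 0 θ ω - Φ 0 a ω| ≤ ENNReal.ofReal (|Φ 0 θ ω| + |Φ 0 a ω|) :=
          ENNReal.ofReal_le_ofReal (abs_sub _ _)
      _ = ENNReal.ofReal |Φ 0 θ ω| + ENNReal.ofReal |Φ 0 a ω| :=
          ENNReal.ofReal_add (abs_nonneg _) (abs_nonneg _)
      _ ≤ _ := by
          rw [two_mul]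
          exact add_le_add (h θ (hDS hθ.1)) (h a ha)
  have hfin : ∫⁻ ω, 2 * ⨆ θ ∈ S, ENNReal.ofReal |Φ 0 θ ω| ∂μ ≠ ∞ := by
    rw [lintegral_const_mul' _ _ (by simp)]
    exact ENNReal.mul_ne_top (by simp) hbound.ne
  have hlim : Tendsto (fun k : ℕ => ∫⁻ ω, w (1 / ((k : ℝ) + 1)) 0 ω ∂μ) atTop (𝓝 0) := by
    rw [← lintegral_zero (μ := μ)]
    refine tendsto_lintegral_of_dominated_convergence' _
      (fun k => (hwstat _).aemeasurable hX 0) (fun k => ae_of_all _ fun ω => hle _ ω) hfin ?_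
    filter_upwards [hcont] with ω hω
    refine ENNReal.tendsto_nhds_zero.2 fun ε hε => ?_
    have hca : Tendsto (fun θ => ENNReal.ofReal |Φ 0 θ ω - Φ 0 a ω|) (𝓝[S] a) (𝓝 0) := by
      have h := (ENNReal.continuous_ofReal.tendsto _).comp
        ((hω 0 a ha).tendsto.sub_const (Φ 0 a ω)).abs
      simpa [Function.comp_def] using h
    obtain ⟨δ, hδ, hδε⟩ := Metric.mem_nhdsWithin_iff.1 (ENNReal.tendsto_nhds_zero.1 hca ε hε)
    have hk := tendsto_one_div_add_atTop_nhds_zero_nat (𝕜 := ℝ)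
    filter_upwards [hk.eventually_lt_const hδ] with k hk
    refine iSup₂_le fun θ hθ => hδε ⟨?_, hDS hθ.1⟩
    exact Metric.ball_subset_ball hk.le hθ.2
  obtain ⟨k, hk⟩ := (hlim.eventually_lt_const (ENNReal.ofReal_pos.2 hη)).exists
  set r : ℝ := 1 / ((k : ℝ) + 1)
  refine ⟨r, by positivity, ?_⟩
  have hwfin : ∀ t, ∀ᵐ ω ∂μ, w r t ω < ∞ := by
    intro t
    have h0 : ∀ᵐ ω ∂μ, w r 0 ω < ∞ :=
      ae_lt_top' ((hwstat r).aemeasurable hX 0) (hk.trans ENNReal.ofReal_lt_top).ne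
    exact ((hwstat r).identDistrib hX t).symm.ae_snd measurableSet_Iio h0
  have hint : Integrable (fun ω => (w r 0 ω).toReal) μ :=
    integrable_toReal_of_lintegral_ne_top ((hwstat r).aemeasurable hX 0)
      (hk.trans ENNReal.ofReal_lt_top).ne
  have hmean : ∫ ω, (w r 0 ω).toReal ∂μ < η := by
    rw [integral_toReal ((hwstat r).aemeasurable hX 0) (hwfin 0)]
    exact (ENNReal.lt_ofReal_iff_toReal_lt (hk.trans ENNReal.ofReal_lt_top).ne).1 hk
  have hstat : IsStationaryFunctional X μ fun t ω => (w r t ω).toReal :=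
    (hwstat r).comp ENNReal.measurable_toReal
  filter_upwards [hstat.ae_tendsto_average hX hint, hcont, ae_all_iff.2 hwfin] with ω h1 h2 h3
  filter_upwards [h1.eventually_lt_const hmean, eventually_gt_atTop 0] with n hn hn0 θ hθ
  have hn0' : (0 : ℝ) < n := by exact_mod_cast hn0
  calc ∑ t ∈ Finset.Icc 1 n, |Φ t θ ω - Φ t a ω|
      ≤ ∑ t ∈ Finset.Icc 1 n, (w r t ω).toReal := by
        refine Finset.sum_le_sum fun t _ => ?_
        rw [← ENNReal.ofReal_le_iff_le_toReal (h3 t).ne]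
        exact ofReal_abs_sub_le_biSup hDS hSD (h2 t) a r hθ
    _ ≤ η * n := by
        rw [inv_mul_lt_iff₀ hn0'] at hn
        linarith

end LocalUniform

/-! ### The density power divergence identifies the parameter -/

section Divergence

/-- The integrand of the density power divergence of a density with value `b` from one with value
`a`; at `γ = 0`, that of the Kullback-Leibler divergence. The terms are arranged so as to make it
pointwise nonnegative. -/
noncomputable def divergenceIntegrand (γ a b : ℝ) : ℝ :=
  if γ = 0 then (Real.log a - Real.log b) * a - a + b
  else 1 / γ * ((a ^ γ - b ^ γ) * a) - 1 / (1 + γ) * (a ^ (1 + γ) - b ^ (1 + γ))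

/-- Off the diagonal the integrand is positive: for `γ > 0` this is the strict Bernoulli inequality
for `(a / b) ^ (1 + γ)`, and for `γ = 0` the strict inequality `log x < x - 1`. -/
theorem divergenceIntegrand_pos {γ a b : ℝ} (hγ : 0 ≤ γ) (ha : 0 ≤ a) (hb : 0 ≤ b)
    (h : γ = 0 → a = 0 ∨ 0 < b) (hab : a ≠ b) : 0 < divergenceIntegrand γ a b := by
  unfold divergenceIntegrand
  split_ifs with h0
  · rcases h h0 with rfl | hb'
    · simpa using lt_of_le_of_ne hb hab
    · rcases ha.eq_or_lt with rfl | ha'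
      · simpa using hb'
      · have h1 := Real.log_lt_sub_one_of_pos (div_pos hb' ha') (by
          rw [Ne, div_eq_one_iff_eq ha'.ne']
          exact fun h => hab h.symm)
        rw [Real.log_div hb'.ne' ha'.ne'] at h1
        have h2 := mul_lt_mul_of_pos_right h1 ha'
        have h3 : (b / a - 1) * a = b - a := by field_simp
        linarith
  · have hγ' : 0 < γ := lt_of_le_of_ne hγ (Ne.symm h0)
    have e1 : a ^ (1 + γ) = a ^ γ * a := by
      rw [add_comm, Real.rpow_add_one' ha (by linarith)]
    have e2 : b ^ (1 + γ) = b ^ γ * b := by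
      rw [add_comm, Real.rpow_add_one' hb (by linarith)]
    have key : 0 < a ^ γ * a - (1 + γ) * (b ^ γ * a) + γ * (b ^ γ * b) := by
      rcases hb.eq_or_lt with rfl | hb'
      · rw [Real.zero_rpow hγ'.ne']
        have : 0 < a := lt_of_le_of_ne ha (Ne.symm hab)
        have := Real.rpow_pos_of_pos this γ
        nlinarith [mul_pos this ‹0 < a›]
      · have h1 := one_add_mul_self_lt_rpow_one_add (s := a / b - 1) (p := 1 + γ)
          (by have := div_nonneg ha hb; linarith)
          (by
            rw [Ne, sub_eq_zero, div_eq_one_iff_eq hb'.ne']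
            exact hab) (by linarith)
        rw [add_sub_cancel, Real.div_rpow ha hb, lt_div_iff₀ (Real.rpow_pos_of_pos hb' _), e1,
          e2] at h1
        have h3 : (1 + (1 + γ) * (a / b - 1)) * (b ^ γ * b)
            = (1 + γ) * (b ^ γ * a) - γ * (b ^ γ * b) := by
          field_simp
          ring
        linarith
    rw [e1, e2]
    have h4 : 1 / γ * ((a ^ γ - b ^ γ) * a) - 1 / (1 + γ) * (a ^ γ * a - b ^ γ * b)
        = (a ^ γ * a - (1 + γ) * (b ^ γ * a) + γ * (b ^ γ * b)) / (γ * (1 + γ)) := by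
      field_simp
      ring
    rw [h4]
    positivity

theorem divergenceIntegrand_nonneg {γ a b : ℝ} (hγ : 0 ≤ γ) (ha : 0 ≤ a) (hb : 0 ≤ b)
    (h : γ = 0 → a = 0 ∨ 0 < b) : 0 ≤ divergenceIntegrand γ a b := by
  by_cases hab : a = b
  · simp [divergenceIntegrand, hab]
  · exact (divergenceIntegrand_pos hγ ha hb h hab).le

theorem scaleDensity_nonneg {f : ℝ → ℝ} (hf : ∀ x, 0 ≤ f x) {v : ℝ} (hv : 0 ≤ v) (x : ℝ) :
    0 ≤ scaleDensity f v x :=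
  mul_nonneg (inv_nonneg.2 hv) (hf _)

theorem integrable_scaleDensity {f : ℝ → ℝ} (hf : Integrable f) {v : ℝ} (hv : 0 < v) :
    Integrable (scaleDensity f v) :=
  (hf.comp_div hv.ne').const_mul _

theorem integral_scaleDensity {f : ℝ → ℝ} {v : ℝ} (hv : 0 < v) :
    ∫ x, scaleDensity f v x = ∫ x, f x := by
  simp only [scaleDensity]
  rw [integral_const_mul, Measure.integral_comp_div, abs_of_pos hv, smul_eq_mul,
    inv_mul_cancel_left₀ hv.ne']

theorem integral_sq_mul_scaleDensity {f : ℝ → ℝ} {v : ℝ} (hv : 0 < v) :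
    ∫ x, x ^ 2 * scaleDensity f v x = v ^ 2 * ∫ x, x ^ 2 * f x := by
  have : ∀ x, x ^ 2 * scaleDensity f v x = v * ((x / v) ^ 2 * f (x / v)) := by
    intro x
    simp only [scaleDensity]
    field_simp
  simp_rw [this]
  rw [integral_const_mul, Measure.integral_comp_div (fun y => y ^ 2 * f y), abs_of_pos hv,
    smul_eq_mul]
  ring

theorem integrable_scaleDensity_rpow {f : ℝ → ℝ} (hf : ∀ x, 0 ≤ f x) {p : ℝ}
    (hfp : Integrable fun x => f x ^ p) {v : ℝ} (hv : 0 < v) :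
    Integrable fun x => scaleDensity f v x ^ p := by
  have : ∀ x, scaleDensity f v x ^ p = v⁻¹ ^ p * f (x / v) ^ p := fun x =>
    Real.mul_rpow (inv_nonneg.2 hv.le) (hf _)
  simp_rw [this]
  exact (hfp.comp_div hv.ne').const_mul _

theorem measurable_scaleDensity {f : ℝ → ℝ} (hf : Measurable f) :
    Measurable (Function.uncurry (scaleDensity f)) := by
  unfold scaleDensity Function.uncurry
  fun_prop

theorem measurable_dpdTerm {f : ℝ → ℝ} (hf : Measurable f) (γ : ℝ) :
    Measurable (Function.uncurry (dpdTerm f γ)) := by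
  have h := measurable_scaleDensity hf
  unfold dpdTerm
  simp only [Function.uncurry_def]
  split_ifs
  · exact Real.measurable_log.comp h
  · refine ((h.pow_const γ).const_mul _).sub (Measurable.const_mul ?_ _)
    have : StronglyMeasurable fun v : ℝ => ∫ y, scaleDensity f v y ^ (1 + γ) :=
      StronglyMeasurable.integral_prod_right (f := fun v y => scaleDensity f v y ^ (1 + γ))
        (h.pow_const _).stronglyMeasurable
    exact this.measurable.comp measurable_fst

variable {f : ℝ → ℝ} {γ v w : ℝ}

/-- For the observation `w e` of an innovation `e` with density `f`, the expected loss of objective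
caused by the scale `v` instead of the true `w` is the integrated divergence of the two densities
of the observation. The integral is in the variable `e`, so `f e` appears as
`w * scaleDensity f w (w * e)`. -/
theorem integral_dpdTerm_sub_eq (hf0 : ∀ x, 0 ≤ f x) (hfi : Integrable f) (hf1 : ∫ x, f x = 1)
    (hfγ : Integrable fun x => f x ^ (1 + γ)) (hv : 0 < v) (hw : 0 < w)
    (hint : Integrable fun e => f e * (dpdTerm f γ w (w * e) - dpdTerm f γ v (w * e))) :
    Integrable (fun e => w * divergenceIntegrand γ (scaleDensity f w (w * e))
      (scaleDensity f v (w * e))) ∧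
    ∫ e, w * divergenceIntegrand γ (scaleDensity f w (w * e)) (scaleDensity f v (w * e)) =
      ∫ e, f e * (dpdTerm f γ w (w * e) - dpdTerm f γ v (w * e)) := by
  have hfe : ∀ e, f e = w * scaleDensity f w (w * e) := by
    intro e
    rw [scaleDensity, mul_div_cancel_left₀ _ hw.ne', mul_inv_cancel_left₀ hw.ne']
  have hcomp : ∀ g : ℝ → ℝ, ∫ e, w * g (w * e) = ∫ x, g x := by
    intro g
    rw [integral_const_mul, Measure.integral_comp_mul_left, abs_of_pos (inv_pos.2 hw), smul_eq_mul,
      mul_inv_cancel_left₀ hw.ne']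
  have hcompi : ∀ {g : ℝ → ℝ}, Integrable g → Integrable fun e => w * g (w * e) := fun hg =>
    (hg.comp_mul_left' hw.ne').const_mul w
  have ha := hcompi (integrable_scaleDensity hfi hw)
  have hb := hcompi (integrable_scaleDensity hfi hv)
  have ha1 := (hcomp (scaleDensity f w)).trans ((integral_scaleDensity hw).trans hf1)
  have hb1 := (hcomp (scaleDensity f v)).trans ((integral_scaleDensity hv).trans hf1)
  by_cases h0 : γ = 0
  · have heq : (fun e => w * divergenceIntegrand γ (scaleDensity f w (w * e))
        (scaleDensity f v (w * e))) = fun e =>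
        f e * (dpdTerm f γ w (w * e) - dpdTerm f γ v (w * e))
          - w * scaleDensity f w (w * e) + w * scaleDensity f v (w * e) := by
      funext e
      rw [hfe e]
      simp only [divergenceIntegrand, dpdTerm, h0, if_true]
      ring
    rw [heq]
    refine ⟨(hint.sub ha).add hb, ?_⟩
    refine (integral_add (hint.sub ha) hb).trans ?_
    rw [integral_sub' hint ha, ha1, hb1]
    ring
  · have hap := hcompi (integrable_scaleDensity_rpow hf0 hfγ hw)
    have hbp := hcompi (integrable_scaleDensity_rpow hf0 hfγ hv)
    have hap1 := hcomp fun x => scaleDensity f w x ^ (1 + γ)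
    have hbp1 := hcomp fun x => scaleDensity f v x ^ (1 + γ)
    set A := ∫ x, scaleDensity f w x ^ (1 + γ) with hA
    set B := ∫ x, scaleDensity f v x ^ (1 + γ) with hB
    have heq : (fun e => w * divergenceIntegrand γ (scaleDensity f w (w * e))
        (scaleDensity f v (w * e))) = fun e =>
        f e * (dpdTerm f γ w (w * e) - dpdTerm f γ v (w * e))
          + 1 / (1 + γ) * (A - B) * (w * scaleDensity f w (w * e))
          - (1 / (1 + γ) * (w * scaleDensity f w (w * e) ^ (1 + γ))
            - 1 / (1 + γ) * (w * scaleDensity f v (w * e) ^ (1 + γ))) := by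
      funext e
      rw [hfe e]
      simp only [divergenceIntegrand, dpdTerm, h0, if_false, ← hA, ← hB]
      ring
    rw [heq]
    have i1 := ha.const_mul (1 / (1 + γ) * (A - B))
    have i2 := hap.const_mul (1 / (1 + γ))
    have i3 := hbp.const_mul (1 / (1 + γ))
    refine ⟨(hint.add i1).sub (i2.sub i3), ?_⟩
    refine (integral_sub (hint.add i1) (i2.sub i3)).trans ?_
    rw [integral_add' hint i1, integral_sub' i2 i3,
      integral_const_mul (1 / (1 + γ) * (A - B)), integral_const_mul (1 / (1 + γ)),
      integral_const_mul (1 / (1 + γ)), ha1, hap1, hbp1]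
    ring

/-- The true scale maximizes the expected objective, and it is the only maximizer because the
second moment of the density `scaleDensity f v` is `v ^ 2`. -/
theorem integral_dpdTerm_sub_nonneg_and_eq (hf0 : ∀ x, 0 ≤ f x) (hfi : Integrable f)
    (hf1 : ∫ x, f x = 1) (hf2 : ∫ x, x ^ 2 * f x = 1)
    (hγ : 0 ≤ γ) (hfγ : Integrable fun x => f x ^ (1 + γ)) (hv : 0 < v) (hw : 0 < w)
    (hlog : γ = 0 → ∀ᵐ e, f e ≠ 0 → 0 < f (w * e / v))
    (hint : Integrable fun e => f e * (dpdTerm f γ w (w * e) - dpdTerm f γ v (w * e))) :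
    0 ≤ ∫ e, f e * (dpdTerm f γ w (w * e) - dpdTerm f γ v (w * e)) ∧
      (∫ e, f e * (dpdTerm f γ w (w * e) - dpdTerm f γ v (w * e)) = 0 → v = w) := by
  obtain ⟨hi, heq⟩ := integral_dpdTerm_sub_eq hf0 hfi hf1 hfγ hv hw hint
  have hcond : ∀ᵐ e, γ = 0 → scaleDensity f w (w * e) = 0 ∨ 0 < scaleDensity f v (w * e) := by
    by_cases h0 : γ = 0
    · filter_upwards [hlog h0] with e he _
      by_cases hfe : f e = 0
      · left
        rw [scaleDensity, mul_div_cancel_left₀ _ hw.ne', hfe, mul_zero]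
      · right
        exact mul_pos (inv_pos.2 hv) (he hfe)
    · exact ae_of_all _ fun e h => absurd h h0
  have hnn : 0 ≤ᵐ[volume] fun e => w * divergenceIntegrand γ (scaleDensity f w (w * e))
      (scaleDensity f v (w * e)) := by
    filter_upwards [hcond] with e he
    exact mul_nonneg hw.le (divergenceIntegrand_nonneg hγ (scaleDensity_nonneg hf0 hw.le _)
      (scaleDensity_nonneg hf0 hv.le _) he)
  rw [← heq]
  refine ⟨integral_nonneg_of_ae hnn, fun hzero => ?_⟩
  have hae := (integral_eq_zero_iff_of_nonneg_ae hnn hi).1 hzero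
  have heqd : ∀ᵐ e, scaleDensity f w (w * e) = scaleDensity f v (w * e) := by
    filter_upwards [hcond, hae] with e he h
    by_contra hne
    exact (mul_pos hw (divergenceIntegrand_pos hγ (scaleDensity_nonneg hf0 hw.le _)
      (scaleDensity_nonneg hf0 hv.le _) he hne)).ne' h
  have hmom : ∀ u, ∫ e, (w * e) ^ 2 * scaleDensity f u (w * e)
      = w⁻¹ * ∫ x, x ^ 2 * scaleDensity f u x := by
    intro u
    rw [Measure.integral_comp_mul_left (fun x => x ^ 2 * scaleDensity f u x),
      abs_of_pos (inv_pos.2 hw), smul_eq_mul]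
  have h1 : w⁻¹ * ∫ x, x ^ 2 * scaleDensity f w x = w⁻¹ * ∫ x, x ^ 2 * scaleDensity f v x := by
    rw [← hmom, ← hmom]
    refine integral_congr_ae ?_
    filter_upwards [heqd] with e he
    rw [he]
  rw [integral_sq_mul_scaleDensity hw, integral_sq_mul_scaleDensity hv, hf2, mul_one, mul_one] at h1
  exact ((pow_left_inj₀ hw.le hv.le two_ne_zero).1
    (mul_left_cancel₀ (inv_ne_zero hw.ne') h1)).symm

end Divergence

section Identification

variable {d : ℕ} {Ω : Type*} [MeasurableSpace Ω] {μ : Measure Ω} {f : ℝ → ℝ} {γ : ℝ}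
  {Θ : Set (EuclideanSpace ℝ (Fin d))} {θ₀ : EuclideanSpace ℝ (Fin d)}
  {s : EuclideanSpace ℝ (Fin d) → (ℕ → ℝ) → ℝ} {ε X : ℤ → Ω → ℝ}

theorem measurable_past (hX : ∀ t, Measurable (X t)) (t : ℤ) : Measurable (past X t) :=
  measurable_pi_lambda _ fun _ => hX _

theorem isStationaryFunctional_past (X : ℤ → Ω → ℝ) (μ : Measure Ω) :
    IsStationaryFunctional X μ (past X) := by
  refine ⟨fun y k => y (-1 - k), measurable_pi_lambda _ fun k => measurable_pi_apply _,
    fun t => ae_of_all _ fun ω => ?_⟩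
  funext k
  simp only [past, shiftPath]
  congr 1
  ring

theorem isStationaryFunctional_self (X : ℤ → Ω → ℝ) (μ : Measure Ω) :
    IsStationaryFunctional X μ X :=
  ⟨fun y => y 0, measurable_pi_apply 0, fun t => ae_of_all _ fun ω => by simp [shiftPath]⟩

theorem isStationaryFunctional_sigma {θ : EuclideanSpace ℝ (Fin d)} (hs : Measurable (s θ)) :
    IsStationaryFunctional X μ fun t => sigma s X t θ :=
  (isStationaryFunctional_past X μ).comp hs

theorem isStationaryFunctional_q (hf : Measurable f) (γ : ℝ) {θ : EuclideanSpace ℝ (Fin d)}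
    (hs : Measurable (s θ)) : IsStationaryFunctional X μ fun t => q f γ s X t θ :=
  (isStationaryFunctional_sigma hs).comp₂ (isStationaryFunctional_self X μ)
    (measurable_dpdTerm hf γ)

variable [IsProbabilityMeasure μ]

/-- The mean of `q_0` is maximal at `θ₀`, and only there: given the past, the innovation has
density `f`, so that the conditional mean is controlled by `integral_dpdTerm_sub_nonneg_and_eq`. -/
theorem integral_q_lt (hmodel : HeteroscedasticModel μ f Θ θ₀ s ε X) (hθ₀ : θ₀ ∈ Θ)
    (hγ : 0 ≤ γ) (hfγ : Integrable fun x => f x ^ (1 + γ))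
    (hlog : γ = 0 → ∀ᵐ ω ∂μ, ∀ t, ∀ θ ∈ Θ, 0 < f (X t ω / sigma s X t θ ω))
    {θ : EuclideanSpace ℝ (Fin d)} (hθ : θ ∈ Θ) (hne : θ ≠ θ₀)
    (hi : Integrable (q f γ s X 0 θ) μ) (hi₀ : Integrable (q f γ s X 0 θ₀) μ) :
    ∫ ω, q f γ s X 0 θ ω ∂μ < ∫ ω, q f γ s X 0 θ₀ ω ∂μ := by
  have hf := hmodel.density_measurable
  have hf0 := hmodel.density_nonneg
  have hfm : Measurable fun x => ENNReal.ofReal (f x) := hf.ennreal_ofReal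
  have hεm := hmodel.innovation_measurable 0
  have hpm : Measurable (past X 0) := measurable_past hmodel.observation_measurable 0
  have hsθ := hmodel.scale_measurable θ hθ
  have hsθ₀ := hmodel.scale_measurable θ₀ hθ₀
  have hdpd := measurable_dpdTerm hf γ
  set ρ := μ.map (past X 0) with hρ
  set ν := volume.withDensity fun x => ENNReal.ofReal (f x) with hν
  have hνlaw : μ.map (ε 0) = ν := hmodel.innovation_law 0
  have : IsProbabilityMeasure ρ := Measure.isProbabilityMeasure_map hpm.aemeasurable
  have : IsProbabilityMeasure ν := by
    rw [← hνlaw]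
    exact Measure.isProbabilityMeasure_map hεm.aemeasurable
  -- integrals against the law of the innovations
  have hνint : ∀ g : ℝ → ℝ, ∫ x, g x ∂ν = ∫ x, f x * g x := by
    intro g
    rw [hν, integral_withDensity_eq_integral_toReal_smul hfm (ae_of_all _ fun x => by simp)]
    simp only [ENNReal.toReal_ofReal (hf0 _), smul_eq_mul]
  have hνi : ∀ g : ℝ → ℝ, Integrable g ν ↔ Integrable fun x => f x * g x := by
    intro g
    rw [hν, integrable_withDensity_iff_integrable_smul' hfm (ae_of_all _ fun x => by simp)]
    simp only [ENNReal.toReal_ofReal (hf0 _), smul_eq_mul]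
  have hfi : Integrable f := by simpa using (hνi fun _ => 1).1 (integrable_const 1)
  have hf1 : ∫ x, f x = 1 := by simpa using (hνint fun _ => 1).symm
  have hf2 : ∫ x, x ^ 2 * f x = 1 := by
    have h1 : ∫ x, x ^ 2 ∂ν = ∫ ω, ε 0 ω ^ 2 ∂μ := by
      rw [← hνlaw, integral_map hεm.aemeasurable (by fun_prop)]
    have h2 := hmodel.innovation_variance 0
    rw [variance_of_integral_eq_zero hεm.aemeasurable (hmodel.innovation_mean 0)] at h2
    rw [← h2, ← h1, hνint]
    exact integral_congr_ae (ae_of_all _ fun x => mul_comm _ _)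
  -- the pair of past and innovation
  have hpair : μ.map (fun ω => (past X 0 ω, ε 0 ω)) = ρ.prod ν := by
    rw [hρ, ← hνlaw]
    exact (indepFun_iff_map_prod_eq_prod_map_map hpm.aemeasurable hεm.aemeasurable).1
      (hmodel.innovation_indep_past 0).symm
  have hpairm : Measurable fun ω => (past X 0 ω, ε 0 ω) := hpm.prodMk hεm
  set F : (ℕ → ℝ) × ℝ → ℝ := fun p =>
    dpdTerm f γ (s θ₀ p.1) (s θ₀ p.1 * p.2) - dpdTerm f γ (s θ p.1) (s θ₀ p.1 * p.2) with hF
  have hxm : Measurable fun p : (ℕ → ℝ) × ℝ => s θ₀ p.1 * p.2 :=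
    (hsθ₀.comp measurable_fst).mul measurable_snd
  have hFm : Measurable F :=
    (hdpd.comp ((hsθ₀.comp measurable_fst).prodMk hxm)).sub
      (hdpd.comp ((hsθ.comp measurable_fst).prodMk hxm))
  have hFq : (fun ω => F (past X 0 ω, ε 0 ω)) =ᵐ[μ]
      fun ω => q f γ s X 0 θ₀ ω - q f γ s X 0 θ ω := by
    filter_upwards [hmodel.equation 0] with ω hω
    simp only [hF, q, hω, sigma]
  have hFi : Integrable F (ρ.prod ν) := by
    rw [← hpair, integrable_map_measure hFm.aestronglyMeasurable hpairm.aemeasurable]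
    exact (hi₀.sub hi).congr hFq.symm
  have hFint : ∫ p, F p ∂(ρ.prod ν) = ∫ ω, q f γ s X 0 θ₀ ω ∂μ - ∫ ω, q f γ s X 0 θ ω ∂μ := by
    rw [← hpair, integral_map hpairm.aemeasurable hFm.aestronglyMeasurable, ← integral_sub hi₀ hi]
    exact integral_congr_ae hFq
  have hpos : ∀ θ ∈ Θ, ∀ᵐ p ∂ρ, 0 < s θ p := by
    intro θ hθ
    rw [hρ, ae_map_iff hpm.aemeasurable (measurableSet_lt measurable_const
      (hmodel.scale_measurable θ hθ))]
    filter_upwards [hmodel.scale_pos] with ω hω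
    exact hω 0 θ hθ
  have hlog' : γ = 0 → ∀ᵐ p ∂ρ, ∀ᵐ e, f e ≠ 0 → 0 < f (s θ₀ p * e / s θ p) := by
    intro h0
    have hm : MeasurableSet {p : (ℕ → ℝ) × ℝ | 0 < f (s θ₀ p.1 * p.2 / s θ p.1)} :=
      measurableSet_lt measurable_const (hf.comp (hxm.div (hsθ.comp measurable_fst)))
    have h1 : ∀ᵐ p ∂(ρ.prod ν), 0 < f (s θ₀ p.1 * p.2 / s θ p.1) := by
      rw [← hpair, ae_map_iff hpairm.aemeasurable hm]
      filter_upwards [hlog h0, hmodel.equation 0] with ω h1 h2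
      have := h1 0 θ hθ
      rwa [h2] at this
    filter_upwards [Measure.ae_ae_of_ae_prod h1] with p hp
    rw [hν, ae_withDensity_iff hfm] at hp
    filter_upwards [hp] with e he hfe
    exact he (by simpa using lt_of_le_of_ne (hf0 e) (Ne.symm hfe))
  have hinner : ∀ᵐ p ∂ρ, 0 ≤ ∫ e, F (p, e) ∂ν ∧ (∫ e, F (p, e) ∂ν = 0 → s θ p = s θ₀ p) := by
    have hl : ∀ᵐ p ∂ρ, γ = 0 → ∀ᵐ e, f e ≠ 0 → 0 < f (s θ₀ p * e / s θ p) := by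
      by_cases h0 : γ = 0
      · filter_upwards [hlog' h0] with p hp _ using hp
      · exact ae_of_all _ fun p h => absurd h h0
    filter_upwards [hFi.prod_right_ae, hpos θ hθ, hpos θ₀ hθ₀, hl] with p h1 h2 h3 h4
    have h5 := (hνi fun e => F (p, e)).1 h1
    have h6 := hνint fun e => F (p, e)
    simp only [hF] at h5 h6 ⊢
    rw [h6]
    exact integral_dpdTerm_sub_nonneg_and_eq hf0 hfi hf1 hf2 hγ hfγ h2 h3 h4 h5
  have hnn : 0 ≤ᵐ[ρ] fun p => ∫ e, F (p, e) ∂ν := hinner.mono fun p h => h.1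
  have hsub : 0 ≤ ∫ ω, q f γ s X 0 θ₀ ω ∂μ - ∫ ω, q f γ s X 0 θ ω ∂μ := by
    rw [← hFint, integral_prod _ hFi]
    exact integral_nonneg_of_ae hnn
  refine lt_of_le_of_ne (by linarith) fun heq => hne ?_
  have hzero : ∫ p, ∫ e, F (p, e) ∂ν ∂ρ = 0 := by
    rw [← integral_prod _ hFi, hFint, heq, sub_self]
  have hae := (integral_eq_zero_iff_of_nonneg_ae hnn hFi.integral_prod_left).1 hzero
  have heqs : ∀ᵐ p ∂ρ, s θ p = s θ₀ p := by
    filter_upwards [hinner, hae] with p h1 h2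
    exact h1.2 h2
  refine hmodel.identifiable θ hθ (ae_all_iff.2 fun t => ?_)
  have hlaw : μ.map (past X t) = ρ :=
    (isStationaryFunctional_past X μ).map_eq hmodel.stationary_ergodic t
  rw [← hlaw] at heqs
  have h := ae_of_ae_map (measurable_past hmodel.observation_measurable t).aemeasurable heqs
  exact h

end Identification

/-! ### The central limit theorem for martingale differences -/

section StoppedProduct

/-- The product of the factors `1 + i x_k` over `k < n`, in which a factor is dropped as soon as the
sum of the squares of the preceding `x_j` exceeds `C`. The truncation keeps the product bounded in
mean square. -/
noncomputable def stoppedProduct (C : ℝ) (x : ℕ → ℝ) : ℕ → ℂ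
  | 0 => 1
  | k + 1 => stoppedProduct C x k *
      (if ∑ j ∈ Finset.range k, x j ^ 2 ≤ C then 1 + x k * Complex.I else 1)

theorem norm_sq_one_add_mul_I (x : ℝ) : ‖1 + x * Complex.I‖ ^ 2 = 1 + x ^ 2 := by
  rw [← Complex.normSq_eq_norm_sq]
  simp [Complex.normSq_apply, sq]

theorem norm_sq_stoppedProduct_le_exp (C : ℝ) (x : ℕ → ℝ) (n : ℕ) :
    ‖stoppedProduct C x n‖ ^ 2 ≤ Real.exp (∑ j ∈ Finset.range n, x j ^ 2) := by
  induction n with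
  | zero => simp [stoppedProduct]
  | succ n ih =>
    rw [stoppedProduct, norm_mul, mul_pow, Finset.sum_range_succ, Real.exp_add]
    refine mul_le_mul ih ?_ (by positivity) (by positivity)
    split_ifs
    · rw [norm_sq_one_add_mul_I, add_comm]
      exact Real.add_one_le_exp _
    · simpa using sq_nonneg (x n)

theorem sum_range_sq_mono (x : ℕ → ℝ) : Monotone fun n => ∑ j ∈ Finset.range n, x j ^ 2 :=
  monotone_nat_of_le_succ fun n => by
    rw [Finset.sum_range_succ]
    have := sq_nonneg (x n)
    linarith

/-- The last factor kept contributes at most `1 + x_k ^ 2`, and those before it at most `exp C`. -/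
theorem norm_sq_stoppedProduct_le (C : ℝ) (hC : 0 ≤ C) (x : ℕ → ℝ) (n : ℕ) :
    ‖stoppedProduct C x n‖ ^ 2 ≤ Real.exp C * (1 + ∑ j ∈ Finset.range n, x j ^ 2) := by
  induction n with
  | zero => simpa [stoppedProduct] using hC
  | succ n ih =>
    have hs : 0 ≤ ∑ j ∈ Finset.range n, x j ^ 2 := Finset.sum_nonneg fun _ _ => sq_nonneg _
    rw [stoppedProduct, norm_mul, mul_pow]
    split_ifs with h
    · rw [norm_sq_one_add_mul_I, Finset.sum_range_succ]
      refine mul_le_mul ((norm_sq_stoppedProduct_le_exp C x n).trans (Real.exp_le_exp.2 h))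
        (by linarith) (by positivity) (by positivity)
    · simp only [norm_one, one_pow, mul_one]
      refine ih.trans (mul_le_mul_of_nonneg_left ?_ (Real.exp_pos C).le)
      have := sum_range_sq_mono x (Nat.le_succ n)
      simp only at this
      linarith

theorem stoppedProduct_eq_prod {C : ℝ} {x : ℕ → ℝ} {n : ℕ}
    (h : ∑ j ∈ Finset.range n, x j ^ 2 ≤ C) :
    stoppedProduct C x n = ∏ k ∈ Finset.range n, (1 + x k * Complex.I) := by
  induction n with
  | zero => simp [stoppedProduct]
  | succ n ih =>
    have h' := (sum_range_sq_mono x (Nat.le_succ n)).trans h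
    rw [stoppedProduct, if_pos h', ih h', Finset.prod_range_succ]

theorem norm_prod_sub_prod_le_sum {a b : ℕ → ℂ} (ha : ∀ k, ‖a k‖ ≤ 1) (hb : ∀ k, ‖b k‖ ≤ 1)
    (n : ℕ) : ‖∏ k ∈ Finset.range n, a k - ∏ k ∈ Finset.range n, b k‖ ≤
      ∑ k ∈ Finset.range n, ‖a k - b k‖ := by
  induction n with
  | zero => simp
  | succ n ih =>
    rw [Finset.prod_range_succ, Finset.prod_range_succ, Finset.sum_range_succ]
    have hA : ‖∏ k ∈ Finset.range n, a k‖ ≤ 1 := by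
      rw [norm_prod]
      exact Finset.prod_le_one (fun _ _ => norm_nonneg _) fun k _ => ha k
    calc ‖(∏ k ∈ Finset.range n, a k) * a n - (∏ k ∈ Finset.range n, b k) * b n‖
        = ‖(∏ k ∈ Finset.range n, a k - ∏ k ∈ Finset.range n, b k) * b n
          + (∏ k ∈ Finset.range n, a k) * (a n - b n)‖ := by congr 1; ring
      _ ≤ ‖∏ k ∈ Finset.range n, a k - ∏ k ∈ Finset.range n, b k‖ * ‖b n‖
          + ‖∏ k ∈ Finset.range n, a k‖ * ‖a n - b n‖ := by
        refine (norm_add_le _ _).trans ?_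
        rw [norm_mul, norm_mul]
      _ ≤ _ := by
        gcongr
        · exact (mul_le_of_le_one_right (norm_nonneg _) (hb n)).trans ih
        · exact mul_le_of_le_one_left (norm_nonneg _) hA

theorem norm_one_add_mul_I_mul_exp_le (x : ℝ) :
    ‖(1 + x * Complex.I) * Real.exp (-x ^ 2 / 2)‖ ≤ 1 := by
  rw [← sq_le_one_iff₀ (norm_nonneg _), norm_mul, mul_pow, norm_sq_one_add_mul_I,
    Complex.norm_real, Real.norm_eq_abs, sq_abs, ← Real.exp_nat_mul]
  have h : ((2 : ℕ) : ℝ) * (-x ^ 2 / 2) = -x ^ 2 := by push_cast; ring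
  rw [h, Real.exp_neg, ← div_eq_mul_inv, div_le_one (Real.exp_pos _), add_comm]
  exact Real.add_one_le_exp _

theorem norm_exp_mul_I_sub_le (x : ℝ) :
    ‖Complex.exp (x * Complex.I) - (1 + x * Complex.I) * Real.exp (-x ^ 2 / 2)‖
      ≤ 2 * |x| ^ 3 := by
  rcases le_total 1 |x| with h | h
  · have h1 : ‖Complex.exp (x * Complex.I)‖ = 1 := Complex.norm_exp_ofReal_mul_I x
    have h2 := norm_one_add_mul_I_mul_exp_le x
    have h3 : (1 : ℝ) ≤ |x| ^ 3 := one_le_pow₀ h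
    calc _ ≤ ‖Complex.exp (x * Complex.I)‖ + ‖(1 + x * Complex.I) * Real.exp (-x ^ 2 / 2)‖ :=
          norm_sub_le _ _
      _ ≤ 1 + 1 := by gcongr; exact h1.le
      _ ≤ _ := by linarith
  · have hx2 : x ^ 2 = |x| ^ 2 := (sq_abs x).symm
    have e1 : ‖Complex.exp (x * Complex.I) - (1 + x * Complex.I - x ^ 2 / 2)‖
        ≤ |x| ^ 3 * (2 / 9) := by
      have := Complex.exp_bound (x := x * Complex.I) (by simpa using h) (n := 3) (by norm_num)
      simp only [Finset.sum_range_succ, Finset.sum_range_zero, norm_mul, Complex.norm_I,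
        Complex.norm_real, Real.norm_eq_abs, mul_one, mul_pow, Complex.I_sq] at this
      norm_num [Nat.factorial] at this
      convert this using 2
      ring_nf
    have e2 : |Real.exp (-x ^ 2 / 2) - 1 - (-x ^ 2 / 2)| ≤ (-x ^ 2 / 2) ^ 2 :=
      Real.abs_exp_sub_one_sub_id_le (by
        rw [abs_div, abs_neg, abs_of_nonneg (sq_nonneg x), abs_two, hx2]
        have : |x| ^ 2 ≤ 1 := pow_le_one₀ (abs_nonneg x) h
        linarith)
    set r : ℝ := Real.exp (-x ^ 2 / 2) - 1 - (-x ^ 2 / 2) with hr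
    have e3 : (1 + x * Complex.I) * Real.exp (-x ^ 2 / 2) = (1 + x * Complex.I - x ^ 2 / 2)
        - (x ^ 3 / 2 : ℝ) * Complex.I + (1 + x * Complex.I) * r := by
      rw [hr]
      push_cast
      ring
    have e4 : ‖(1 + x * Complex.I)‖ ≤ 2 := by
      refine (norm_add_le _ _).trans ?_
      simp only [norm_one, norm_mul, Complex.norm_I, Complex.norm_real, Real.norm_eq_abs, mul_one]
      linarith
    rw [e3]
    have hr' : |r| ≤ |x| ^ 3 / 4 := by
      refine e2.trans ?_
      have : (-x ^ 2 / 2) ^ 2 = |x| ^ 3 * |x| / 4 := by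
        rw [show (-x ^ 2 / 2) ^ 2 = (x ^ 2) ^ 2 / 4 by ring, hx2]
        ring
      rw [this]
      have h3 : 0 ≤ |x| ^ 3 := by positivity
      nlinarith
    calc _ = ‖(Complex.exp (x * Complex.I) - (1 + x * Complex.I - x ^ 2 / 2))
          + (x ^ 3 / 2 : ℝ) * Complex.I - (1 + x * Complex.I) * r‖ := by congr 1; ring
      _ ≤ |x| ^ 3 * (2 / 9) + |x| ^ 3 / 2 + 2 * (|x| ^ 3 / 4) := by
        refine (norm_sub_le _ _).trans (add_le_add ((norm_add_le _ _).trans (add_le_add e1 ?_)) ?_)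
        · rw [norm_mul, Complex.norm_I, mul_one, Complex.norm_real, Real.norm_eq_abs, abs_div,
            abs_pow, abs_two]
        · rw [norm_mul, Complex.norm_real, Real.norm_eq_abs]
          exact mul_le_mul e4 hr' (abs_nonneg _) (by norm_num)
      _ ≤ 2 * |x| ^ 3 := by
        have h3 : 0 ≤ |x| ^ 3 := by positivity
        linarith

theorem norm_exp_sum_mul_I_sub_le (x : ℕ → ℝ) (n : ℕ) :
    ‖Complex.exp ((∑ k ∈ Finset.range n, x k : ℝ) * Complex.I)
      - (∏ k ∈ Finset.range n, (1 + x k * Complex.I))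
        * Real.exp (-(∑ k ∈ Finset.range n, x k ^ 2) / 2)‖
      ≤ 2 * ∑ k ∈ Finset.range n, |x k| ^ 3 := by
  have h1 : Complex.exp ((∑ k ∈ Finset.range n, x k : ℝ) * Complex.I)
      = ∏ k ∈ Finset.range n, Complex.exp (x k * Complex.I) := by
    rw [← Complex.exp_sum, ← Finset.sum_mul]
    push_cast
    rfl
  have h2 : (∏ k ∈ Finset.range n, (1 + x k * Complex.I))
        * Real.exp (-(∑ k ∈ Finset.range n, x k ^ 2) / 2)
      = ∏ k ∈ Finset.range n, ((1 + x k * Complex.I) * Real.exp (-x k ^ 2 / 2)) := by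
    rw [Finset.prod_mul_distrib]
    congr 1
    rw [← Complex.ofReal_prod, ← Real.exp_sum, neg_div, Finset.sum_div, ← Finset.sum_neg_distrib]
    simp only [neg_div]
  rw [h1, h2, Finset.mul_sum]
  exact (norm_prod_sub_prod_le_sum (fun k => (Complex.norm_exp_ofReal_mul_I _).le)
    (fun k => norm_one_add_mul_I_mul_exp_le _) n).trans
    (Finset.sum_le_sum fun k _ => norm_exp_mul_I_sub_le _)

/-- If the averages of `y_k ^ 2` converge then `y_k = o(√k)`, which makes the sum of the
`|y_k / √n| ^ 3` over `k < n` negligible. -/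
theorem tendsto_sum_abs_pow_three {y : ℕ → ℝ} {v : ℝ}
    (h : Tendsto (fun n : ℕ => (n : ℝ)⁻¹ * ∑ k ∈ Finset.range n, y k ^ 2) atTop (𝓝 v)) :
    Tendsto (fun n : ℕ => ∑ k ∈ Finset.range n, |(√(n : ℝ))⁻¹ * y k| ^ 3) atTop (𝓝 0) := by
  have hsmall : Tendsto (fun n : ℕ => ((n : ℝ) + 1)⁻¹ * y n ^ 2) atTop (𝓝 0) := by
    have h1 := (tendsto_add_atTop_iff_nat 1).2 h
    have h2 : Tendsto (fun n : ℕ => (n : ℝ) / ((n : ℝ) + 1)) atTop (𝓝 1) :=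
      tendsto_natCast_div_add_atTop (1 : ℝ)
    have h3 := h1.sub (h2.mul h)
    rw [one_mul, sub_self] at h3
    refine h3.congr' ?_
    filter_upwards [eventually_gt_atTop 0] with n hn
    have hn' : (n : ℝ) ≠ 0 := by positivity
    rw [Finset.sum_range_succ]
    push_cast
    field_simp
    ring
  have hv : 0 ≤ v := ge_of_tendsto' h fun n =>
    mul_nonneg (by positivity) (Finset.sum_nonneg fun _ _ => sq_nonneg _)
  have hform : ∀ n : ℕ, ∑ k ∈ Finset.range n, |(√(n : ℝ))⁻¹ * y k| ^ 3
      = (√(n : ℝ))⁻¹ ^ 3 * ∑ k ∈ Finset.range n, |y k| ^ 3 := by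
    intro n
    rw [Finset.mul_sum]
    refine Finset.sum_congr rfl fun k _ => ?_
    rw [abs_mul, abs_of_nonneg (by positivity : (0 : ℝ) ≤ (√(n : ℝ))⁻¹), mul_pow]
  simp_rw [hform]
  refine Metric.tendsto_nhds.2 fun ε hε => ?_
  set δ := ε / (2 * (v + 1)) with hδ
  have hδ0 : 0 < δ := by positivity
  obtain ⟨N, hN⟩ := eventually_atTop.1 (hsmall.eventually_lt_const (pow_pos hδ0 2))
  have hhead : Tendsto (fun n : ℕ => (√(n : ℝ))⁻¹ ^ 3 * ∑ k ∈ Finset.range N, |y k| ^ 3) atTop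
      (𝓝 0) := by
    have h1 : Tendsto (fun n : ℕ => (√(n : ℝ))⁻¹) atTop (𝓝 0) :=
      tendsto_inv_atTop_zero.comp (Real.tendsto_sqrt_atTop.comp tendsto_natCast_atTop_atTop)
    simpa using (h1.pow 3).mul_const (∑ k ∈ Finset.range N, |y k| ^ 3)
  filter_upwards [hhead.eventually_lt_const (half_pos hε),
    h.eventually_lt_const (lt_add_one v), eventually_gt_atTop 0] with n h1 h2 hn
  have hn' : (0 : ℝ) < n := by exact_mod_cast hn
  have hsq : 0 < √(n : ℝ) := Real.sqrt_pos.2 hn'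
  have hterm : ∀ k ∈ Finset.range n, |y k| ^ 3 ≤
      (if k < N then |y k| ^ 3 else 0) + δ * √(n : ℝ) * y k ^ 2 := by
    intro k hk
    have hk' : k < n := Finset.mem_range.1 hk
    split_ifs with hkN
    · have : 0 ≤ δ * √(n : ℝ) * y k ^ 2 := by positivity
      linarith
    · have h3 := hN k (not_lt.1 hkN)
      rw [inv_mul_lt_iff₀ (by positivity)] at h3
      have h4 : (k : ℝ) + 1 ≤ n := by exact_mod_cast hk'
      have h5 : |y k| ≤ δ * √(n : ℝ) := by
        refine abs_le_of_sq_le_sq ?_ (by positivity)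
        rw [mul_pow, Real.sq_sqrt hn'.le]
        nlinarith [sq_nonneg δ]
      calc |y k| ^ 3 = |y k| * y k ^ 2 := by rw [← sq_abs (y k)]; ring
        _ ≤ δ * √(n : ℝ) * y k ^ 2 := by gcongr
        _ ≤ _ := by linarith
  have hsum : ∑ k ∈ Finset.range n, |y k| ^ 3 ≤
      ∑ k ∈ Finset.range N, |y k| ^ 3 + δ * √(n : ℝ) * ∑ k ∈ Finset.range n, y k ^ 2 := by
    refine (Finset.sum_le_sum hterm).trans ?_
    rw [Finset.sum_add_distrib, ← Finset.mul_sum, ← Finset.sum_filter]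
    gcongr
    intro k hk
    exact Finset.mem_range.2 (Finset.mem_filter.1 hk).2
  rw [Real.dist_eq, sub_zero, abs_of_nonneg (mul_nonneg (by positivity)
    (Finset.sum_nonneg fun _ _ => by positivity))]
  calc (√(n : ℝ))⁻¹ ^ 3 * ∑ k ∈ Finset.range n, |y k| ^ 3
      ≤ (√(n : ℝ))⁻¹ ^ 3 * (∑ k ∈ Finset.range N, |y k| ^ 3
        + δ * √(n : ℝ) * ∑ k ∈ Finset.range n, y k ^ 2) := by gcongr
    _ = (√(n : ℝ))⁻¹ ^ 3 * ∑ k ∈ Finset.range N, |y k| ^ 3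
        + δ * ((n : ℝ)⁻¹ * ∑ k ∈ Finset.range n, y k ^ 2) := by
      have : (n : ℝ)⁻¹ = (√(n : ℝ))⁻¹ ^ 2 := by
        rw [inv_pow, Real.sq_sqrt hn'.le]
      rw [this]
      field_simp
    _ < ε / 2 + ε / 2 := by
      refine add_lt_add h1 ?_
      calc δ * ((n : ℝ)⁻¹ * ∑ k ∈ Finset.range n, y k ^ 2) < δ * (v + 1) := by gcongr
        _ = ε / 2 := by rw [hδ]; field_simp
    _ = ε := add_halves ε

/-- The pathwise core of the central limit theorem: the exponential of `i` times the normalized sum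
is asymptotically `exp (-v / 2)` times the stopped product. -/
theorem tendsto_exp_sum_mul_I_sub_stoppedProduct {y : ℕ → ℝ} {v : ℝ}
    (h : Tendsto (fun n : ℕ => (n : ℝ)⁻¹ * ∑ k ∈ Finset.range n, y k ^ 2) atTop (𝓝 v)) :
    Tendsto (fun n : ℕ =>
      Complex.exp ((∑ k ∈ Finset.range n, (√(n : ℝ))⁻¹ * y k : ℝ) * Complex.I)
        - Real.exp (-v / 2) * stoppedProduct (v + 1) (fun k => (√(n : ℝ))⁻¹ * y k) n)
      atTop (𝓝 0) := by
  have hsq : ∀ n : ℕ, ∑ k ∈ Finset.range n, ((√(n : ℝ))⁻¹ * y k) ^ 2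
      = (n : ℝ)⁻¹ * ∑ k ∈ Finset.range n, y k ^ 2 := by
    intro n
    rw [Finset.mul_sum]
    refine Finset.sum_congr rfl fun k _ => ?_
    rw [mul_pow, inv_pow, Real.sq_sqrt (Nat.cast_nonneg n)]
  have h1 : Tendsto (fun n : ℕ => 2 * ∑ k ∈ Finset.range n, |(√(n : ℝ))⁻¹ * y k| ^ 3
      + (1 + Real.exp (v + 1)) *
        |Real.exp (-((n : ℝ)⁻¹ * ∑ k ∈ Finset.range n, y k ^ 2) / 2) - Real.exp (-v / 2)|)
      atTop (𝓝 0) := by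
    have h2 : Tendsto (fun n : ℕ =>
        |Real.exp (-((n : ℝ)⁻¹ * ∑ k ∈ Finset.range n, y k ^ 2) / 2) - Real.exp (-v / 2)|)
        atTop (𝓝 0) := by
      have := (((Real.continuous_exp.tendsto (-v / 2)).comp (h.neg.div_const 2)).sub_const
        (Real.exp (-v / 2))).abs
      simpa using this
    simpa using ((tendsto_sum_abs_pow_three h).const_mul 2).add (h2.const_mul (1 + Real.exp (v + 1)))
  refine squeeze_zero_norm' ?_ h1
  filter_upwards [h.eventually_lt_const (lt_add_one v)] with n hn
  have hC : ∑ k ∈ Finset.range n, ((√(n : ℝ))⁻¹ * y k) ^ 2 ≤ v + 1 := by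
    rw [hsq]
    exact hn.le
  have hb := norm_exp_sum_mul_I_sub_le (fun k => (√(n : ℝ))⁻¹ * y k) n
  rw [← stoppedProduct_eq_prod hC, hsq] at hb
  set P := stoppedProduct (v + 1) (fun k => (√(n : ℝ))⁻¹ * y k) n with hP
  have hPn : ‖P‖ ≤ 1 + Real.exp (v + 1) := by
    have h3 := (norm_sq_stoppedProduct_le_exp (v + 1) (fun k => (√(n : ℝ))⁻¹ * y k) n).trans
      (Real.exp_le_exp.2 hC)
    rw [← hP] at h3
    nlinarith [sq_nonneg (‖P‖ - 1)]
  set u := Real.exp (-((n : ℝ)⁻¹ * ∑ k ∈ Finset.range n, y k ^ 2) / 2) with hu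
  calc _ = ‖(Complex.exp ((∑ k ∈ Finset.range n, (√(n : ℝ))⁻¹ * y k : ℝ) * Complex.I) - P * u)
        + P * (u - Real.exp (-v / 2) : ℝ)‖ := by
        congr 1
        push_cast
        ring
    _ ≤ _ := by
      refine (norm_add_le _ _).trans (add_le_add hb ?_)
      rw [norm_mul, Complex.norm_real, Real.norm_eq_abs]
      gcongr

end StoppedProduct

section MartingaleCLT

variable {Ω : Type*} {m0 : MeasurableSpace Ω} {μ : Measure Ω}

/-- Almost sure convergence to `0` together with a bound in mean square gives convergence of the
means. -/
theorem tendsto_integral_of_tendsto_ae_of_integral_sq_le [IsProbabilityMeasure μ]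
    {G : ℕ → Ω → ℂ} (hG : ∀ n, AEStronglyMeasurable (G n) μ)
    (hlim : ∀ᵐ ω ∂μ, Tendsto (fun n => G n ω) atTop (𝓝 0)) {K : ℝ}
    (hi : ∀ n, Integrable (fun ω => ‖G n ω‖ ^ 2) μ) (hK : ∀ n, ∫ ω, ‖G n ω‖ ^ 2 ∂μ ≤ K) :
    Tendsto (fun n => ∫ ω, G n ω ∂μ) atTop (𝓝 0) := by
  have hK0 : 0 ≤ K := (integral_nonneg fun ω => by positivity).trans (hK 0)
  refine Metric.tendsto_nhds.2 fun ε hε => ?_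
  set M := 2 * (K + 1) / ε with hM
  have hM0 : 0 < M := by positivity
  have hmin : Tendsto (fun n => ∫ ω, min ‖G n ω‖ M ∂μ) atTop (𝓝 (∫ _, (0 : ℝ) ∂μ)) := by
    refine tendsto_integral_of_dominated_convergence (fun _ => M)
      (fun n => ((hG n).norm.inf aestronglyMeasurable_const)) (integrable_const M)
      (fun n => ae_of_all _ fun ω => ?_) ?_
    · rw [Real.norm_eq_abs, abs_of_nonneg (le_min (norm_nonneg _) hM0.le)]
      exact min_le_right _ _
    · filter_upwards [hlim] with ω hω
      simpa [min_eq_left hM0.le] using hω.norm.min (tendsto_const_nhds (x := M))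
  rw [integral_zero] at hmin
  filter_upwards [hmin.eventually_lt_const (half_pos hε)] with n hn
  rw [dist_zero_right]
  have hmini : Integrable (fun ω => min ‖G n ω‖ M) μ :=
    Integrable.of_bound ((hG n).norm.inf aestronglyMeasurable_const) M (ae_of_all _ fun ω => by
      rw [Real.norm_eq_abs, abs_of_nonneg (le_min (norm_nonneg _) hM0.le)]
      exact min_le_right _ _)
  calc ‖∫ ω, G n ω ∂μ‖ ≤ ∫ ω, (min ‖G n ω‖ M + ‖G n ω‖ ^ 2 / M) ∂μ := by
        refine norm_integral_le_of_norm_le (hmini.add ((hi n).div_const M))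
          (ae_of_all _ fun ω => ?_)
        rcases le_total ‖G n ω‖ M with h | h
        · rw [min_eq_left h]
          have : 0 ≤ ‖G n ω‖ ^ 2 / M := by positivity
          linarith
        · have h1 : ‖G n ω‖ ≤ ‖G n ω‖ ^ 2 / M := by
            rw [le_div_iff₀ hM0, sq]
            gcongr
          have h2 : 0 ≤ min ‖G n ω‖ M := le_min (norm_nonneg _) hM0.le
          linarith
    _ = ∫ ω, min ‖G n ω‖ M ∂μ + (∫ ω, ‖G n ω‖ ^ 2 ∂μ) / M := by
        rw [integral_add hmini ((hi n).div_const M), integral_div]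
    _ < ε / 2 + ε / 2 := by
        refine add_lt_add hn ?_
        rw [div_lt_iff₀ hM0, hM]
        have : ε / 2 * (2 * (K + 1) / ε) = K + 1 := by field_simp
        rw [this]
        linarith [hK n]
    _ = ε := add_halves ε

variable {𝒢 : Filtration ℕ m0} {Y : ℕ → Ω → ℝ}

theorem stronglyMeasurable_sum_sq (hY : ∀ k, StronglyMeasurable[𝒢 (k + 1)] (Y k)) (c : ℝ)
    (n : ℕ) : StronglyMeasurable[𝒢 n] fun ω => ∑ j ∈ Finset.range n, (c * Y j ω) ^ 2 :=
  Finset.stronglyMeasurable_fun_sum _ fun j hj =>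
    ((((hY j).mono (𝒢.mono (Finset.mem_range.1 hj))).const_mul c).pow 2)

theorem stronglyMeasurable_stoppedProduct (hY : ∀ k, StronglyMeasurable[𝒢 (k + 1)] (Y k))
    (c C : ℝ) (n : ℕ) :
    StronglyMeasurable[𝒢 n] fun ω => stoppedProduct C (fun k => c * Y k ω) n := by
  induction n with
  | zero => exact stronglyMeasurable_const
  | succ n ih =>
    refine (ih.mono (𝒢.mono n.le_succ)).mul (StronglyMeasurable.ite ?_ ?_ stronglyMeasurable_const)
    · exact 𝒢.mono n.le_succ _
        ((stronglyMeasurable_sum_sq hY c n).measurableSet_le stronglyMeasurable_const)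
    · exact stronglyMeasurable_const.add
        ((Complex.continuous_ofReal.comp_stronglyMeasurable ((hY n).const_mul c)).mul_const _)

theorem integrable_norm_sq_stoppedProduct [IsProbabilityMeasure μ]
    (hY : ∀ k, StronglyMeasurable[𝒢 (k + 1)] (Y k))
    (hY2 : ∀ k, Integrable (fun ω => Y k ω ^ 2) μ) (c : ℝ) {C : ℝ} (hC : 0 ≤ C) (n : ℕ) :
    Integrable (fun ω => ‖stoppedProduct C (fun k => c * Y k ω) n‖ ^ 2) μ := by
  have hi : Integrable (fun ω => Real.exp C * (1 + ∑ j ∈ Finset.range n, (c * Y j ω) ^ 2)) μ := by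
    refine ((integrable_const 1).add (integrable_finsetSum _ fun j _ => ?_)).const_mul _
    simpa only [mul_pow] using (hY2 j).const_mul (c ^ 2)
  refine hi.mono'
    (((stronglyMeasurable_stoppedProduct hY c C n).mono (𝒢.le n)).norm.pow 2).aestronglyMeasurable
    (ae_of_all _ fun ω => ?_)
  rw [Real.norm_eq_abs, abs_of_nonneg (by positivity)]
  exact norm_sq_stoppedProduct_le C hC _ n

/-- The stopped product has mean one: each new factor is `1` plus a martingale difference times a
bounded random variable from the past. -/
theorem integral_stoppedProduct [IsProbabilityMeasure μ]
    (hY : ∀ k, StronglyMeasurable[𝒢 (k + 1)] (Y k)) (hYi : ∀ k, Integrable (Y k) μ)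
    (hY2 : ∀ k, Integrable (fun ω => Y k ω ^ 2) μ)
    (hmart : ∀ k, μ[Y k | 𝒢 k] =ᵐ[μ] 0) (c : ℝ) {C : ℝ} (hC : 0 ≤ C) (n : ℕ) :
    Integrable (fun ω => stoppedProduct C (fun k => c * Y k ω) n) μ ∧
      ∫ ω, stoppedProduct C (fun k => c * Y k ω) n ∂μ = 1 := by
  have hint : ∀ n, Integrable (fun ω => stoppedProduct C (fun k => c * Y k ω) n) μ := by
    intro n
    refine ((integrable_const 1).add (integrable_norm_sq_stoppedProduct hY hY2 c hC n)).mono'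
      ((stronglyMeasurable_stoppedProduct hY c C n).mono (𝒢.le n)).aestronglyMeasurable
      (ae_of_all _ fun ω => ?_)
    simp only [Pi.add_apply]
    nlinarith [sq_nonneg (‖stoppedProduct C (fun k => c * Y k ω) n‖ - 1)]
  refine ⟨hint n, ?_⟩
  induction n with
  | zero => simp [stoppedProduct]
  | succ n ih =>
    set h : Ω → ℂ := fun ω => if ∑ j ∈ Finset.range n, (c * Y j ω) ^ 2 ≤ C then
      stoppedProduct C (fun k => c * Y k ω) n * (c * Complex.I) else 0 with hh
    have hmeas : StronglyMeasurable[𝒢 n] h :=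
      StronglyMeasurable.ite
        ((stronglyMeasurable_sum_sq hY c n).measurableSet_le stronglyMeasurable_const)
        ((stronglyMeasurable_stoppedProduct hY c C n).mul_const _) stronglyMeasurable_const
    have hbound : ∀ ω, ‖h ω‖ ≤ (1 + Real.exp C) * |c| := by
      intro ω
      simp only [hh]
      split_ifs with hω
      · rw [norm_mul, norm_mul, Complex.norm_I, mul_one, Complex.norm_real, Real.norm_eq_abs]
        have h3 := (norm_sq_stoppedProduct_le_exp C (fun k => c * Y k ω) n).trans
          (Real.exp_le_exp.2 hω)
        gcongr
        nlinarith [sq_nonneg (‖stoppedProduct C (fun k => c * Y k ω) n‖ - 1)]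
      · rw [norm_zero]
        positivity
    set B : ℂ →L[ℝ] ℝ →L[ℝ] ℂ := (ContinuousLinearMap.lsmul ℝ ℝ).flip with hB
    have hce := condExp_stronglyMeasurable_bilin_of_bound B (𝒢.le n) hmeas (hYi n) _
      (ae_of_all μ hbound)
    have hzero : ∫ ω, B (h ω) (Y n ω) ∂μ = 0 := by
      rw [← integral_condExp (𝒢.le n), integral_congr_ae hce]
      refine integral_eq_zero_of_ae ?_
      filter_upwards [hmart n] with ω hω
      simp [hω]
    have hsplit : ∀ ω, stoppedProduct C (fun k => c * Y k ω) (n + 1)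
        = stoppedProduct C (fun k => c * Y k ω) n + B (h ω) (Y n ω) := by
      intro ω
      rw [stoppedProduct]
      simp only [hh, hB, ContinuousLinearMap.flip_apply, ContinuousLinearMap.lsmul_apply,
        Complex.real_smul]
      split_ifs
      · push_cast
        ring
      · ring
    have hBi : Integrable (fun ω => B (h ω) (Y n ω)) μ := by
      have := (hint (n + 1)).sub (hint n)
      refine this.congr (ae_of_all _ fun ω => ?_)
      simp only [Pi.sub_apply, hsplit ω, add_sub_cancel_left]
    simp_rw [hsplit]
    rw [integral_add (hint n) hBi, hzero, ih, add_zero]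

/-- **Central limit theorem for martingale differences** whose squares obey a law of large numbers:
the characteristic function of the normalized sum, at the argument `1`, converges to that of the
centred Gaussian law with variance `v`. -/
theorem tendsto_integral_exp_sum_martingaleDifference [IsProbabilityMeasure μ]
    (hYm : ∀ k, AEStronglyMeasurable[𝒢 (k + 1)] (Y k) μ)
    (hYi : ∀ k, Integrable (Y k) μ) (hY2 : ∀ k, Integrable (fun ω => Y k ω ^ 2) μ) {K : ℝ}
    (hK : ∀ k, ∫ ω, Y k ω ^ 2 ∂μ ≤ K) (hmart : ∀ k, μ[Y k | 𝒢 k] =ᵐ[μ] 0) {v : ℝ}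
    (hv : ∀ᵐ ω ∂μ, Tendsto (fun n : ℕ => (n : ℝ)⁻¹ * ∑ k ∈ Finset.range n, Y k ω ^ 2) atTop (𝓝 v)) :
    Tendsto (fun n : ℕ =>
      ∫ ω, Complex.exp ((∑ k ∈ Finset.range n, (√(n : ℝ))⁻¹ * Y k ω : ℝ) * Complex.I) ∂μ) atTop
      (𝓝 (Real.exp (-v / 2))) := by
  -- pass to adapted versions
  wlog hY : ∀ k, StronglyMeasurable[𝒢 (k + 1)] (Y k) generalizing Y
  · set Y' : ℕ → Ω → ℝ := fun k => (hYm k).mk (Y k) with hY'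
    have hae : ∀ k, Y k =ᵐ[μ] Y' k := fun k => (hYm k).ae_eq_mk
    have hall : ∀ᵐ ω ∂μ, ∀ k, Y k ω = Y' k ω := ae_all_iff.2 hae
    have hsq : ∀ k, (fun ω => Y k ω ^ 2) =ᵐ[μ] fun ω => Y' k ω ^ 2 := fun k => by
      filter_upwards [hae k] with ω hω
      rw [hω]
    have h := this (Y := Y') (fun k => (hYm k).stronglyMeasurable_mk.aestronglyMeasurable)
      (fun k => (hYi k).congr (hae k)) (fun k => (hY2 k).congr (hsq k))
      (fun k => (integral_congr_ae (hsq k)).symm.le.trans (hK k))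
      (fun k => (condExp_congr_ae (hae k)).symm.trans (hmart k))
      (by
        filter_upwards [hv, hall] with ω h1 h2
        simpa only [h2] using h1) (fun k => (hYm k).stronglyMeasurable_mk)
    refine h.congr fun n => integral_congr_ae ?_
    filter_upwards [hall] with ω hω
    simp only [hω]
  have hv0 : 0 ≤ v := by
    obtain ⟨ω, hω⟩ := hv.exists
    exact ge_of_tendsto' hω fun n =>
      mul_nonneg (by positivity) (Finset.sum_nonneg fun _ _ => sq_nonneg _)
  have hC : 0 ≤ v + 1 := by linarith
  set P : ℕ → Ω → ℂ := fun n ω => stoppedProduct (v + 1) (fun k => (√(n : ℝ))⁻¹ * Y k ω) n with hP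
  set e : ℕ → Ω → ℂ := fun n ω =>
    Complex.exp ((∑ k ∈ Finset.range n, (√(n : ℝ))⁻¹ * Y k ω : ℝ) * Complex.I) with he
  have hPmean := fun n : ℕ => integral_stoppedProduct hY hYi hY2 hmart (√(n : ℝ))⁻¹ hC n
  have hPi : ∀ n, Integrable (P n) μ := fun n => (hPmean n).1
  have hPsq : ∀ n, Integrable (fun ω => ‖P n ω‖ ^ 2) μ := fun n =>
    integrable_norm_sq_stoppedProduct hY hY2 (√(n : ℝ))⁻¹ hC n
  have hPK : ∀ n, ∫ ω, ‖P n ω‖ ^ 2 ∂μ ≤ Real.exp (v + 1) * (1 + K) := by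
    intro n
    have hi : ∀ j ∈ Finset.range n, Integrable (fun ω => ((√(n : ℝ))⁻¹ * Y j ω) ^ 2) μ := by
      intro j _
      simpa only [mul_pow] using (hY2 j).const_mul ((√(n : ℝ))⁻¹ ^ 2)
    have hK0 : 0 ≤ K := (integral_nonneg fun ω => sq_nonneg _).trans (hK 0)
    calc ∫ ω, ‖P n ω‖ ^ 2 ∂μ
        ≤ ∫ ω, Real.exp (v + 1) * (1 + ∑ j ∈ Finset.range n, ((√(n : ℝ))⁻¹ * Y j ω) ^ 2) ∂μ := by
          refine integral_mono (hPsq n)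
            (((integrable_const 1).add (integrable_finsetSum _ hi)).const_mul _) fun ω => ?_
          exact norm_sq_stoppedProduct_le (v + 1) hC _ n
      _ = Real.exp (v + 1) * (1 + ∑ j ∈ Finset.range n, (√(n : ℝ))⁻¹ ^ 2 * ∫ ω, Y j ω ^ 2 ∂μ) := by
          rw [integral_const_mul, integral_add (integrable_const 1) (integrable_finsetSum _ hi),
            integral_finsetSum _ hi]
          simp only [mul_pow, integral_const_mul, integral_const, probReal_univ, one_smul]
      _ ≤ Real.exp (v + 1) * (1 + K) := by
          gcongr
          calc ∑ j ∈ Finset.range n, (√(n : ℝ))⁻¹ ^ 2 * ∫ ω, Y j ω ^ 2 ∂μ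
              ≤ ∑ _j ∈ Finset.range n, (√(n : ℝ))⁻¹ ^ 2 * K :=
                Finset.sum_le_sum fun j _ => by gcongr; exact hK j
            _ = ((n : ℝ) * (n : ℝ)⁻¹) * K := by
                rw [Finset.sum_const, Finset.card_range, nsmul_eq_mul, inv_pow,
                  Real.sq_sqrt (Nat.cast_nonneg n)]
                ring
            _ ≤ K := mul_le_of_le_one_left hK0 mul_inv_le_one
  have hem : ∀ n, AEStronglyMeasurable (e n) μ := by
    intro n
    have h1 : AEStronglyMeasurable (fun ω => ∑ k ∈ Finset.range n, (√(n : ℝ))⁻¹ * Y k ω) μ :=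
      Finset.aestronglyMeasurable_fun_sum _ fun k _ => (hYi k).aestronglyMeasurable.const_mul _
    have h2 : Continuous fun x : ℝ => Complex.exp (x * Complex.I) := by fun_prop
    exact h2.comp_aestronglyMeasurable h1
  have hen : ∀ n ω, ‖e n ω‖ = 1 := fun n ω => Complex.norm_exp_ofReal_mul_I _
  have hei : ∀ n, Integrable (e n) μ := fun n =>
    Integrable.of_bound (hem n) 1 (ae_of_all _ fun ω => (hen n ω).le)
  set a : ℝ := Real.exp (-v / 2) with ha
  have hGm : ∀ n, AEStronglyMeasurable (fun ω => e n ω - a * P n ω) μ := fun n =>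
    (hem n).sub ((hPi n).aestronglyMeasurable.const_mul _)
  have hGle : ∀ n ω, ‖e n ω - a * P n ω‖ ^ 2 ≤ 2 + 2 * a ^ 2 * ‖P n ω‖ ^ 2 := by
    intro n ω
    have h1 : ‖e n ω - a * P n ω‖ ≤ 1 + |a| * ‖P n ω‖ := by
      refine (norm_sub_le _ _).trans ?_
      rw [hen, norm_mul, Complex.norm_real, Real.norm_eq_abs]
    have h2 : ‖e n ω - a * P n ω‖ ^ 2 ≤ (1 + |a| * ‖P n ω‖) ^ 2 := by gcongr
    have h3 : (|a| * ‖P n ω‖) ^ 2 = a ^ 2 * ‖P n ω‖ ^ 2 := by rw [mul_pow, sq_abs]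
    nlinarith [sq_nonneg (1 - |a| * ‖P n ω‖)]
  have hbi : ∀ n, Integrable (fun ω => 2 + 2 * a ^ 2 * ‖P n ω‖ ^ 2) μ := fun n =>
    (integrable_const 2).add ((hPsq n).const_mul _)
  have hGi : ∀ n, Integrable (fun ω => ‖e n ω - a * P n ω‖ ^ 2) μ := fun n =>
    (hbi n).mono' ((hGm n).norm.pow 2) (ae_of_all _ fun ω => by
      rw [Real.norm_eq_abs, abs_of_nonneg (by positivity)]
      exact hGle n ω)
  have hG := tendsto_integral_of_tendsto_ae_of_integral_sq_le hGm
    (hv.mono fun ω hω => tendsto_exp_sum_mul_I_sub_stoppedProduct hω) hGi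
    (K := 2 + 2 * a ^ 2 * (Real.exp (v + 1) * (1 + K))) fun n => by
      refine (integral_mono (hGi n) (hbi n) (hGle n)).trans ?_
      rw [integral_add (integrable_const 2) ((hPsq n).const_mul _), integral_const_mul]
      simp only [integral_const, probReal_univ, one_smul]
      gcongr
      exact hPK n
  have heq : ∀ n, ∫ ω, (e n ω - a * P n ω) ∂μ = ∫ ω, e n ω ∂μ - a := by
    intro n
    rw [integral_sub (hei n) ((hPi n).const_mul _), integral_const_mul, (hPmean n).2, mul_one]
  simp_rw [heq] at hG
  have h := hG.add_const (a : ℂ)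
  simp only [sub_add_cancel, zero_add] at h
  exact h

end MartingaleCLT

/-! ### Quadratic approximation of an objective function and its posterior mean -/

section Laplace

variable {E : Type*} [NormedAddCommGroup E] [InnerProductSpace ℝ E]

/-- The objective functions `Q n` have a well separated peak at `θ₀` of height of order `n`, and
near `θ₀` their gradients `G n` are those of the quadratic function with Hessian `-n J`, up to a
relative error that becomes arbitrarily small. -/
structure QuadraticPeak (Θ : Set E) (θ₀ : E) (J : E →L[ℝ] E) (Q : ℕ → E → ℝ) (G : ℕ → E → E) :
    Prop where
  symmetric : ∀ u v, inner ℝ (J u) v = inner ℝ u (J v)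
  coercive : ∃ c > 0, ∀ v, c * ‖v‖ ^ 2 ≤ inner ℝ v (J v)
  separated : ∀ δ > 0, ∃ c > 0, ∀ᶠ n : ℕ in atTop, ∀ θ ∈ Θ, δ ≤ ‖θ - θ₀‖ →
    Q n θ ≤ Q n θ₀ - c * n
  gradient : ∀ η > 0, ∃ r > 0, ∀ᶠ n : ℕ in atTop, ∀ θ ∈ Metric.ball θ₀ r,
    HasFDerivAt (Q n) (innerSL ℝ (G n θ)) θ ∧ ∀ θ' ∈ Metric.ball θ₀ r,
      ‖G n θ - G n θ' + (n : ℝ) • J (θ - θ')‖ ≤ η * n * ‖θ - θ'‖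

namespace QuadraticPeak

variable {Θ : Set E} {θ₀ : E} {J : E →L[ℝ] E} {Q : ℕ → E → ℝ} {G : ℕ → E → E} {m : ℕ → E}

theorem tendsto_argmax (h : QuadraticPeak Θ θ₀ J Q G) (hθ₀ : θ₀ ∈ Θ)
    (hm : ∀ n, m n ∈ Θ ∧ IsMaxOn (Q n) Θ (m n)) : Tendsto m atTop (𝓝 θ₀) := by
  refine Metric.tendsto_nhds.2 fun δ hδ => ?_
  obtain ⟨c, hc, hev⟩ := h.separated δ hδ
  filter_upwards [hev, eventually_gt_atTop 0] with n hn hn0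
  rw [dist_eq_norm]
  by_contra! hle
  have h1 := hn (m n) (hm n).1 hle
  have h2 : Q n θ₀ ≤ Q n (m n) := (hm n).2 hθ₀
  have h3 : 0 < c * n := by positivity
  linarith

theorem eventually_gradient_argmax_eq_zero (h : QuadraticPeak Θ θ₀ J Q G)
    (hθ₀ : θ₀ ∈ interior Θ) (hm : ∀ n, m n ∈ Θ ∧ IsMaxOn (Q n) Θ (m n)) :
    ∀ᶠ n in atTop, G n (m n) = 0 := by
  have hlim := h.tendsto_argmax (interior_subset hθ₀) hm
  obtain ⟨r, hr, hev⟩ := h.gradient 1 one_pos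
  filter_upwards [hev, hlim.eventually (isOpen_interior.mem_nhds hθ₀),
    hlim.eventually (Metric.ball_mem_nhds θ₀ hr)] with n h1 h2 h3
  have hmax : IsLocalMax (Q n) (m n) := (hm n).2.isLocalMax (mem_interior_iff_mem_nhds.1 h2)
  have h4 := hmax.hasFDerivAt_eq_zero (h1 (m n) h3).1
  have h5 : inner ℝ (G n (m n)) (G n (m n)) = 0 := by
    have := DFunLike.congr_fun h4 (G n (m n))
    simpa using this
  exact inner_self_eq_zero.1 h5

theorem eventually_norm_gradient_sub_le (h : QuadraticPeak Θ θ₀ J Q G)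
    (hθ₀ : θ₀ ∈ interior Θ) (hm : ∀ n, m n ∈ Θ ∧ IsMaxOn (Q n) Θ (m n)) {η : ℝ} (hη : 0 < η) :
    ∀ᶠ n : ℕ in atTop, ‖G n θ₀ - (n : ℝ) • J (m n - θ₀)‖ ≤ η * n * ‖m n - θ₀‖ := by
  have hlim := h.tendsto_argmax (interior_subset hθ₀) hm
  obtain ⟨r, hr, hev⟩ := h.gradient η hη
  filter_upwards [hev, h.eventually_gradient_argmax_eq_zero hθ₀ hm,
    hlim.eventually (Metric.ball_mem_nhds θ₀ hr)] with n h1 h2 h3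
  have h4 := (h1 θ₀ (Metric.mem_ball_self hr)).2 (m n) h3
  rw [h2, sub_zero, norm_sub_rev θ₀ (m n), ← neg_sub (m n) θ₀, map_neg, smul_neg,
    ← sub_eq_add_neg] at h4
  exact h4

/-- Second order expansion at the maximizer, from the mean value inequality for the difference of
`Q n` and its quadratic approximation. -/
theorem exists_ball_abs_sub_add_le (h : QuadraticPeak Θ θ₀ J Q G) (hθ₀ : θ₀ ∈ interior Θ)
    (hm : ∀ n, m n ∈ Θ ∧ IsMaxOn (Q n) Θ (m n)) {η : ℝ} (hη : 0 < η) :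
    ∃ r > 0, ∀ᶠ n : ℕ in atTop, ∀ θ ∈ Metric.ball θ₀ r,
      |Q n θ - Q n (m n) + (n : ℝ) / 2 * inner ℝ (θ - m n) (J (θ - m n))|
        ≤ η * n * ‖θ - m n‖ ^ 2 := by
  have hlim := h.tendsto_argmax (interior_subset hθ₀) hm
  obtain ⟨r, hr, hev⟩ := h.gradient η hη
  refine ⟨r, hr, ?_⟩
  filter_upwards [hev, h.eventually_gradient_argmax_eq_zero hθ₀ hm,
    hlim.eventually (Metric.ball_mem_nhds θ₀ hr)] with n h1 h2 h3 θ hθ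
  set s := Metric.ball θ₀ r ∩ Metric.closedBall (m n) ‖θ - m n‖ with hs
  have hconv : Convex ℝ s := (convex_ball _ _).inter (convex_closedBall _ _)
  set R : E → ℝ := fun x => Q n x + (n : ℝ) / 2 * inner ℝ (x - m n) (J (x - m n)) with hR
  have hderiv : ∀ x ∈ s, HasFDerivWithinAt R
      (innerSL ℝ (G n x + (n : ℝ) • J (x - m n))) s x := by
    intro x hx
    have hid : HasFDerivAt (fun x : E => x - m n) (ContinuousLinearMap.id ℝ E) x :=
      (hasFDerivAt_id x).sub_const (m n)
    have hJ : HasFDerivAt (fun x : E => J (x - m n)) (J.comp (ContinuousLinearMap.id ℝ E)) x :=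
      J.hasFDerivAt.comp x hid
    have hin := (hid.inner ℝ hJ).const_mul ((n : ℝ) / 2)
    have := (h1 x hx.1).1.add hin
    refine (this.congr_fderiv ?_).hasFDerivWithinAt
    ext v
    simp only [add_apply, smul_apply, innerSL_apply_apply,
      ContinuousLinearMap.comp_apply, ContinuousLinearMap.prod_apply, fderivInnerCLM_apply,
      ContinuousLinearMap.id_apply, inner_add_left, inner_smul_left, smul_eq_mul, RCLike.conj_to_real]
    rw [← h.symmetric (x - m n) v, real_inner_comm v (J (x - m n))]
    ring
  have hbound : ∀ x ∈ s, ‖innerSL ℝ (G n x + (n : ℝ) • J (x - m n))‖ ≤ η * n * ‖θ - m n‖ := by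
    intro x hx
    rw [innerSL_apply_norm]
    have h4 := (h1 x hx.1).2 (m n) h3
    rw [h2, sub_zero] at h4
    refine h4.trans ?_
    have h5 : ‖x - m n‖ ≤ ‖θ - m n‖ := by
      rw [← dist_eq_norm]
      exact hx.2
    gcongr
  have key := hconv.norm_image_sub_le_of_norm_hasFDerivWithin_le hderiv hbound
    (x := m n) (y := θ) ⟨h3, by simp⟩ ⟨hθ, by simp [dist_eq_norm]⟩
  have h6 : R θ - R (m n)
      = Q n θ - Q n (m n) + (n : ℝ) / 2 * inner ℝ (θ - m n) (J (θ - m n)) := by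
    simp only [hR, sub_self, inner_zero_left, mul_zero]
    ring
  rw [h6, Real.norm_eq_abs] at key
  exact key.trans_eq (by ring)

end QuadraticPeak

theorem tendsto_sqrt_pow_mul_exp_neg (k : ℕ) {c : ℝ} (hc : 0 < c) (D : ℝ) :
    Tendsto (fun n : ℕ => √(n : ℝ) ^ k * (Real.exp (-(c * n)) * (1 + √(n : ℝ) * D))) atTop
      (𝓝 0) := by
  have hs : Tendsto (fun n : ℕ => √(n : ℝ)) atTop atTop :=
    Real.tendsto_sqrt_atTop.comp tendsto_natCast_atTop_atTop
  have h1 : Tendsto (fun x : ℝ => x ^ k * Real.exp (-x) + D * (x ^ (k + 1) * Real.exp (-x))) atTop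
      (𝓝 0) := by
    simpa using (Real.tendsto_pow_mul_exp_neg_atTop_nhds_zero k).add
      ((Real.tendsto_pow_mul_exp_neg_atTop_nhds_zero (k + 1)).const_mul D)
  -- for `√n ≥ 1 / c` the exponent `-c n` is at most `-√n`
  have h2 : Tendsto (fun n : ℕ => Real.exp (√(n : ℝ) - c * n)) atTop (𝓝 0) := by
    refine Real.tendsto_exp_atBot.comp ?_
    have h3 : Tendsto (fun x : ℝ => x * (1 - c * x)) atTop atBot := by
      refine tendsto_id.atTop_mul_atBot₀ ?_
      have h4 : Tendsto (fun x : ℝ => 1 + -(c * x)) atTop atBot :=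
        tendsto_atBot_add_const_left _ 1 (tendsto_neg_atTop_atBot.comp
          (tendsto_id.const_mul_atTop hc))
      simpa [sub_eq_add_neg] using h4
    refine (h3.comp hs).congr fun n => ?_
    simp only [Function.comp_apply]
    have := Real.mul_self_sqrt (Nat.cast_nonneg (α := ℝ) n)
    linear_combination (-c) * this
  have h5 := (h1.comp hs).mul h2
  rw [zero_mul] at h5
  refine h5.congr fun n => ?_
  simp only [Function.comp_apply]
  have e : Real.exp (-(c * n)) = Real.exp (-√(n : ℝ)) * Real.exp (√(n : ℝ) - c * n) := by
    rw [← Real.exp_add]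
    congr 1
    ring
  rw [e]
  ring

variable [FiniteDimensional ℝ E] [MeasurableSpace E] [BorelSpace E]

theorem integrable_exp_neg_mul_sq_norm {b : ℝ} (hb : 0 < b) :
    Integrable fun u : E => Real.exp (-b * ‖u‖ ^ 2) := by
  have h := (GaussianFourier.integrable_cexp_neg_mul_sq_norm_add (V := E) (b := (b : ℂ))
    (by simpa using hb) 0 0).norm
  refine h.congr (ae_of_all _ fun u => ?_)
  simp only [inner_zero_left, Complex.ofReal_zero, mul_zero, add_zero, Complex.norm_exp]
  congr 1
  norm_cast

theorem integrable_exp_neg_mul_sq_norm_mul_one_add_norm {b : ℝ} (hb : 0 < b) :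
    Integrable fun u : E => Real.exp (-b * ‖u‖ ^ 2) * (1 + ‖u‖) := by
  have h := (integrable_exp_neg_mul_sq_norm (E := E) (half_pos hb)).const_mul
    (Real.exp (1 / (2 * b)))
  refine h.mono' (by fun_prop) (ae_of_all _ fun u => ?_)
  rw [Real.norm_eq_abs, abs_of_nonneg (by positivity), ← Real.exp_add]
  calc Real.exp (-b * ‖u‖ ^ 2) * (1 + ‖u‖) ≤ Real.exp (-b * ‖u‖ ^ 2) * Real.exp ‖u‖ := by
        gcongr
        rw [add_comm]
        exact Real.add_one_le_exp _
    _ = Real.exp (-b * ‖u‖ ^ 2 + ‖u‖) := (Real.exp_add _ _).symm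
    _ ≤ _ := by
        refine Real.exp_le_exp.2 ?_
        have h1 : 1 / (2 * b) + -(b / 2) * ‖u‖ ^ 2 - (-b * ‖u‖ ^ 2 + ‖u‖)
            = (b * ‖u‖ - 1) ^ 2 / (2 * b) := by
          field_simp
          ring
        have h2 : 0 ≤ (b * ‖u‖ - 1) ^ 2 / (2 * b) := by positivity
        linarith

/-- Rescaling of an integral by the change of variables `θ = m + a⁻¹ u`. -/
theorem pow_smul_setIntegral_eq {F : Type*} [NormedAddCommGroup F] [NormedSpace ℝ F]
    {S : Set E} (hS : MeasurableSet S) (g : E → F) (m : E) {a : ℝ} (ha : 0 < a) :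
    a ^ Module.finrank ℝ E • ∫ θ in S, g θ = ∫ u, S.indicator g (m + a⁻¹ • u) := by
  rw [← integral_indicator hS,
    Measure.integral_comp_inv_smul_of_nonneg volume (fun x => S.indicator g (m + x)) ha.le,
    integral_add_left_eq_self (μ := volume) (S.indicator g) m]

namespace QuadraticPeak

variable {Θ : Set E} {θ₀ : E} {J : E →L[ℝ] E} {Q : ℕ → E → ℝ} {G : ℕ → E → E} {m : ℕ → E}
  {prior : E → ℝ} {F : Type*} [NormedAddCommGroup F] [NormedSpace ℝ F]

theorem integrableOn_weight_smul (hΘ : IsCompact Θ) (hQ : ∀ n, Measurable (Q n))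
    (hm : ∀ n, m n ∈ Θ ∧ IsMaxOn (Q n) Θ (m n)) (hπm : Measurable prior)
    (hπ0 : ∀ θ, 0 ≤ prior θ) (hπi : IntegrableOn prior Θ) {φ : E → F} (hφ : Continuous φ)
    (hφ1 : ∀ u, ‖φ u‖ ≤ 1 + ‖u‖) (n : ℕ) :
    IntegrableOn (fun θ => (Real.exp (Q n θ - Q n (m n)) * prior θ) •
      φ (√(n : ℝ) • (θ - m n))) Θ := by
  refine Integrable.mono' (g := fun θ => (1 + √(n : ℝ) * Metric.diam Θ) * prior θ)
    (hπi.const_mul _) ?_ ?_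
  · have h1 : Measurable fun θ => Real.exp (Q n θ - Q n (m n)) * prior θ :=
      ((hQ n).sub_const _).exp.mul hπm
    have h2 : Continuous fun θ => φ (√(n : ℝ) • (θ - m n)) := by fun_prop
    exact h1.aestronglyMeasurable.smul h2.aestronglyMeasurable
  · filter_upwards [ae_restrict_mem hΘ.measurableSet] with θ hθ
    have h1 : Real.exp (Q n θ - Q n (m n)) ≤ 1 := by
      rw [Real.exp_le_one_iff, sub_nonpos]
      exact (hm n).2 hθ
    have h2 : ‖φ (√(n : ℝ) • (θ - m n))‖ ≤ 1 + √(n : ℝ) * Metric.diam Θ := by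
      refine (hφ1 _).trans ?_
      rw [norm_smul, Real.norm_eq_abs, abs_of_nonneg (Real.sqrt_nonneg _), ← dist_eq_norm]
      gcongr
      exact Metric.dist_le_diam_of_mem hΘ.isBounded hθ (hm n).1
    rw [norm_smul, Real.norm_eq_abs, abs_of_nonneg (mul_nonneg (Real.exp_pos _).le (hπ0 θ))]
    calc Real.exp (Q n θ - Q n (m n)) * prior θ * ‖φ (√(n : ℝ) • (θ - m n))‖
        ≤ 1 * prior θ * (1 + √(n : ℝ) * Metric.diam Θ) := by
          have := hπ0 θ
          gcongr
      _ = _ := by ring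

/-- **Laplace's method.** In the scale `u = √n (θ - m n)` around the maximizer, the posterior weight
tends to a centred Gaussian density with precision `J`. Away from the peak the weight is
exponentially small; near the peak the expansion of `Q n` gives both the pointwise limit and a
Gaussian bound for dominated convergence. -/
theorem tendsto_rescaled_integral (h : QuadraticPeak Θ θ₀ J Q G) (hΘ : IsCompact Θ)
    (hθ₀ : θ₀ ∈ interior Θ) (hQ : ∀ n, Measurable (Q n))
    (hm : ∀ n, m n ∈ Θ ∧ IsMaxOn (Q n) Θ (m n)) (hπm : Measurable prior)
    (hπ0 : ∀ θ, 0 ≤ prior θ) (hπi : IntegrableOn prior Θ) (hπc : ContinuousAt prior θ₀)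
    {φ : E → F} (hφ : Continuous φ) (hφ1 : ∀ u, ‖φ u‖ ≤ 1 + ‖u‖) :
    Tendsto (fun n : ℕ => √(n : ℝ) ^ Module.finrank ℝ E •
      ∫ θ in Θ, (Real.exp (Q n θ - Q n (m n)) * prior θ) • φ (√(n : ℝ) • (θ - m n))) atTop
      (𝓝 (∫ u, (Real.exp (-(inner ℝ u (J u) / 2)) * prior θ₀) • φ u)) := by
  have hΘm := hΘ.measurableSet
  have hlim := h.tendsto_argmax (interior_subset hθ₀) hm
  obtain ⟨c, hc, hJ⟩ := h.coercive
  obtain ⟨r₁, hr₁, hexp⟩ := h.exists_ball_abs_sub_add_le hθ₀ hm (η := c / 4) (by positivity)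
  obtain ⟨r₂, hr₂, hpr⟩ := Metric.eventually_nhds_iff_ball.1
    (hπc.eventually_lt_const (lt_add_one (prior θ₀)))
  set r := min r₁ r₂ with hr
  have hr0 : 0 < r := lt_min hr₁ hr₂
  set δ := r / 2 with hδ
  have hδ0 : 0 < δ := half_pos hr0
  set g : ℕ → E → F := fun n θ =>
    (Real.exp (Q n θ - Q n (m n)) * prior θ) • φ (√(n : ℝ) • (θ - m n)) with hg
  have hgi : ∀ n, IntegrableOn (g n) Θ := fun n =>
    integrableOn_weight_smul hΘ hQ hm hπm hπ0 hπi hφ hφ1 n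
  have hsplit : ∀ n, ∫ θ in Θ, g n θ = (∫ θ in Θ ∩ Metric.ball (m n) δ, g n θ)
      + ∫ θ in Θ \ Metric.ball (m n) δ, g n θ := fun n =>
    (integral_inter_add_sdiff Metric.isOpen_ball.measurableSet (hgi n)).symm
  -- the contribution of parameters away from the maximizer
  have hfar : Tendsto (fun n : ℕ => √(n : ℝ) ^ Module.finrank ℝ E •
      ∫ θ in Θ \ Metric.ball (m n) δ, g n θ) atTop (𝓝 0) := by
    obtain ⟨b, hb, hsep⟩ := h.separated (δ / 2) (half_pos hδ0)
    have hz := (tendsto_sqrt_pow_mul_exp_neg (Module.finrank ℝ E) hb (Metric.diam Θ)).mul_const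
      (∫ θ in Θ, prior θ)
    rw [zero_mul] at hz
    refine squeeze_zero_norm' ?_ hz
    filter_upwards [hsep, hlim.eventually (Metric.ball_mem_nhds θ₀ (half_pos hδ0))] with n h1 h2
    rw [norm_smul, Real.norm_eq_abs, abs_of_nonneg (by positivity), mul_assoc]
    refine mul_le_mul_of_nonneg_left ?_ (by positivity)
    have hD : 0 ≤ Metric.diam Θ := Metric.diam_nonneg
    calc ‖∫ θ in Θ \ Metric.ball (m n) δ, g n θ‖
        ≤ ∫ θ in Θ \ Metric.ball (m n) δ,
            Real.exp (-(b * n)) * (1 + √(n : ℝ) * Metric.diam Θ) * prior θ := by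
          refine norm_integral_le_of_norm_le ((hπi.mono_set Set.sdiff_subset).const_mul _) ?_
          filter_upwards [ae_restrict_mem (hΘm.diff Metric.isOpen_ball.measurableSet)] with θ hθ
          have h3 : δ ≤ ‖θ - m n‖ := by
            simpa [dist_eq_norm] using hθ.2
          have h4 : ‖m n - θ₀‖ < δ / 2 := by simpa [dist_eq_norm] using h2
          have h5 : ‖θ - m n‖ ≤ ‖θ - θ₀‖ + ‖m n - θ₀‖ := by
            have := norm_sub_le (θ - θ₀) (m n - θ₀)
            rwa [sub_sub_sub_cancel_right] at this
          have h6 := h1 θ hθ.1 (by linarith)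
          have h7 : Q n θ₀ ≤ Q n (m n) := (hm n).2 (interior_subset hθ₀)
          have h8 : ‖φ (√(n : ℝ) • (θ - m n))‖ ≤ 1 + √(n : ℝ) * Metric.diam Θ := by
            refine (hφ1 _).trans ?_
            rw [norm_smul, Real.norm_eq_abs, abs_of_nonneg (Real.sqrt_nonneg _), ← dist_eq_norm]
            gcongr
            exact Metric.dist_le_diam_of_mem hΘ.isBounded hθ.1 (hm n).1
          have h9 : Real.exp (Q n θ - Q n (m n)) ≤ Real.exp (-(b * n)) :=
            Real.exp_le_exp.2 (by linarith)
          have h10 := hπ0 θ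
          simp only [hg]
          rw [norm_smul, Real.norm_eq_abs, abs_of_nonneg (mul_nonneg (Real.exp_pos _).le h10)]
          calc Real.exp (Q n θ - Q n (m n)) * prior θ * ‖φ (√(n : ℝ) • (θ - m n))‖
              ≤ Real.exp (-(b * n)) * prior θ * (1 + √(n : ℝ) * Metric.diam Θ) := by gcongr
            _ = _ := by ring
      _ = Real.exp (-(b * n)) * (1 + √(n : ℝ) * Metric.diam Θ) *
            ∫ θ in Θ \ Metric.ball (m n) δ, prior θ := integral_const_mul _ _
      _ ≤ Real.exp (-(b * n)) * (1 + √(n : ℝ) * Metric.diam Θ) * ∫ θ in Θ, prior θ := by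
          refine mul_le_mul_of_nonneg_left ?_ (by positivity)
          exact setIntegral_mono_set hπi (ae_of_all _ hπ0) Set.sdiff_subset.eventuallyLE
  -- the contribution of parameters near the maximizer
  have hloc : Tendsto (fun n : ℕ => ∫ u, (Θ ∩ Metric.ball (m n) δ).indicator (g n)
      (m n + (√(n : ℝ))⁻¹ • u)) atTop
      (𝓝 (∫ u, (Real.exp (-(inner ℝ u (J u) / 2)) * prior θ₀) • φ u)) := by
    have hmr : ∀ᶠ n in atTop, Metric.ball (m n) δ ⊆ Metric.ball θ₀ r := by
      filter_upwards [hlim.eventually (Metric.ball_mem_nhds θ₀ hδ0)] with n hn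
      refine Metric.ball_subset_ball' ?_
      have : dist (m n) θ₀ < δ := hn
      linarith
    have hbound_int : Integrable fun u : E => (prior θ₀ + 1) *
        (Real.exp (-(c / 4) * ‖u‖ ^ 2) * (1 + ‖u‖)) :=
      (integrable_exp_neg_mul_sq_norm_mul_one_add_norm (by positivity)).const_mul _
    refine tendsto_integral_filter_of_dominated_convergence _ ?_ ?_ hbound_int ?_
    · refine Eventually.of_forall fun n => ?_
      have h1 : Measurable fun θ => Real.exp (Q n θ - Q n (m n)) * prior θ :=
        ((hQ n).sub_const _).exp.mul hπm
      have h2 : Continuous fun θ => φ (√(n : ℝ) • (θ - m n)) := by fun_prop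
      have h3 : StronglyMeasurable ((Θ ∩ Metric.ball (m n) δ).indicator (g n)) :=
        (h1.stronglyMeasurable.smul h2.stronglyMeasurable).indicator
          (hΘm.inter Metric.isOpen_ball.measurableSet)
      exact (h3.comp_measurable (g := fun u : E => m n + (√(n : ℝ))⁻¹ • u)
        (by fun_prop)).aestronglyMeasurable
    · filter_upwards [hexp, hmr, eventually_gt_atTop 0] with n h1 h2 hn0
      refine ae_of_all _ fun u => ?_
      have hn : (0 : ℝ) < n := by exact_mod_cast hn0
      have hsq : 0 < √(n : ℝ) := Real.sqrt_pos.2 hn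
      by_cases hu : m n + (√(n : ℝ))⁻¹ • u ∈ Θ ∩ Metric.ball (m n) δ
      swap
      · rw [Set.indicator_of_notMem hu, norm_zero]
        have := hπ0 θ₀
        positivity
      rw [Set.indicator_of_mem hu]
      set θ := m n + (√(n : ℝ))⁻¹ • u with hθ
      have hθr : θ ∈ Metric.ball θ₀ r := h2 hu.2
      have e1 : θ - m n = (√(n : ℝ))⁻¹ • u := by rw [hθ, add_sub_cancel_left]
      have e2 : √(n : ℝ) • (θ - m n) = u := by rw [e1, smul_inv_smul₀ hsq.ne']
      have e3 : (n : ℝ) * ‖θ - m n‖ ^ 2 = ‖u‖ ^ 2 := by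
        rw [e1, norm_smul, mul_pow, Real.norm_eq_abs, sq_abs, inv_pow, Real.sq_sqrt hn.le,
          mul_inv_cancel_left₀ hn.ne']
      have h3 := (abs_le.1 (h1 θ (Metric.ball_subset_ball (min_le_left _ _) hθr))).2
      have h4 := mul_le_mul_of_nonneg_left (hJ (θ - m n)) (by positivity : 0 ≤ (n : ℝ) / 2)
      have h5 : Q n θ - Q n (m n) ≤ -(c / 4) * ‖u‖ ^ 2 := by
        rw [← e3]
        linarith
      have h6 := (hpr θ (Metric.ball_subset_ball (min_le_right _ _) hθr)).le
      have h7 := hπ0 θ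
      simp only [hg]
      rw [e2, norm_smul, Real.norm_eq_abs, abs_of_nonneg (mul_nonneg (Real.exp_pos _).le h7)]
      calc Real.exp (Q n θ - Q n (m n)) * prior θ * ‖φ u‖
          ≤ Real.exp (-(c / 4) * ‖u‖ ^ 2) * (prior θ₀ + 1) * (1 + ‖u‖) := by
            have := Real.exp_le_exp.2 h5
            have := hφ1 u
            have := hπ0 θ₀
            gcongr
        _ = _ := by ring
    · refine ae_of_all _ fun u => ?_
      have hinv : Tendsto (fun n : ℕ => (√(n : ℝ))⁻¹) atTop (𝓝 0) :=
        tendsto_inv_atTop_zero.comp (Real.tendsto_sqrt_atTop.comp tendsto_natCast_atTop_atTop)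
      have hsm : Tendsto (fun n : ℕ => (√(n : ℝ))⁻¹ • u) atTop (𝓝 0) := by
        simpa using hinv.smul_const u
      have hθlim : Tendsto (fun n : ℕ => m n + (√(n : ℝ))⁻¹ • u) atTop (𝓝 θ₀) := by
        simpa using hlim.add hsm
      have hmem : ∀ᶠ n : ℕ in atTop, m n + (√(n : ℝ))⁻¹ • u ∈ Θ ∩ Metric.ball (m n) δ := by
        filter_upwards [hθlim.eventually (isOpen_interior.mem_nhds hθ₀),
          hsm.eventually (Metric.ball_mem_nhds 0 hδ0)] with n h1 h2
        refine ⟨interior_subset h1, ?_⟩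
        simpa [dist_eq_norm] using h2
      have hQlim : Tendsto (fun n : ℕ => Q n (m n + (√(n : ℝ))⁻¹ • u) - Q n (m n)) atTop
          (𝓝 (-(inner ℝ u (J u) / 2))) := by
        refine Metric.tendsto_nhds.2 fun ε hε => ?_
        obtain ⟨r', hr', hexp'⟩ := h.exists_ball_abs_sub_add_le hθ₀ hm
          (η := ε / (2 * (‖u‖ ^ 2 + 1))) (by positivity)
        filter_upwards [hexp', hθlim.eventually (Metric.ball_mem_nhds θ₀ hr'),
          eventually_gt_atTop 0] with n h1 h2 hn0
        have hn : (0 : ℝ) < n := by exact_mod_cast hn0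
        have h3 := h1 _ h2
        have e3 : (n : ℝ) * ((√(n : ℝ))⁻¹) ^ 2 = 1 := by
          rw [inv_pow, Real.sq_sqrt hn.le, mul_inv_cancel₀ hn.ne']
        rw [add_sub_cancel_left, norm_smul, mul_pow, Real.norm_eq_abs, sq_abs, map_smul,
          inner_smul_left, inner_smul_right, RCLike.conj_to_real] at h3
        have e4 : (n : ℝ) / 2 * ((√(n : ℝ))⁻¹ * ((√(n : ℝ))⁻¹ * inner ℝ u (J u)))
            = inner ℝ u (J u) / 2 := by
          linear_combination (inner ℝ u (J u) / 2) * e3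
        have e5 : ε / (2 * (‖u‖ ^ 2 + 1)) * n * ((√(n : ℝ))⁻¹ ^ 2 * ‖u‖ ^ 2)
            = ε / (2 * (‖u‖ ^ 2 + 1)) * ‖u‖ ^ 2 := by
          linear_combination (ε / (2 * (‖u‖ ^ 2 + 1)) * ‖u‖ ^ 2) * e3
        rw [e4, e5] at h3
        rw [Real.dist_eq, sub_neg_eq_add]
        refine h3.trans_lt ?_
        rw [div_mul_eq_mul_div, div_lt_iff₀ (by positivity)]
        nlinarith [sq_nonneg ‖u‖]
      have hfin := (((Real.continuous_exp.tendsto _).comp hQlim).mul (hπc.tendsto.comp hθlim)).smul_const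
        (φ u)
      refine hfin.congr' ?_
      filter_upwards [hmem, eventually_gt_atTop 0] with n h1 hn0
      have hsq : 0 < √(n : ℝ) := Real.sqrt_pos.2 (by exact_mod_cast hn0)
      rw [Set.indicator_of_mem h1]
      simp only [hg, Function.comp_apply, add_sub_cancel_left, smul_inv_smul₀ hsq.ne']
  have hsum := hloc.add hfar
  rw [add_zero] at hsum
  refine hsum.congr' ?_
  filter_upwards [eventually_gt_atTop 0] with n hn0
  have hsq : 0 < √(n : ℝ) := Real.sqrt_pos.2 (by exact_mod_cast hn0)
  rw [← pow_smul_setIntegral_eq (hΘm.inter Metric.isOpen_ball.measurableSet) (g n) (m n) hsq,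
    ← smul_add, ← hsplit]

/-- The posterior mean is within `o(1 / √n)` of the maximizer: by Laplace's method the limit of
`√n` times their difference is the mean of a centred Gaussian law. -/
theorem tendsto_sqrt_smul_posteriorMean_sub (h : QuadraticPeak Θ θ₀ J Q G) (hΘ : IsCompact Θ)
    (hθ₀ : θ₀ ∈ interior Θ) (hQ : ∀ n, Measurable (Q n))
    (hm : ∀ n, m n ∈ Θ ∧ IsMaxOn (Q n) Θ (m n)) (hπm : Measurable prior)
    (hπ0 : ∀ θ, 0 ≤ prior θ) (hπi : IntegrableOn prior Θ) (hπc : ContinuousAt prior θ₀)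
    (hπpos : 0 < prior θ₀) :
    Tendsto (fun n : ℕ => √(n : ℝ) • ((∫ θ in Θ, (Real.exp (Q n θ) * prior θ /
      ∫ θ' in Θ, Real.exp (Q n θ') * prior θ') • θ) - m n)) atTop (𝓝 0) := by
  have hone := h.tendsto_rescaled_integral hΘ hθ₀ hQ hm hπm hπ0 hπi hπc (φ := fun _ => (1 : ℝ))
    continuous_const fun u => by simp
  have hid := h.tendsto_rescaled_integral hΘ hθ₀ hQ hm hπm hπ0 hπi hπc (φ := fun u : E => u)
    continuous_id fun u => by simp
  have hodd : ∫ u, (Real.exp (-(inner ℝ u (J u) / 2)) * prior θ₀) • u = 0 := by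
    have h1 := integral_neg_eq_self
      (fun u : E => (Real.exp (-(inner ℝ u (J u) / 2)) * prior θ₀) • u) volume
    simp only [map_neg, inner_neg_left, inner_neg_right, neg_neg, smul_neg, integral_neg] at h1
    have h2 : (2 : ℝ) • ∫ u, (Real.exp (-(inner ℝ u (J u) / 2)) * prior θ₀) • u = 0 := by
      rw [two_smul]
      nth_rewrite 1 [← h1]
      exact neg_add_cancel _
    exact (smul_eq_zero.1 h2).resolve_left two_ne_zero
  obtain ⟨c, hc, hJ⟩ := h.coercive
  have hgi : Integrable fun u : E => Real.exp (-(inner ℝ u (J u) / 2)) := by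
    refine (integrable_exp_neg_mul_sq_norm (half_pos hc)).mono' (by fun_prop)
      (ae_of_all _ fun u => ?_)
    rw [Real.norm_eq_abs, abs_of_nonneg (Real.exp_pos _).le]
    refine Real.exp_le_exp.2 ?_
    have := hJ u
    linarith
  have hZpos : 0 < ∫ u : E, (Real.exp (-(inner ℝ u (J u) / 2)) * prior θ₀) • (1 : ℝ) := by
    simp only [smul_eq_mul, mul_one]
    rw [integral_mul_const]
    exact mul_pos (integral_exp_pos hgi) hπpos
  rw [hodd] at hid
  have hquot := (hone.inv₀ hZpos.ne').smul hid
  rw [smul_zero] at hquot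
  refine hquot.congr' ?_
  filter_upwards [hone.eventually_const_lt hZpos, eventually_gt_atTop 0] with n hZn hn0
  have hsq : 0 < √(n : ℝ) := Real.sqrt_pos.2 (by exact_mod_cast hn0)
  set w : E → ℝ := fun θ => Real.exp (Q n θ - Q n (m n)) * prior θ with hw
  have hwi : IntegrableOn w Θ := by
    have := integrableOn_weight_smul hΘ hQ hm hπm hπ0 hπi (φ := fun _ => (1 : ℝ))
      continuous_const (fun u => by simp) n
    simpa only [smul_eq_mul, mul_one] using this
  have hwidi : IntegrableOn (fun θ => w θ • √(n : ℝ) • (θ - m n)) Θ :=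
    integrableOn_weight_smul hΘ hQ hm hπm hπ0 hπi (φ := fun u : E => u)
      continuous_id (fun u => by simp) n
  have hwm : IntegrableOn (fun θ => w θ • m n) Θ := hwi.smul_const (m n)
  have hexpw : ∀ θ, Real.exp (Q n θ) * prior θ = Real.exp (Q n (m n)) * w θ := by
    intro θ
    rw [hw, ← mul_assoc, ← Real.exp_add]
    ring_nf
  set Z := ∫ θ in Θ, w θ with hZ
  simp only [smul_eq_mul, mul_one] at hZn
  have hZ0 : Z ≠ 0 := by
    intro h0
    rw [← hZ, h0, mul_zero] at hZn
    exact lt_irrefl _ hZn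
  have hpost : ∀ θ, Real.exp (Q n θ) * prior θ / ∫ θ' in Θ, Real.exp (Q n θ') * prior θ'
      = Z⁻¹ * w θ := by
    intro θ
    simp_rw [hexpw]
    rw [integral_const_mul, ← hZ, mul_div_mul_left _ _ (Real.exp_pos _).ne', div_eq_inv_mul]
  set V := ∫ θ in Θ, w θ • √(n : ℝ) • (θ - m n) with hV
  have hmean : ∫ θ in Θ, w θ • θ = (√(n : ℝ))⁻¹ • V + Z • m n := by
    have hdecomp : ∀ θ, w θ • θ = (√(n : ℝ))⁻¹ • (w θ • √(n : ℝ) • (θ - m n)) + w θ • m n := by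
      intro θ
      rw [smul_comm (w θ) (√(n : ℝ)), inv_smul_smul₀ hsq.ne', ← smul_add, sub_add_cancel]
    simp_rw [hdecomp]
    rw [hV, hZ, ← integral_smul, ← integral_smul_const]
    exact integral_add (hwidi.smul _) hwm
  have hpmean : ∫ θ in Θ, (Real.exp (Q n θ) * prior θ /
      ∫ θ' in Θ, Real.exp (Q n θ') * prior θ') • θ = Z⁻¹ • (√(n : ℝ))⁻¹ • V + m n := by
    simp_rw [hpost, mul_smul]
    rw [integral_smul, hmean, smul_add, inv_smul_smul₀ hZ0]
  have hZone : ∫ θ in Θ, (Real.exp (Q n θ - Q n (m n)) * prior θ) • (1 : ℝ) = Z := by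
    simp only [smul_eq_mul, mul_one, hZ, hw]
  rw [hpmean, add_sub_cancel_right, smul_comm Z⁻¹, smul_inv_smul₀ hsq.ne', hZone, smul_eq_mul,
    mul_inv, mul_comm, mul_smul, inv_smul_smul₀ (by positivity)]

end QuadraticPeak

end Laplace

/-! ### Gradients and Hessians in coordinates -/

section Calculus

variable {d : ℕ}

theorem fderiv_eq_inner_grad (g : EuclideanSpace ℝ (Fin d) → ℝ) (θ v : EuclideanSpace ℝ (Fin d)) :
    fderiv ℝ g θ v = inner ℝ (grad g θ) v := by
  conv_lhs => rw [← (EuclideanSpace.basisFun (Fin d) ℝ).sum_repr v]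
  simp [grad, PiLp.inner_apply, map_sum]

theorem innerSL_grad (g : EuclideanSpace ℝ (Fin d) → ℝ) (θ : EuclideanSpace ℝ (Fin d)) :
    innerSL ℝ (grad g θ) = fderiv ℝ g θ := by
  ext v
  rw [innerSL_apply_apply, fderiv_eq_inner_grad]

theorem norm_le_vecL1 (v : EuclideanSpace ℝ (Fin d)) : ‖v‖ ≤ vecL1 v := by
  conv_lhs => rw [← (EuclideanSpace.basisFun (Fin d) ℝ).sum_repr v]
  refine (norm_sum_le _ _).trans (Finset.sum_le_sum fun i _ => ?_)
  simp [norm_smul]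

theorem abs_apply_le_matL1 (A : Matrix (Fin d) (Fin d) ℝ) (i j : Fin d) : |A i j| ≤ matL1 A :=
  (Finset.single_le_sum (f := fun j => |A i j|) (fun _ _ => abs_nonneg _) (Finset.mem_univ j)).trans
    (Finset.single_le_sum (f := fun i => ∑ j, |A i j|)
      (fun _ _ => Finset.sum_nonneg fun _ _ => abs_nonneg _) (Finset.mem_univ i))

variable {g : EuclideanSpace ℝ (Fin d) → ℝ} {V : Set (EuclideanSpace ℝ (Fin d))}

theorem differentiableAt_of_contDiffOn_two (hV : IsOpen V) (hg : ContDiffOn ℝ 2 g V)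
    {θ : EuclideanSpace ℝ (Fin d)} (hθ : θ ∈ V) : DifferentiableAt ℝ g θ :=
  (hg.contDiffAt (hV.mem_nhds hθ)).differentiableAt (by norm_num)

theorem contDiffAt_fderiv_apply (hV : IsOpen V) (hg : ContDiffOn ℝ 2 g V)
    {θ : EuclideanSpace ℝ (Fin d)} (hθ : θ ∈ V) (v : EuclideanSpace ℝ (Fin d)) :
    ContDiffAt ℝ 1 (fun x => fderiv ℝ g x v) θ :=
  ((hg.contDiffAt (hV.mem_nhds hθ)).fderiv_right (m := 1) (by norm_num)).clm_apply contDiffAt_const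

theorem differentiableAt_fderiv_apply (hV : IsOpen V) (hg : ContDiffOn ℝ 2 g V)
    {θ : EuclideanSpace ℝ (Fin d)} (hθ : θ ∈ V) (v : EuclideanSpace ℝ (Fin d)) :
    DifferentiableAt ℝ (fun x => fderiv ℝ g x v) θ :=
  (contDiffAt_fderiv_apply hV hg hθ v).differentiableAt (by norm_num)

theorem continuousOn_hess_apply (hV : IsOpen V) (hg : ContDiffOn ℝ 2 g V) (i j : Fin d) :
    ContinuousOn (fun θ => hess g θ i j) V := by
  intro θ hθ
  have h := ((contDiffAt_fderiv_apply hV hg hθ (EuclideanSpace.single j 1)).fderiv_right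
    (m := 0) (by norm_num)).clm_apply
      (contDiffAt_const (c := (EuclideanSpace.single i 1 : EuclideanSpace ℝ (Fin d))))
  exact h.continuousAt.continuousWithinAt

theorem grad_sum {ι : Type*} (s : Finset ι) {h : ι → EuclideanSpace ℝ (Fin d) → ℝ}
    {θ : EuclideanSpace ℝ (Fin d)} (hh : ∀ t ∈ s, DifferentiableAt ℝ (h t) θ) :
    grad (fun x => ∑ t ∈ s, h t x) θ = ∑ t ∈ s, grad (h t) θ := by
  ext i
  rw [grad, fderiv_fun_sum hh]
  simp [grad]

theorem hess_sum {ι : Type*} (s : Finset ι) {h : ι → EuclideanSpace ℝ (Fin d) → ℝ}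
    (hV : IsOpen V) (hh : ∀ t ∈ s, ContDiffOn ℝ 2 (h t) V) {θ : EuclideanSpace ℝ (Fin d)}
    (hθ : θ ∈ V) (i j : Fin d) :
    hess (fun x => ∑ t ∈ s, h t x) θ i j = ∑ t ∈ s, hess (h t) θ i j := by
  have heq : (fun x => fderiv ℝ (fun x => ∑ t ∈ s, h t x) x (EuclideanSpace.single j 1)) =ᶠ[𝓝 θ]
      fun x => ∑ t ∈ s, fderiv ℝ (h t) x (EuclideanSpace.single j 1) := by
    filter_upwards [hV.mem_nhds hθ] with x hx
    rw [fderiv_fun_sum fun t ht => differentiableAt_of_contDiffOn_two hV (hh t ht) hx]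
    simp
  simp only [hess, Matrix.of_apply]
  rw [heq.fderiv_eq,
    fderiv_fun_sum fun t ht => differentiableAt_fderiv_apply hV (hh t ht) hθ _]
  simp

/-- A bound on the entries of the Hessian of `g` plus a constant symmetric matrix bounds the
increments of the gradient of `g` plus the corresponding linear map. -/
theorem norm_grad_sub_grad_add_le (hV : IsOpen V) (hconv : Convex ℝ V) (hg : ContDiffOn ℝ 2 g V)
    {A : Matrix (Fin d) (Fin d) ℝ} (hA : ∀ i j, A i j = A j i) {K : ℝ}
    (hK : ∀ x ∈ V, ∀ i j, |hess g x i j + A i j| ≤ K) {θ θ' : EuclideanSpace ℝ (Fin d)}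
    (hθ : θ ∈ V) (hθ' : θ' ∈ V) :
    ‖grad g θ - grad g θ' + Matrix.toEuclideanCLM (𝕜 := ℝ) A (θ - θ')‖ ≤
      (d : ℝ) ^ 2 * K * ‖θ - θ'‖ := by
  have hcoord : ∀ j, |(grad g θ - grad g θ' + Matrix.toEuclideanCLM (𝕜 := ℝ) A (θ - θ')) j| ≤
      d * K * ‖θ - θ'‖ := by
    intro j
    have hK0 : 0 ≤ K := (abs_nonneg _).trans (hK θ hθ j j)
    set H : EuclideanSpace ℝ (Fin d) → ℝ := fun x =>
      fderiv ℝ g x (EuclideanSpace.single j 1) + ∑ i, A i j * x i with hH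
    have hlin : ∀ x, HasFDerivAt (fun x : EuclideanSpace ℝ (Fin d) => ∑ i, A i j * x i)
        (∑ i, A i j • EuclideanSpace.proj (𝕜 := ℝ) i : EuclideanSpace ℝ (Fin d) →L[ℝ] ℝ) x := by
      intro x
      have := (∑ i, A i j • EuclideanSpace.proj (𝕜 := ℝ) i :
        EuclideanSpace ℝ (Fin d) →L[ℝ] ℝ).hasFDerivAt (x := x)
      refine this.congr_of_eventuallyEq (Eventually.of_forall fun y => ?_)
      simp
    have hderiv : ∀ x ∈ V, HasFDerivWithinAt H
        (fderiv ℝ (fun x => fderiv ℝ g x (EuclideanSpace.single j 1)) x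
          + ∑ i, A i j • EuclideanSpace.proj (𝕜 := ℝ) i) V x := fun x hx =>
      ((differentiableAt_fderiv_apply hV hg hx _).hasFDerivAt.add (hlin x)).hasFDerivWithinAt
    have hbound : ∀ x ∈ V, ‖fderiv ℝ (fun x => fderiv ℝ g x (EuclideanSpace.single j 1)) x
          + ∑ i, A i j • EuclideanSpace.proj (𝕜 := ℝ) i‖ ≤ d * K := by
      intro x hx
      refine ContinuousLinearMap.opNorm_le_bound _ (by positivity) fun v => ?_
      have hexp : (fderiv ℝ (fun x => fderiv ℝ g x (EuclideanSpace.single j 1)) x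
          + ∑ i, A i j • EuclideanSpace.proj (𝕜 := ℝ) i) v
          = ∑ i, v i * (hess g x i j + A i j) := by
        rw [add_apply, fderiv_eq_inner_grad]
        simp [PiLp.inner_apply, grad, hess, mul_add, Finset.sum_add_distrib, mul_comm]
      rw [hexp, Real.norm_eq_abs]
      calc |∑ i, v i * (hess g x i j + A i j)| ≤ ∑ i, |v i * (hess g x i j + A i j)| :=
            Finset.abs_sum_le_sum_abs _ _
        _ ≤ ∑ _i : Fin d, ‖v‖ * K := by
            refine Finset.sum_le_sum fun i _ => ?_
            rw [abs_mul]
            have h1 : |v i| ≤ ‖v‖ := PiLp.norm_apply_le v i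
            have h2 := hK x hx i j
            gcongr
        _ = d * K * ‖v‖ := by
            rw [Finset.sum_const, Finset.card_univ, Fintype.card_fin, nsmul_eq_mul]
            ring
    have key := hconv.norm_image_sub_le_of_norm_hasFDerivWithin_le hderiv hbound hθ' hθ
    rw [Real.norm_eq_abs] at key
    refine le_of_eq_of_le ?_ key
    congr 1
    have h3 : (Matrix.toEuclideanCLM (𝕜 := ℝ) A (θ - θ')) j = ∑ i, A i j * (θ i - θ' i) := by
      simp [Matrix.ofLp_toEuclideanCLM, Matrix.mulVec, dotProduct, hA j, mul_sub]
    rw [PiLp.add_apply, PiLp.sub_apply, h3]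
    simp only [hH, grad, mul_sub, Finset.sum_sub_distrib]
    ring
  calc _ ≤ _ := norm_le_vecL1 _
    _ ≤ ∑ _j : Fin d, (d : ℝ) * K * ‖θ - θ'‖ := Finset.sum_le_sum fun j _ => hcoord j
    _ = _ := by
      rw [Finset.sum_const, Finset.card_univ, Fintype.card_fin, nsmul_eq_mul]
      ring

end Calculus

section DerivativeFunctional

variable {Ω : Type*} [MeasurableSpace Ω] {μ : Measure Ω} {X : ℤ → Ω → ℝ}

/-- Directional derivatives in the parameter, as limits of difference quotients, are functionals of
the stationary process. -/
theorem IsStationaryFunctional.fderiv_apply {E : Type*} [NormedAddCommGroup E] [NormedSpace ℝ E]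
    {V : Set E} (hV : IsOpen V) {Φ : ℤ → E → Ω → ℝ}
    (hΦ : ∀ θ ∈ V, IsStationaryFunctional X μ fun t => Φ t θ)
    (hdiff : ∀ᵐ ω ∂μ, ∀ t, ∀ θ ∈ V, DifferentiableAt ℝ (fun θ => Φ t θ ω) θ)
    {θ : E} (hθ : θ ∈ V) (v : E) :
    IsStationaryFunctional X μ fun t ω => fderiv ℝ (fun θ => Φ t θ ω) θ v := by
  have hstep : Tendsto (fun k : ℕ => θ + ((k : ℝ) + 1)⁻¹ • v) atTop (𝓝 θ) := by
    have h1 : Tendsto (fun k : ℕ => ((k : ℝ) + 1)⁻¹) atTop (𝓝 0) := by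
      simpa using tendsto_one_div_add_atTop_nhds_zero_nat (𝕜 := ℝ)
    simpa using (h1.smul_const v).const_add θ
  obtain ⟨N, hN⟩ := eventually_atTop.1 (hstep.eventually (hV.mem_nhds hθ))
  have hc : Tendsto (fun k : ℕ => (((k + N : ℕ) : ℝ) + 1)) atTop atTop :=
    tendsto_atTop_add_const_right _ 1
      (tendsto_natCast_atTop_atTop.comp (tendsto_add_atTop_nat N))
  refine IsStationaryFunctional.of_tendsto
    (Y := fun k t ω => (((k + N : ℕ) : ℝ) + 1) •
      (Φ t (θ + (((k + N : ℕ) : ℝ) + 1)⁻¹ • v) ω - Φ t θ ω)) (fun k => ?_) fun t => ?_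
  · exact (hΦ _ (hN (k + N) (Nat.le_add_left N k))).comp₂ (hΦ θ hθ)
      (h := fun x y => (((k + N : ℕ) : ℝ) + 1) • (x - y)) (by fun_prop)
  · filter_upwards [hdiff] with ω hω
    exact (hω t θ hθ).hasFDerivAt.lim v (tendsto_norm_atTop_atTop.comp hc)

end DerivativeFunctional

/-! ### The objective function has a quadratic peak at the true parameter -/

section Peak

theorem eventually_sum_le_of_tendsto_average_biSup {E : Type*} {S : Set E} {a : ℕ → E → ℝ}
    (ha : ∀ t θ, 0 ≤ a t θ)
    (h : Tendsto (fun n : ℕ => (n : ℝ≥0∞)⁻¹ *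
      ∑ t ∈ Finset.Icc 1 n, ⨆ θ ∈ S, ENNReal.ofReal (a t θ)) atTop (𝓝 0)) {η : ℝ} (hη : 0 < η) :
    ∀ᶠ n : ℕ in atTop, ∀ θ ∈ S, ∑ t ∈ Finset.Icc 1 n, a t θ ≤ η * n := by
  filter_upwards [h.eventually_le_const (ENNReal.ofReal_pos.2 hη), eventually_gt_atTop 0]
    with n hn hn0 θ hθ
  have h1 : ∑ t ∈ Finset.Icc 1 n, ⨆ θ ∈ S, ENNReal.ofReal (a t θ) ≤ n * ENNReal.ofReal η := by
    rwa [mul_comm, ← div_eq_mul_inv, ENNReal.div_le_iff (by simpa using hn0.ne') (by simp),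
      mul_comm] at hn
  have h2 : ENNReal.ofReal (∑ t ∈ Finset.Icc 1 n, a t θ) ≤ ENNReal.ofReal (η * n) := by
    rw [ENNReal.ofReal_sum_of_nonneg fun t _ => ha t θ, ENNReal.ofReal_mul hη.le,
      ENNReal.ofReal_natCast, mul_comm]
    exact (Finset.sum_le_sum fun t _ =>
      le_biSup (fun θ => ENNReal.ofReal (a t θ)) hθ).trans h1
  exact (ENNReal.ofReal_le_ofReal_iff (by positivity)).1 h2

variable {d : ℕ} {Ω : Type*} [MeasurableSpace Ω] {μ : Measure Ω} {X : ℤ → Ω → ℝ}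
  {q : ℤ → EuclideanSpace ℝ (Fin d) → Ω → ℝ} {q' : ℕ → EuclideanSpace ℝ (Fin d) → Ω → ℝ}

theorem integrable_of_lintegral_biSup_lt_top {E : Type*} {S : Set E} {Φ : E → Ω → ℝ}
    (h : ∫⁻ ω, ⨆ θ ∈ S, ENNReal.ofReal |Φ θ ω| ∂μ < ∞) {θ : E} (hθ : θ ∈ S)
    (hm : AEMeasurable (Φ θ) μ) : Integrable (Φ θ) μ := by
  refine ⟨hm.aestronglyMeasurable, lt_of_le_of_lt (lintegral_mono fun ω => ?_) h⟩
  rw [Real.enorm_eq_ofReal_abs]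
  exact le_biSup (fun θ => ENNReal.ofReal |Φ θ ω|) hθ

variable {θ₀ : EuclideanSpace ℝ (Fin d)} {V : Set (EuclideanSpace ℝ (Fin d))}

theorem isStationaryFunctional_hess (hV : IsOpen V)
    (hq : ∀ θ ∈ V, IsStationaryFunctional X μ fun t => q t θ)
    (hsm : ∀ᵐ ω ∂μ, ∀ t, ContDiffOn ℝ 2 (fun θ => q t θ ω) V) (i j : Fin d)
    {θ : EuclideanSpace ℝ (Fin d)} (hθ : θ ∈ V) :
    IsStationaryFunctional X μ fun t ω => hess (fun θ => q t θ ω) θ i j := by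
  have h1 : ∀ θ ∈ V, IsStationaryFunctional X μ fun t ω =>
      fderiv ℝ (fun θ => q t θ ω) θ (EuclideanSpace.single j 1) := fun θ hθ =>
    IsStationaryFunctional.fderiv_apply hV hq
      (hsm.mono fun ω hω t θ hθ => differentiableAt_of_contDiffOn_two hV (hω t) hθ) hθ _
  exact IsStationaryFunctional.fderiv_apply
    (Φ := fun t θ ω => fderiv ℝ (fun θ => q t θ ω) θ (EuclideanSpace.single j 1)) hV h1
    (hsm.mono fun ω hω t θ hθ => differentiableAt_fderiv_apply hV (hω t) hθ _) hθ _

variable [IsProbabilityMeasure μ]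

/-- Wald's argument: if the mean of `q_0` has a strict maximum over the compact set `Θ` at `θ₀`, then
almost surely the feasible objective function at distance at least `δ` from `θ₀` is smaller than at
`θ₀` by an amount of order `n`. -/
theorem exists_ae_eventually_sum_le_sub (hX : StationaryErgodic X μ)
    {Θ : Set (EuclideanSpace ℝ (Fin d))} (hΘ : IsCompact Θ) (hθ₀ : θ₀ ∈ Θ) (hq : ∀ θ ∈ Θ, IsStationaryFunctional X μ fun t => q t θ)
    (hcont : ∀ᵐ ω ∂μ, ∀ t, ContinuousOn (fun θ => q t θ ω) Θ) (hA2 : A2 μ Θ q q')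
    (hmax : ∀ θ ∈ Θ, θ ≠ θ₀ → ∫ ω, q 0 θ ω ∂μ < ∫ ω, q 0 θ₀ ω ∂μ) {δ : ℝ} (hδ : 0 < δ) :
    ∃ c > 0, ∀ᵐ ω ∂μ, ∀ᶠ n : ℕ in atTop, ∀ θ ∈ Θ, δ ≤ ‖θ - θ₀‖ →
      ∑ t ∈ Finset.Icc 1 n, q' t θ ω ≤ ∑ t ∈ Finset.Icc 1 n, q' t θ₀ ω - c * n := by
  set K := Θ \ Metric.ball θ₀ δ with hK
  have hKc : IsCompact K := hΘ.diff Metric.isOpen_ball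
  have hint : ∀ θ ∈ Θ, Integrable (q 0 θ) μ := fun θ hθ =>
    integrable_of_lintegral_biSup_lt_top hA2.1 hθ ((hq θ hθ).aemeasurable hX 0)
  have hmain : ∃ c > 0, ∀ᵐ ω ∂μ, ∀ᶠ n : ℕ in atTop, ∀ θ ∈ K,
      ∑ t ∈ Finset.Icc 1 n, q' t θ ω ≤ ∑ t ∈ Finset.Icc 1 n, q' t θ₀ ω - c * n := by
    refine hKc.induction_on (p := fun S => ∃ c > 0, ∀ᵐ ω ∂μ, ∀ᶠ n : ℕ in atTop, ∀ θ ∈ S,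
      ∑ t ∈ Finset.Icc 1 n, q' t θ ω ≤ ∑ t ∈ Finset.Icc 1 n, q' t θ₀ ω - c * n) ?_ ?_ ?_ ?_
    · exact ⟨1, one_pos, ae_of_all _ fun ω => Eventually.of_forall fun n θ hθ => hθ.elim⟩
    · rintro S T hST ⟨c, hc, h⟩
      exact ⟨c, hc, h.mono fun ω hω => hω.mono fun n hn θ hθ => hn θ (hST hθ)⟩
    · rintro S T ⟨c, hc, h⟩ ⟨c', hc', h'⟩
      refine ⟨min c c', lt_min hc hc', ?_⟩
      filter_upwards [h, h'] with ω h1 h2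
      filter_upwards [h1, h2] with n h3 h4 θ hθ
      rcases hθ with hθ | hθ
      · refine (h3 θ hθ).trans ?_
        gcongr
        exact min_le_left _ _
      · refine (h4 θ hθ).trans ?_
        gcongr
        exact min_le_right _ _
    · intro a ha
      have haΘ : a ∈ Θ := ha.1
      have hne : a ≠ θ₀ := by
        rintro rfl
        exact ha.2 (Metric.mem_ball_self hδ)
      set ℓ := ∫ ω, q 0 θ₀ ω ∂μ - ∫ ω, q 0 a ω ∂μ with hℓ
      have hℓ0 : 0 < ℓ := sub_pos.2 (hmax a haΘ hne)
      obtain ⟨r, hr, hball⟩ := exists_ball_ae_eventually_sum_abs_sub_le hX hq hcont hA2.1 haΘ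
        (η := ℓ / 8) (by positivity)
      refine ⟨K ∩ Metric.ball a r, inter_mem_nhdsWithin _ (Metric.ball_mem_nhds a hr), ℓ / 8,
        by positivity, ?_⟩
      filter_upwards [hball, (hq a haΘ).ae_tendsto_average hX (hint a haΘ),
        (hq θ₀ hθ₀).ae_tendsto_average hX (hint θ₀ hθ₀), hA2.2] with ω h1 h2 h3 h4
      have h5 := eventually_sum_le_of_tendsto_average_biSup
        (a := fun t θ => |q t θ ω - q' t θ ω|) (fun _ _ => abs_nonneg _) h4
        (η := ℓ / 8) (by positivity)
      filter_upwards [h1, h2.eventually_lt_const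
        (show ∫ ω, q 0 a ω ∂μ < ∫ ω, q 0 a ω ∂μ + ℓ / 8 by linarith),
        h3.eventually_const_lt
        (show ∫ ω, q 0 θ₀ ω ∂μ - ℓ / 8 < ∫ ω, q 0 θ₀ ω ∂μ by linarith), h5,
        eventually_gt_atTop 0] with n e1 e2 e3 e4 hn0 θ hθ
      have hn : (0 : ℝ) < n := by exact_mod_cast hn0
      rw [inv_mul_lt_iff₀ hn] at e2
      rw [lt_inv_mul_iff₀ hn] at e3
      have f1 := (abs_le.1 ((Finset.abs_sum_le_sum_abs _ _).trans
        (e1 θ ⟨hθ.1.1, hθ.2⟩))).2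
      have f2 := (abs_le.1 ((Finset.abs_sum_le_sum_abs _ _).trans (e4 θ hθ.1.1))).1
      have f3 := (abs_le.1 ((Finset.abs_sum_le_sum_abs _ _).trans (e4 θ₀ hθ₀))).2
      rw [Finset.sum_sub_distrib] at f1 f2 f3
      have e5 : (n : ℝ) * (∫ ω, q 0 a ω ∂μ + ℓ / 8) = n * ∫ ω, q 0 θ₀ ω ∂μ - 7 / 8 * (ℓ * n) := by
        rw [hℓ]
        ring
      have e6 : (n : ℝ) * (∫ ω, q 0 θ₀ ω ∂μ - ℓ / 8) = n * ∫ ω, q 0 θ₀ ω ∂μ - 1 / 8 * (ℓ * n) := by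
        ring
      have e7 : 0 < ℓ * n := by positivity
      linarith
  obtain ⟨c, hc, h⟩ := hmain
  refine ⟨c, hc, h.mono fun ω hω => hω.mono fun n hn θ hθ hle => hn θ ⟨hθ, ?_⟩⟩
  simpa [dist_eq_norm] using hle

/-- Local equicontinuity of the averaged Hessians of the `q_t` at `θ₀`, entry by entry. -/
theorem exists_ball_ae_eventually_sum_abs_hess_sub_le (hX : StationaryErgodic X μ) (hV : IsOpen V)
    (hθ₀ : θ₀ ∈ V) (hq : ∀ θ ∈ V, IsStationaryFunctional X μ fun t => q t θ)
    (hsm : ∀ᵐ ω ∂μ, ∀ t, ContDiffOn ℝ 2 (fun θ => q t θ ω) V) (hA6 : A6 μ θ₀ q)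
    (i j : Fin d) {η : ℝ} (hη : 0 < η) :
    ∃ r > 0, ∀ᵐ ω ∂μ, ∀ᶠ n : ℕ in atTop, ∀ θ ∈ Metric.ball θ₀ r,
      ∑ t ∈ Finset.Icc 1 n, |hess (fun θ => q t θ ω) θ i j - hess (fun θ => q t θ ω) θ₀ i j| ≤
        η * n := by
  obtain ⟨N₆, hN₆, h₆⟩ := hA6
  set S := V ∩ interior N₆ with hS
  have hSo : IsOpen S := hV.inter isOpen_interior
  have hSθ₀ : θ₀ ∈ S := ⟨hθ₀, mem_interior_iff_mem_nhds.2 hN₆⟩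
  have hstat : ∀ θ ∈ S, IsStationaryFunctional X μ fun t ω =>
      hess (fun θ => q t θ ω) θ i j := fun θ hθ => isStationaryFunctional_hess hV hq hsm i j hθ.1
  have hcont : ∀ᵐ ω ∂μ, ∀ t, ContinuousOn (fun θ => hess (fun θ => q t θ ω) θ i j) S :=
    hsm.mono fun ω h t => (continuousOn_hess_apply hV (h t) i j).mono Set.inter_subset_left
  have hbound : ∫⁻ ω, ⨆ θ ∈ S, ENNReal.ofReal |hess (fun θ => q 0 θ ω) θ i j| ∂μ < ∞ := by
    refine lt_of_le_of_lt (lintegral_mono fun ω => iSup₂_le fun θ hθ => ?_) h₆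
    exact (ENNReal.ofReal_le_ofReal (abs_apply_le_matL1 _ i j)).trans
      (le_biSup (fun θ => ENNReal.ofReal (matL1 (hess (fun θ => q 0 θ ω) θ)))
        (interior_subset hθ.2))
  obtain ⟨ρ, hρ, hball⟩ := exists_ball_ae_eventually_sum_abs_sub_le
    (Φ := fun t θ ω => hess (fun θ => q t θ ω) θ i j) hX hstat hcont hbound hSθ₀ hη
  obtain ⟨r, hr, hrS⟩ := Metric.isOpen_iff.1 hSo θ₀ hSθ₀
  refine ⟨min r ρ, lt_min hr hρ, hball.mono fun ω hω => hω.mono fun n hn θ hθ => hn θ ⟨?_, ?_⟩⟩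
  · exact hrS (Metric.ball_subset_ball (min_le_left _ _) hθ)
  · exact Metric.ball_subset_ball (min_le_right _ _) hθ

/-- Uniform law of large numbers near `θ₀` for an entry of the Hessian of the feasible objective
function. -/
theorem exists_ball_ae_eventually_abs_hess_apply_add_le (hX : StationaryErgodic X μ)
    (hV : IsOpen V) (hθ₀ : θ₀ ∈ V) (hq : ∀ θ ∈ V, IsStationaryFunctional X μ fun t => q t θ)
    (hsm : ∀ᵐ ω ∂μ, (∀ t, ContDiffOn ℝ 2 (fun θ => q t θ ω) V) ∧
      ∀ t, 1 ≤ t → ContDiffOn ℝ 2 (fun θ => q' t θ ω) V)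
    (hA5 : A5 μ θ₀ q q') (hA6 : A6 μ θ₀ q) (i j : Fin d)
    (hint : Integrable (fun ω => hess (fun θ => q 0 θ ω) θ₀ i j) μ) {η : ℝ} (hη : 0 < η) :
    ∃ r > 0, ∀ᵐ ω ∂μ, ∀ᶠ n : ℕ in atTop, ∀ θ ∈ Metric.ball θ₀ r,
      |hess (fun θ => ∑ t ∈ Finset.Icc 1 n, q' t θ ω) θ i j + n * matJ μ θ₀ q i j| ≤ η * n := by
  obtain ⟨N₅, hN₅, h₅⟩ := hA5
  have hsm1 : ∀ᵐ ω ∂μ, ∀ t, ContDiffOn ℝ 2 (fun θ => q t θ ω) V := hsm.mono fun ω h => h.1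
  obtain ⟨ρ, hρ, hball⟩ := exists_ball_ae_eventually_sum_abs_hess_sub_le hX hV hθ₀ hq hsm1 hA6 i j
    (η := η / 3) (by positivity)
  obtain ⟨r, hr, hrsub⟩ := Metric.mem_nhds_iff.1
    (inter_mem (inter_mem (hV.mem_nhds hθ₀) hN₅) (Metric.ball_mem_nhds θ₀ hρ))
  refine ⟨r, hr, ?_⟩
  have hlln := (isStationaryFunctional_hess hV hq hsm1 i j hθ₀).ae_tendsto_average hX hint
  filter_upwards [hsm, h₅, hlln, hball] with ω h1 h2 h3 h4
  have e1 := eventually_sum_le_of_tendsto_average_biSup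
    (a := fun t θ => matL1 (hess (fun θ => q t θ ω) θ - hess (fun θ => q' t θ ω) θ))
    (fun _ _ => Finset.sum_nonneg fun _ _ => Finset.sum_nonneg fun _ _ => abs_nonneg _) h2
    (η := η / 3) (by positivity)
  have e2 := Metric.tendsto_nhds.1 h3 (η / 3) (by positivity)
  filter_upwards [e1, e2, h4, eventually_gt_atTop 0] with n f1 f2 f3 hn0 θ hθ
  have hn : (0 : ℝ) < n := by exact_mod_cast hn0
  have hmem := hrsub hθ
  rw [hess_sum (Finset.Icc 1 n) hV (fun t ht => h1.2 t (Finset.mem_Icc.1 ht).1) hmem.1.1]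
  have g1 : |∑ t ∈ Finset.Icc 1 n, (hess (fun θ => q t θ ω) θ i j
      - hess (fun θ => q' t θ ω) θ i j)| ≤ η / 3 * n := by
    refine (Finset.abs_sum_le_sum_abs _ _).trans ((Finset.sum_le_sum fun t _ => ?_).trans
      (f1 θ hmem.1.2))
    exact abs_apply_le_matL1 (hess (fun θ => q t θ ω) θ - hess (fun θ => q' t θ ω) θ) i j
  have g2 : |∑ t ∈ Finset.Icc 1 n, (hess (fun θ => q t θ ω) θ i j
      - hess (fun θ => q t θ ω) θ₀ i j)| ≤ η / 3 * n :=
    (Finset.abs_sum_le_sum_abs _ _).trans (f3 θ hmem.2)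
  have g3 : |∑ t ∈ Finset.Icc 1 n, hess (fun θ => q t θ ω) θ₀ i j + n * matJ μ θ₀ q i j|
      ≤ η / 3 * n := by
    have g4 : ∑ t ∈ Finset.Icc 1 n, hess (fun θ => q t θ ω) θ₀ i j + n * matJ μ θ₀ q i j
        = n * ((n : ℝ)⁻¹ * ∑ t ∈ Finset.Icc 1 n, hess (fun θ => q t θ ω) θ₀ i j
          - ∫ ω, hess (fun θ => q 0 θ ω) θ₀ i j ∂μ) := by
      rw [mul_sub, mul_inv_cancel_left₀ hn.ne']
      simp [matJ, sub_eq_add_neg]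
    rw [g4, abs_mul, abs_of_pos hn, mul_comm]
    rw [Real.dist_eq] at f2
    exact mul_le_mul_of_nonneg_right f2.le hn.le
  rw [Finset.sum_sub_distrib] at g1 g2
  rw [abs_le] at g1 g2 g3 ⊢
  constructor <;> linarith

/-- Uniform law of large numbers for the Hessian of the feasible objective function near `θ₀`. -/
theorem exists_ball_ae_eventually_abs_hess_add_le (hX : StationaryErgodic X μ) (hV : IsOpen V)
    (hθ₀ : θ₀ ∈ V) (hq : ∀ θ ∈ V, IsStationaryFunctional X μ fun t => q t θ)
    (hsm : ∀ᵐ ω ∂μ, (∀ t, ContDiffOn ℝ 2 (fun θ => q t θ ω) V) ∧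
      ∀ t, 1 ≤ t → ContDiffOn ℝ 2 (fun θ => q' t θ ω) V)
    (hA5 : A5 μ θ₀ q q') (hA6 : A6 μ θ₀ q)
    (hint : ∀ i j, Integrable (fun ω => hess (fun θ => q 0 θ ω) θ₀ i j) μ)
    {η : ℝ} (hη : 0 < η) :
    ∃ r > 0, Metric.ball θ₀ r ⊆ V ∧ ∀ᵐ ω ∂μ, ∀ᶠ n : ℕ in atTop, ∀ θ ∈ Metric.ball θ₀ r, ∀ i j,
      |hess (fun θ => ∑ t ∈ Finset.Icc 1 n, q' t θ ω) θ i j + n * matJ μ θ₀ q i j| ≤ η * n := by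
  choose ρ hρ hball using fun i j =>
    exists_ball_ae_eventually_abs_hess_apply_add_le hX hV hθ₀ hq hsm hA5 hA6 i j (hint i j) hη
  have hmem : V ∩ ⋂ i, ⋂ j, Metric.ball θ₀ (ρ i j) ∈ 𝓝 θ₀ :=
    inter_mem (hV.mem_nhds hθ₀) (Filter.iInter_mem.2 fun i => Filter.iInter_mem.2 fun j =>
      Metric.ball_mem_nhds θ₀ (hρ i j))
  obtain ⟨r, hr, hrsub⟩ := Metric.mem_nhds_iff.1 hmem
  refine ⟨r, hr, fun θ hθ => (hrsub hθ).1, ?_⟩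
  have hall := ae_all_iff.2 fun i => ae_all_iff.2 fun j => hball i j
  filter_upwards [hall] with ω hω
  have hω' := eventually_all.2 fun i => eventually_all.2 fun j => hω i j
  filter_upwards [hω'] with n hn θ hθ i j
  exact hn i j θ (Set.mem_iInter.1 (Set.mem_iInter.1 (hrsub hθ).2 i) j)

theorem exists_pos_mul_norm_sq_le_inner_toEuclideanCLM {d : ℕ} {J : Matrix (Fin d) (Fin d) ℝ}
    (hJ : J.PosDef) :
    ∃ c > 0, ∀ v, c * ‖v‖ ^ 2 ≤ inner ℝ v (Matrix.toEuclideanCLM (𝕜 := ℝ) J v) := by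
  have hinner : ∀ v, inner ℝ v (Matrix.toEuclideanCLM (𝕜 := ℝ) J v)
      = dotProduct v.ofLp (J.mulVec v.ofLp) := fun v => by
    rw [PiLp.inner_apply, Matrix.ofLp_toEuclideanCLM, dotProduct]
    exact Finset.sum_congr rfl fun i _ => by simp [mul_comm]
  have hpos : ∀ v : EuclideanSpace ℝ (Fin d), v ≠ 0 →
      0 < inner ℝ v (Matrix.toEuclideanCLM (𝕜 := ℝ) J v) := fun v hv => by
    rw [hinner]
    have := hJ.dotProduct_mulVec_pos (x := v.ofLp) (by simpa using hv)
    simpa using this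
  obtain hd | hd := (Metric.sphere (0 : EuclideanSpace ℝ (Fin d)) 1).eq_empty_or_nonempty
  · refine ⟨1, one_pos, fun v => ?_⟩
    have hv : v = 0 := by
      by_contra h
      have : ‖v‖⁻¹ • v ∈ Metric.sphere (0 : EuclideanSpace ℝ (Fin d)) 1 := by
        simp [norm_smul, h]
      simp [hd] at this
    simp [hv]
  · obtain ⟨u, hu, hmin⟩ := (isCompact_sphere (0 : EuclideanSpace ℝ (Fin d)) 1).exists_isMinOn hd
      (f := fun v => inner ℝ v (Matrix.toEuclideanCLM (𝕜 := ℝ) J v)) (by fun_prop)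
    refine ⟨_, hpos u ?_, fun v => ?_⟩
    · rintro rfl
      simp at hu
    · obtain rfl | hv := eq_or_ne v 0
      · simp
      have hn : 0 < ‖v‖ := norm_pos_iff.2 hv
      have h1 : ‖v‖⁻¹ • v ∈ Metric.sphere (0 : EuclideanSpace ℝ (Fin d)) 1 := by
        simp [norm_smul, hn.ne']
      have h2 := isMinOn_iff.1 hmin _ h1
      simp only [map_smul, inner_smul_left, inner_smul_right] at h2
      have h3 := mul_le_mul_of_nonneg_right h2 (sq_nonneg ‖v‖)
      refine h3.trans_eq ?_
      simp
      field_simp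

/-- Almost surely the feasible objective function satisfies the hypotheses of Laplace's method at
the true parameter, with `J` the matrix `matJ`. -/
theorem ae_quadraticPeak (hX : StationaryErgodic X μ)
    {Θ : Set (EuclideanSpace ℝ (Fin d))} (hΘ : IsCompact Θ) (hθ₀ : θ₀ ∈ interior Θ)
    (hq : ∀ θ ∈ Θ, IsStationaryFunctional X μ fun t => q t θ)
    (hmax : ∀ θ ∈ Θ, θ ≠ θ₀ → ∫ ω, q 0 θ ω ∂μ < ∫ ω, q 0 θ₀ ω ∂μ)
    (hsmooth : Smooth μ θ₀ q q') (hA1 : A1 μ Θ q) (hA2 : A2 μ Θ q q') (hA5 : A5 μ θ₀ q q')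
    (hA6 : A6 μ θ₀ q) (hA7 : A7 μ θ₀ q) :
    ∀ᵐ ω ∂μ, QuadraticPeak Θ θ₀ (Matrix.toEuclideanCLM (𝕜 := ℝ) (matJ μ θ₀ q))
      (fun n θ => ∑ t ∈ Finset.Icc 1 n, q' t θ ω)
      (fun n θ => grad (fun θ => ∑ t ∈ Finset.Icc 1 n, q' t θ ω) θ) := by
  obtain ⟨U, hU, hθ₀U, hsm⟩ := hsmooth
  set V := interior Θ ∩ U with hVdef
  have hV : IsOpen V := isOpen_interior.inter hU
  have hθ₀V : θ₀ ∈ V := ⟨hθ₀, hθ₀U⟩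
  have hsmV : ∀ᵐ ω ∂μ, (∀ t, ContDiffOn ℝ 2 (fun θ => q t θ ω) V) ∧
      ∀ t, 1 ≤ t → ContDiffOn ℝ 2 (fun θ => q' t θ ω) V := hsm.mono fun ω h =>
    ⟨fun t => (h.1 t).mono Set.inter_subset_right,
      fun t ht => (h.2 t ht).mono Set.inter_subset_right⟩
  have hqV : ∀ θ ∈ V, IsStationaryFunctional X μ fun t => q t θ := fun θ hθ =>
    hq θ (interior_subset hθ.1)
  -- countably many `δ` and `η`, so that the exceptional null set does not depend on them
  have hsep := fun k : ℕ => exists_ae_eventually_sum_le_sub hX hΘ (interior_subset hθ₀) hq hA1.1 hA2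
    hmax (δ := 1 / ((k : ℝ) + 1)) (by positivity)
  have hhess := fun k : ℕ => exists_ball_ae_eventually_abs_hess_add_le hX hV hθ₀V hqV hsmV hA5 hA6
    hA7.1 (η := 1 / ((k : ℝ) + 1)) (by positivity)
  choose c hc hcs using hsep
  choose r hr hrV hrs using hhess
  set J := matJ μ θ₀ q with hJ
  have hJpos : J.PosDef := hA7.2.2
  have hJsymm : ∀ i j, J i j = J j i := fun i j => by
    simpa using (hJpos.isHermitian.apply i j).symm
  filter_upwards [hsmV, ae_all_iff.2 hcs, ae_all_iff.2 hrs] with ω h1 h2 h3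
  refine ⟨fun u v => ?_, ?_, fun δ hδ => ?_, fun η hη => ?_⟩
  · have hsa : IsSelfAdjoint (Matrix.toEuclideanCLM (𝕜 := ℝ) J) :=
      IsSelfAdjoint.map (f := Matrix.toEuclideanCLM (𝕜 := ℝ) (n := Fin d)) hJpos.isHermitian
    exact (ContinuousLinearMap.isSelfAdjoint_iff_isSymmetric.1 hsa) u v
  · exact exists_pos_mul_norm_sq_le_inner_toEuclideanCLM hJpos
  · obtain ⟨k, hk⟩ := exists_nat_one_div_lt hδ
    exact ⟨c k, hc k, (h2 k).mono fun n hn θ hθ hle => hn θ hθ (hk.le.trans hle)⟩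
  · obtain ⟨k, hk⟩ := exists_nat_one_div_lt (show 0 < η / ((d : ℝ) ^ 2 + 1) by positivity)
    refine ⟨r k, hr k, ?_⟩
    filter_upwards [h3 k] with n hn θ hθ
    have hC : ContDiffOn ℝ 2 (fun θ => ∑ t ∈ Finset.Icc 1 n, q' t θ ω) (Metric.ball θ₀ (r k)) :=
      ContDiffOn.sum fun t ht => (h1.2 t (Finset.mem_Icc.1 ht).1).mono (hrV k)
    refine ⟨?_, fun θ' hθ' => ?_⟩
    · rw [innerSL_grad]
      exact (differentiableAt_of_contDiffOn_two Metric.isOpen_ball hC hθ).hasFDerivAt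
    · have := norm_grad_sub_grad_add_le Metric.isOpen_ball (convex_ball _ _) hC
        (A := (n : ℝ) • J) (fun i j => by simp [hJsymm i j]) (K := 1 / ((k : ℝ) + 1) * n)
        (fun x hx i j => hn x hx i j) hθ hθ'
      rw [map_smul, smul_apply] at this
      refine this.trans ?_
      have h5 : (d : ℝ) ^ 2 * (1 / ((k : ℝ) + 1)) ≤ η := by
        rw [lt_div_iff₀ (by positivity)] at hk
        have : 0 ≤ 1 / ((k : ℝ) + 1) := by positivity
        linarith
      rw [← mul_assoc]
      gcongr

end Peak

/-! ### Asymptotic normality of the score -/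

section Score

variable {d : ℕ} {Ω : Type*} [MeasurableSpace Ω] {μ : Measure Ω} [IsProbabilityMeasure μ]

theorem tendstoInDistribution_multivariateGaussian_zero {Y : ℕ → Ω → EuclideanSpace ℝ (Fin d)}
    (hY : ∀ n, AEMeasurable (Y n) μ) {S : Matrix (Fin d) (Fin d) ℝ} (hS : S.PosSemidef)
    (h : ∀ v : EuclideanSpace ℝ (Fin d),
      Tendsto (fun n => ∫ ω, Complex.exp ((inner ℝ (Y n ω) v : ℝ) * Complex.I) ∂μ) atTop
        (𝓝 (Real.exp (-(dotProduct v.ofLp (S.mulVec v.ofLp)) / 2)))) :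
    TendstoInDistribution Y atTop id (fun _ => μ) (multivariateGaussian 0 S) where
  forall_aemeasurable := hY
  tendsto := by
    refine ProbabilityMeasure.tendsto_iff_tendsto_charFun.2 fun v => ?_
    have h1 : ∀ n, charFun (μ.map (Y n)) v
        = ∫ ω, Complex.exp ((inner ℝ (Y n ω) v : ℝ) * Complex.I) ∂μ := fun n => by
      rw [charFun_apply, integral_map (hY n) (by fun_prop)]
    have h2 : charFun ((multivariateGaussian 0 S).map id) v
        = (Real.exp (-(dotProduct v.ofLp (S.mulVec v.ofLp)) / 2) : ℂ) := by
      rw [Measure.map_id, charFun_multivariateGaussian hS]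
      push_cast
      simp [neg_div]
    have := h v
    simp only [ProbabilityMeasure.coe_mk]
    rw [h2]
    simp_rw [h1]
    exact this

/-- A form of Slutsky's theorem: a perturbation that is almost surely of smaller order than
`1 + ‖y n‖` does not affect convergence in distribution of `y n`. -/
theorem tendstoInDistribution_id_of_ae_norm_sub_le {x y : ℕ → Ω → EuclideanSpace ℝ (Fin d)}
    {ν : Measure (EuclideanSpace ℝ (Fin d))} [IsProbabilityMeasure ν]
    (hy : TendstoInDistribution y atTop id (fun _ => μ) ν) (hx : ∀ n, AEMeasurable (x n) μ)
    (h : ∀ᵐ ω ∂μ, ∀ η > 0, ∀ᶠ n in atTop, ‖x n ω - y n ω‖ ≤ η * (1 + ‖y n ω‖)) :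
    TendstoInDistribution x atTop id (fun _ => μ) ν := by
  have hym := hy.forall_aemeasurable
  set u : ℕ → Ω → EuclideanSpace ℝ (Fin d) := fun n ω =>
    (1 + ‖y n ω‖)⁻¹ • (x n ω - y n ω) with hu
  have hum : ∀ n, AEMeasurable (u n) μ := fun n =>
    ((hym n).norm.const_add 1).inv.smul ((hx n).sub (hym n))
  have hu0 : TendstoInMeasure μ u atTop fun _ => 0 := by
    refine tendstoInMeasure_of_tendsto_ae (fun n => (hum n).aestronglyMeasurable) ?_
    filter_upwards [h] with ω hω
    refine Metric.tendsto_nhds.2 fun η hη => ?_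
    filter_upwards [hω (η / 2) (by positivity)] with n hn
    have hpos : 0 < 1 + ‖y n ω‖ := by positivity
    rw [dist_zero_right, hu, norm_smul, norm_inv, Real.norm_of_nonneg hpos.le,
      inv_mul_lt_iff₀ hpos]
    nlinarith
  have key := hy.continuous_comp_prodMk_of_tendstoInMeasure_const
    (g := fun p : EuclideanSpace ℝ (Fin d) × EuclideanSpace ℝ (Fin d) => p.1 + (1 + ‖p.1‖) • p.2)
    (by fun_prop) hu0 hum
  have hxu : ∀ n ω, y n ω + (1 + ‖y n ω‖) • u n ω = x n ω := fun n ω => by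
    have hpos : 0 < 1 + ‖y n ω‖ := by positivity
    rw [hu, smul_inv_smul₀ hpos.ne', add_sub_cancel]
  simpa only [hxu, smul_zero, add_zero] using key

variable {X : ℤ → Ω → ℝ} {Z : ℤ → Ω → EuclideanSpace ℝ (Fin d)}

theorem tendsto_integral_exp_inner_sum_martingaleDifference (hX : StationaryErgodic X μ)
    (hXm : ∀ t, Measurable (X t))
    (hmd : MartingaleDifference Z (history X) μ) {v : EuclideanSpace ℝ (Fin d)}
    (hZ : IsStationaryFunctional X μ fun t ω => inner ℝ (Z t ω) v)
    (hint : Integrable (fun ω => inner ℝ (Z 0 ω) v ^ 2) μ) :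
    Tendsto (fun n : ℕ => ∫ ω, Complex.exp
      ((inner ℝ ((√(n : ℝ))⁻¹ • ∑ t ∈ Finset.Icc 1 n, Z t ω) v : ℝ) * Complex.I) ∂μ) atTop
      (𝓝 (Real.exp (-(∫ ω, inner ℝ (Z 0 ω) v ^ 2 ∂μ) / 2))) := by
  set 𝒢 : Filtration ℕ (inferInstance : MeasurableSpace Ω) :=
    { seq := fun k => history X k
      mono' := fun k l hkl => iSup_le fun s => le_iSup_of_le
        (⟨s, (Set.mem_Iic.1 s.2).trans (Nat.cast_le.2 hkl)⟩ : Set.Iic (l : ℤ)) le_rfl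
      le' := fun k => iSup_le fun s => (hXm s).comap_le } with h𝒢
  have hsq : IsStationaryFunctional X μ fun t ω => inner ℝ (Z t ω) v ^ 2 :=
    hZ.comp (h := fun x : ℝ => x ^ 2) (by fun_prop)
  have hcont : Continuous fun z : EuclideanSpace ℝ (Fin d) => (inner ℝ z v : ℝ) := by fun_prop
  have hshift : ∀ (n : ℕ) (a : ℤ → ℝ),
      ∑ k ∈ Finset.range n, a ((k + 1 : ℕ) : ℤ) = ∑ t ∈ Finset.Icc 1 n, a t := fun n a => by
    rw [Finset.range_eq_Ico, Finset.sum_Ico_add' (fun k : ℕ => a k) 0 n 1]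
    rfl
  have key := tendsto_integral_exp_sum_martingaleDifference (μ := μ) (𝒢 := 𝒢)
    (Y := fun k ω => inner ℝ (Z ((k + 1 : ℕ) : ℤ) ω) v)
    (K := ∫ ω, inner ℝ (Z 0 ω) v ^ 2 ∂μ) (v := ∫ ω, inner ℝ (Z 0 ω) v ^ 2 ∂μ)
    (fun k => hcont.comp_aestronglyMeasurable (hmd ((k + 1 : ℕ) : ℤ)).1)
    (fun k => (hmd ((k + 1 : ℕ) : ℤ)).2.1.inner_const v)
    (fun k => (hsq.identDistrib hX ((k + 1 : ℕ) : ℤ)).integrable_iff.2 hint)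
    (fun k => (hsq.identDistrib hX ((k + 1 : ℕ) : ℤ)).integral_eq.le)
    (fun k => ?_) ?_
  · refine key.congr fun n => integral_congr_ae (ae_of_all _ fun ω => ?_)
    simp only
    rw [← Finset.mul_sum, hshift n fun t => inner ℝ (Z t ω) v, real_inner_smul_left, sum_inner]
  · have h1 := (hmd ((k + 1 : ℕ) : ℤ)).2.2
    have h2 : ((k + 1 : ℕ) : ℤ) - 1 = k := by push_cast; ring
    rw [h2] at h1
    have h3 := (innerSL ℝ v).comp_condExp_comm (m := 𝒢 k) (hmd ((k + 1 : ℕ) : ℤ)).2.1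
    have h4 : (innerSL ℝ v) ∘ Z ((k + 1 : ℕ) : ℤ)
        = fun ω => inner ℝ (Z ((k + 1 : ℕ) : ℤ) ω) v := by
      funext ω
      simp [real_inner_comm]
    rw [h4] at h3
    filter_upwards [h1, h3] with ω e1 e3
    rw [← e3]
    change innerSL ℝ v ((μ[Z ((k + 1 : ℕ) : ℤ) | history X k]) ω) = 0
    rw [e1]
    simp
  · filter_upwards [hsq.ae_tendsto_average hX hint] with ω hω
    refine hω.congr fun n => ?_
    rw [hshift n fun t => inner ℝ (Z t ω) v ^ 2]

/-- The central limit theorem for stationary ergodic martingale differences, in the sandwich form in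
which it applies to the score. -/
theorem tendstoInDistribution_inv_apply_sum_martingaleDifference (hX : StationaryErgodic X μ)
    (hXm : ∀ t, Measurable (X t)) (hmd : MartingaleDifference Z (history X) μ)
    (hZ : ∀ v, IsStationaryFunctional X μ fun t ω => inner ℝ (Z t ω) v)
    (hint : ∀ i j, Integrable (fun ω => Z 0 ω i * Z 0 ω j) μ) {J : Matrix (Fin d) (Fin d) ℝ}
    (hJ : J.PosDef) :
    TendstoInDistribution (fun (n : ℕ) ω => Matrix.toEuclideanCLM (𝕜 := ℝ) J⁻¹
        ((√(n : ℝ))⁻¹ • ∑ t ∈ Finset.Icc 1 n, Z t ω)) atTop id (fun _ => μ)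
      (multivariateGaussian 0
        (J⁻¹ * (Matrix.of fun i j => ∫ ω, Z 0 ω i * Z 0 ω j ∂μ) * J⁻¹)) := by
  set S : Matrix (Fin d) (Fin d) ℝ := Matrix.of fun i j => ∫ ω, Z 0 ω i * Z 0 ω j ∂μ with hS
  have hexp : ∀ (v : EuclideanSpace ℝ (Fin d)) ω, inner ℝ (Z 0 ω) v ^ 2
      = ∑ i, ∑ j, v i * v j * (Z 0 ω i * Z 0 ω j) := fun v ω => by
    rw [PiLp.inner_apply, sq, Finset.sum_mul_sum]
    refine Finset.sum_congr rfl fun i _ => Finset.sum_congr rfl fun j _ => ?_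
    simp
    ring
  have hint2 : ∀ v, Integrable (fun ω => inner ℝ (Z 0 ω) v ^ 2) μ := fun v => by
    simp_rw [hexp v]
    exact integrable_finsetSum _ fun i _ => integrable_finsetSum _ fun j _ =>
      (hint i j).const_mul _
  have hvar : ∀ v : EuclideanSpace ℝ (Fin d),
      ∫ ω, inner ℝ (Z 0 ω) v ^ 2 ∂μ = dotProduct v.ofLp (S.mulVec v.ofLp) := fun v => by
    simp_rw [hexp v]
    rw [integral_finsetSum _ fun i _ => integrable_finsetSum _ fun j _ => (hint i j).const_mul _]
    refine Finset.sum_congr rfl fun i _ => ?_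
    rw [integral_finsetSum _ fun j _ => (hint i j).const_mul _, Matrix.mulVec, dotProduct,
      Finset.mul_sum]
    refine Finset.sum_congr rfl fun j _ => ?_
    rw [integral_const_mul]
    simp only [hS, Matrix.of_apply]
    ring
  have hSpsd : S.PosSemidef := by
    refine Matrix.PosSemidef.of_dotProduct_mulVec_nonneg ?_ fun x => ?_
    · ext i j
      simp [hS, mul_comm]
    · have := hvar (WithLp.toLp 2 x)
      simp only [star_trivial]
      rw [← this]
      exact integral_nonneg fun ω => sq_nonneg _
  have hJi : (J⁻¹).IsHermitian := hJ.isHermitian.inv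
  have hJt : (J⁻¹).transpose = J⁻¹ := hJi
  have hpsd : (J⁻¹ * S * J⁻¹).PosSemidef := by
    have := hSpsd.mul_mul_conjTranspose_same J⁻¹
    rwa [hJi.eq] at this
  have hZm : ∀ t, AEMeasurable (Z t) μ := fun t => (hmd t).2.1.aestronglyMeasurable.aemeasurable
  refine tendstoInDistribution_multivariateGaussian_zero (fun n => ?_) hpsd fun v => ?_
  · have : AEMeasurable (fun ω => (√(n : ℝ))⁻¹ • ∑ t ∈ Finset.Icc 1 n, Z t ω) μ :=
      (measurable_const_smul (√(n : ℝ))⁻¹).comp_aemeasurable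
        (Finset.aemeasurable_fun_sum (Finset.Icc 1 n) fun t _ => hZm t)
    exact (ContinuousLinearMap.measurable _).comp_aemeasurable this
  · have hsymm : ∀ u, inner ℝ (Matrix.toEuclideanCLM (𝕜 := ℝ) J⁻¹ u) v
        = inner ℝ u (Matrix.toEuclideanCLM (𝕜 := ℝ) J⁻¹ v) := fun u => by
      have hsa : IsSelfAdjoint (Matrix.toEuclideanCLM (𝕜 := ℝ) J⁻¹) :=
        IsSelfAdjoint.map (f := Matrix.toEuclideanCLM (𝕜 := ℝ) (n := Fin d)) hJi
      exact (ContinuousLinearMap.isSelfAdjoint_iff_isSymmetric.1 hsa) u v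
    have key := tendsto_integral_exp_inner_sum_martingaleDifference hX hXm hmd
      (hZ (Matrix.toEuclideanCLM (𝕜 := ℝ) J⁻¹ v)) (hint2 _)
    rw [hvar, Matrix.ofLp_toEuclideanCLM] at key
    have hquad : dotProduct v.ofLp ((J⁻¹ * S * J⁻¹).mulVec v.ofLp)
        = dotProduct (J⁻¹.mulVec v.ofLp) (S.mulVec (J⁻¹.mulVec v.ofLp)) := by
      rw [← Matrix.mulVec_mulVec, ← Matrix.mulVec_mulVec, Matrix.dotProduct_mulVec,
        ← Matrix.mulVec_transpose, hJt]
    rw [hquad]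
    simpa only [hsymm] using key

end Score

section Linearization

variable {E : Type*} [NormedAddCommGroup E] [InnerProductSpace ℝ E]

/-- The maximizer, and any estimator within `o(1 / √n)` of it, is asymptotically the image of the
score under the inverse `K` of `J`. The error is relative to the size of that image, so that no
bound on the score is needed. -/
theorem QuadraticPeak.eventually_norm_sqrt_smul_sub_le {Θ : Set E} {θ₀ : E} {J : E →L[ℝ] E}
    {Q : ℕ → E → ℝ} {G : ℕ → E → E} {m : ℕ → E} (h : QuadraticPeak Θ θ₀ J Q G)
    (hθ₀ : θ₀ ∈ interior Θ) (hm : ∀ n, m n ∈ Θ ∧ IsMaxOn (Q n) Θ (m n)) {p S : ℕ → E}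
    (hp : Tendsto (fun n : ℕ => √(n : ℝ) • (p n - m n)) atTop (𝓝 0))
    (hS : Tendsto (fun n : ℕ => (√(n : ℝ))⁻¹ • (S n - G n θ₀)) atTop (𝓝 0))
    {K : E →L[ℝ] E} (hK : ∀ v, K (J v) = v) {η : ℝ} (hη : 0 < η) :
    ∀ᶠ n : ℕ in atTop, ‖√(n : ℝ) • (p n - θ₀) - K ((√(n : ℝ))⁻¹ • S n)‖ ≤
      η * (1 + ‖K ((√(n : ℝ))⁻¹ • S n)‖) := by
  set b := min (1 / 2) (η / 4) with hb
  have hb0 : 0 < b := by positivity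
  have hb1 : b ≤ 1 / 2 := min_le_left _ _
  have hb2 : b ≤ η / 4 := min_le_right _ _
  set ζ := b / (‖K‖ + 1) with hζ
  have hζ0 : 0 < ζ := by positivity
  have hKζ : ‖K‖ * ζ ≤ b := by
    rw [hζ, mul_div_assoc', div_le_iff₀ (by positivity)]
    nlinarith [norm_nonneg K]
  filter_upwards [h.eventually_norm_gradient_sub_le hθ₀ hm hζ0, eventually_gt_atTop 0,
    Metric.tendsto_nhds.1 hp (η / 2) (by positivity), Metric.tendsto_nhds.1 hS ζ hζ0]
    with n h1 hn0 h2 h3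
  rw [dist_zero_right] at h2 h3
  have hn : (0 : ℝ) < n := by exact_mod_cast hn0
  have hsq : 0 < √(n : ℝ) := Real.sqrt_pos.2 hn
  have hss : √(n : ℝ) * √(n : ℝ) = n := Real.mul_self_sqrt hn.le
  set x := √(n : ℝ) • (m n - θ₀) with hx
  set y := K ((√(n : ℝ))⁻¹ • S n) with hy
  have e1 : ‖(√(n : ℝ))⁻¹ • (G n θ₀ - (n : ℝ) • J (m n - θ₀))‖ ≤ ζ * ‖x‖ := by
    rw [norm_smul, hx, norm_smul, norm_inv, Real.norm_of_nonneg hsq.le, inv_mul_le_iff₀ hsq]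
    refine h1.trans_eq ?_
    linear_combination -(ζ * ‖m n - θ₀‖) * hss
  have e2 : (√(n : ℝ))⁻¹ • S n - J x = (√(n : ℝ))⁻¹ • (S n - G n θ₀)
      + (√(n : ℝ))⁻¹ • (G n θ₀ - (n : ℝ) • J (m n - θ₀)) := by
    have : (√(n : ℝ))⁻¹ • (n : ℝ) • J (m n - θ₀) = J x := by
      rw [hx, map_smul, smul_smul]
      congr 1
      rw [inv_mul_eq_iff_eq_mul₀ hsq.ne', hss]
    rw [smul_sub, smul_sub, this]
    abel
  have e3 : ‖y - x‖ ≤ b * (1 + ‖x‖) := by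
    have : y - x = K ((√(n : ℝ))⁻¹ • S n - J x) := by rw [map_sub, hK]
    rw [this]
    calc _ ≤ ‖K‖ * ‖(√(n : ℝ))⁻¹ • S n - J x‖ := K.le_opNorm _
      _ ≤ ‖K‖ * (ζ * (1 + ‖x‖)) := by
        gcongr
        rw [e2]
        refine (norm_add_le _ _).trans ?_
        linarith
      _ = ‖K‖ * ζ * (1 + ‖x‖) := by ring
      _ ≤ _ := by gcongr
  have e4 : ‖x‖ ≤ ‖y‖ + ‖y - x‖ := by
    have := norm_sub_norm_le x y
    rw [norm_sub_rev] at this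
    linarith
  have e5 : √(n : ℝ) • (p n - θ₀) - y = √(n : ℝ) • (p n - m n) - (y - x) := by
    rw [hx, smul_sub, smul_sub, smul_sub]
    abel
  rw [e5]
  refine (norm_sub_le _ _).trans ?_
  have e6 : ‖y - x‖ ≤ 2 * b * (1 + ‖y‖) := by
    nlinarith [norm_nonneg (y - x), norm_nonneg y, norm_nonneg x]
  nlinarith [norm_nonneg y]

end Linearization

/-! ### Measurability of the posterior mean and conclusion -/

section Measurability

variable {d : ℕ} {Ω : Type*} [MeasurableSpace Ω] {f : ℝ → ℝ} {γ : ℝ}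
  {σ' : ℕ → EuclideanSpace ℝ (Fin d) → Ω → ℝ} {X : ℤ → Ω → ℝ}

theorem measurable_uncurry_QProxy (hf : Measurable f) (γ : ℝ)
    (hσ' : ∀ t, Measurable (Function.uncurry (σ' t))) (hX : ∀ t, Measurable (X t)) (n : ℕ) :
    Measurable (Function.uncurry (QProxy f γ σ' X n)) := by
  have h : ∀ t : ℕ, Measurable fun p : EuclideanSpace ℝ (Fin d) × Ω =>
      dpdTerm f γ (σ' t p.1 p.2) (X t p.2) := fun t =>
    (measurable_dpdTerm hf γ).comp ((hσ' t).prodMk ((hX t).comp measurable_snd))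
  exact Finset.measurable_fun_sum (Finset.Icc 1 n) fun t _ => h t

theorem measurable_EDPE (hQ : ∀ n, Measurable (Function.uncurry (QProxy f γ σ' X n)))
    {Θ : Set (EuclideanSpace ℝ (Fin d))} {prior : EuclideanSpace ℝ (Fin d) → ℝ}
    (hprior : Measurable prior) (n : ℕ) : Measurable (EDPE f γ σ' X Θ prior n) := by
  have hw : Measurable fun p : Ω × EuclideanSpace ℝ (Fin d) =>
      Real.exp (QProxy f γ σ' X n p.2 p.1) * prior p.2 :=
    ((hQ n).comp measurable_swap).exp.mul (hprior.comp measurable_snd)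
  have hden : Measurable fun ω => ∫ θ in Θ, Real.exp (QProxy f γ σ' X n θ ω) * prior θ :=
    hw.stronglyMeasurable.integral_prod_right'.measurable
  have hpost : Measurable fun p : Ω × EuclideanSpace ℝ (Fin d) =>
      posterior f γ σ' X Θ prior n p.1 p.2 • p.2 :=
    (hw.div (hden.comp measurable_fst)).smul measurable_snd
  exact hpost.stronglyMeasurable.integral_prod_right'.measurable

end Measurability

theorem theorem3 {d : ℕ} {Ω : Type*} [MeasurableSpace Ω] (μ : Measure Ω) [IsProbabilityMeasure μ]
    -- the model
    (f : ℝ → ℝ) (Θ : Set (EuclideanSpace ℝ (Fin d))) (θ₀ : EuclideanSpace ℝ (Fin d))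
    (s : EuclideanSpace ℝ (Fin d) → (ℕ → ℝ) → ℝ) (ε X : ℤ → Ω → ℝ)
    (hmodel : HeteroscedasticModel μ f Θ θ₀ s ε X)
    (hΘ : IsCompact Θ) (hθ₀ : θ₀ ∈ interior Θ)
    -- the proxy of the conditional standard deviation
    (σ' : ℕ → EuclideanSpace ℝ (Fin d) → Ω → ℝ)
    (hσ'_meas : ∀ t, Measurable (Function.uncurry (σ' t)))
    (hσ'_pos : ∀ᵐ ω ∂μ, ∀ t, 1 ≤ t → ∀ θ ∈ Θ, 0 < σ' t θ ω)
    -- the tuning parameter; the objective functions are finite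
    (γ : ℝ) (hγ : 0 ≤ γ)
    (hf_int : Integrable (fun x => f x ^ (1 + γ)))
    (hlog : γ = 0 → ∀ᵐ ω ∂μ, (∀ t, ∀ θ ∈ Θ, 0 < f (X t ω / sigma s X t θ ω)) ∧
      ∀ t : ℕ, 1 ≤ t → ∀ θ ∈ Θ, 0 < f (X t ω / σ' t θ ω))
    -- the regularity conditions
    (hsmooth : Smooth μ θ₀ (q f γ s X) (qProxy f γ σ' X))
    (hA1 : A1 μ Θ (q f γ s X))
    (hA2 : A2 μ Θ (q f γ s X) (qProxy f γ σ' X))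
    (hA5 : A5 μ θ₀ (q f γ s X) (qProxy f γ σ' X))
    (hA6 : A6 μ θ₀ (q f γ s X))
    (hA7 : A7 μ θ₀ (q f γ s X))
    -- the prior
    (prior : EuclideanSpace ℝ (Fin d) → ℝ) (hprior : IsPriorDensity Θ prior)
    (hprior_pos : 0 < prior θ₀) (hprior_cont : ContinuousAt prior θ₀)
    (hprior_moment : IntegrableOn (fun θ => vecL1 θ * prior θ) Θ)
    -- the minimum density power divergence estimator
    (est : ℕ → Ω → EuclideanSpace ℝ (Fin d)) (hest : IsMDPDE μ f γ σ' X Θ est) :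
    (∀ᵐ ω ∂μ, Tendsto (fun n : ℕ => √(n : ℝ) • (EDPE f γ σ' X Θ prior n ω - est n ω))
        atTop (𝓝 0)) ∧
      (A3 μ X θ₀ (q f γ s X) →
        A4 μ θ₀ (q f γ s X) (qProxy f γ σ' X) →
        TendstoInDistribution
          (fun (n : ℕ) ω => √(n : ℝ) • (EDPE f γ σ' X Θ prior n ω - θ₀)) atTop id (fun _ => μ)
          (multivariateGaussian 0
            ((matJ μ θ₀ (q f γ s X))⁻¹ * matI μ θ₀ (q f γ s X) *
              (matJ μ θ₀ (q f γ s X))⁻¹))) := by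
  have hθ₀Θ : θ₀ ∈ Θ := interior_subset hθ₀
  have hf := hmodel.density_measurable
  have hX := hmodel.stationary_ergodic
  have hqstat : ∀ θ ∈ Θ, IsStationaryFunctional X μ fun t => q f γ s X t θ := fun θ hθ =>
    isStationaryFunctional_q hf γ (hmodel.scale_measurable θ hθ)
  have hqint : ∀ θ ∈ Θ, Integrable (q f γ s X 0 θ) μ := fun θ hθ =>
    integrable_of_lintegral_biSup_lt_top hA2.1 hθ ((hqstat θ hθ).aemeasurable hX 0)
  have hmax : ∀ θ ∈ Θ, θ ≠ θ₀ →
      ∫ ω, q f γ s X 0 θ ω ∂μ < ∫ ω, q f γ s X 0 θ₀ ω ∂μ := fun θ hθ hne =>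
    integral_q_lt hmodel hθ₀Θ hγ hf_int (fun h => (hlog h).mono fun ω hω => hω.1) hθ hne
      (hqint θ hθ) (hqint θ₀ hθ₀Θ)
  have hpeak := ae_quadraticPeak hX hΘ hθ₀ hqstat hmax hsmooth hA1 hA2 hA5 hA6 hA7
  have hargmax : ∀ᵐ ω ∂μ, ∀ n, est n ω ∈ Θ ∧
      IsMaxOn (fun θ => QProxy f γ σ' X n θ ω) Θ (est n ω) := ae_all_iff.2 fun n => (hest n).2
  have hQmeas := measurable_uncurry_QProxy hf γ hσ'_meas hmodel.observation_measurable
  have hfirst : ∀ᵐ ω ∂μ, Tendsto (fun n : ℕ => √(n : ℝ) • (EDPE f γ σ' X Θ prior n ω - est n ω))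
      atTop (𝓝 0) := by
    filter_upwards [hpeak, hargmax] with ω h1 h2
    exact h1.tendsto_sqrt_smul_posteriorMean_sub hΘ hθ₀
      (fun n => (hQmeas n).comp measurable_prodMk_right) h2 hprior.measurable hprior.nonneg
      hprior.integrable hprior_cont hprior_pos
  refine ⟨hfirst, fun hA3 hA4 => ?_⟩
  obtain ⟨U, hU, hθ₀U, hsm⟩ := hsmooth
  have hV : IsOpen (interior Θ ∩ U) := isOpen_interior.inter hU
  have hscore : ∀ v, IsStationaryFunctional X μ fun t ω =>
      inner ℝ (grad (fun θ => q f γ s X t θ ω) θ₀) v := fun v => by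
    simp_rw [← fderiv_eq_inner_grad]
    exact IsStationaryFunctional.fderiv_apply hV
      (fun θ hθ => hqstat θ (interior_subset hθ.1))
      (hsm.mono fun ω hω t θ hθ => differentiableAt_of_contDiffOn_two hU (hω.1 t) hθ.2)
      ⟨hθ₀, hθ₀U⟩ v
  -- the linearized estimator `J⁻¹ W_n`, where `W_n` is the normalized score
  have hclt := tendstoInDistribution_inv_apply_sum_martingaleDifference hX
    hmodel.observation_measurable hA3 hscore hA7.2.1 hA7.2.2
  refine tendstoInDistribution_id_of_ae_norm_sub_le hclt (fun n => ?_) ?_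
  · exact (((measurable_EDPE hQmeas hprior.measurable n).sub_const θ₀).const_smul
      (√(n : ℝ))).aemeasurable
  filter_upwards [hpeak, hargmax, hfirst, hA4, hsm] with ω h1 h2 h3 h4 h5 η hη
  -- the proxies may replace the true objective function in the score
  have hgrad : Tendsto (fun n : ℕ => (√(n : ℝ))⁻¹ •
      (∑ t ∈ Finset.Icc 1 n, grad (fun θ => q f γ s X t θ ω) θ₀ -
        grad (fun θ => ∑ t ∈ Finset.Icc 1 n, qProxy f γ σ' X t θ ω) θ₀)) atTop (𝓝 0) := by
    refine squeeze_zero_norm (fun n => ?_) h4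
    rw [norm_smul, norm_inv, Real.norm_of_nonneg (Real.sqrt_nonneg _), grad_sum (Finset.Icc 1 n)
      fun t ht => differentiableAt_of_contDiffOn_two hU (h5.2 t (Finset.mem_Icc.1 ht).1) hθ₀U,
      ← Finset.sum_sub_distrib]
    gcongr
    exact (norm_sum_le _ _).trans (Finset.sum_le_sum fun t _ => norm_le_vecL1 _)
  have hinv : ∀ v, Matrix.toEuclideanCLM (𝕜 := ℝ) (matJ μ θ₀ (q f γ s X))⁻¹
      (Matrix.toEuclideanCLM (𝕜 := ℝ) (matJ μ θ₀ (q f γ s X)) v) = v := fun v => by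
    have hdet : IsUnit (matJ μ θ₀ (q f γ s X)).det := hA7.2.2.det_pos.ne'.isUnit
    rw [← mul_apply_eq_comp, ← map_mul, Matrix.nonsing_inv_mul _ hdet, map_one,
      one_apply_eq_self]
  exact h1.eventually_norm_sqrt_smul_sub_le hθ₀ h2 h3 hgrad hinv hη
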